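/- **Setting.** Let $f=(f(x,n))_{(x,n)\in\mathbb Z^2}$ be a real random field with law $P$ such that: * (T) for all $z\in\mathbb Z^2$, $(f(x+z))_{x}$ has the same law as $f$; * (R) $(-f(-x,n))_{(x,n)}$ has the same law as $f$; * (FKG) $P(A\cap B)\ge P(A)P(B)$ for all increasing events $A,B$; * (decoupling with exponent $\alpha$ and constant $c_1$) for all integers $r\ge 2$, $w,h\ge1$ and every rectangle $C=[a,a+w]\times[b,b+h]\subset\mathbb Z^2$ there is a coupling of $f$ with a field $f^{C,r}$ such that $\Pr(f^{C,r}\ne f)\le\varepsilon(w,h,r)$, and $f^{C,r}|_A$, $f^{C,r}|_B$ are independent whenever $A\subset C$, $B\subset\mathbb Z^2$ have $\ell^1$-distance larger than $r$; moreover $\varepsilon(w,h,r)\le c_1\,(wh+(w+h)r+r^2)\,r^{-\alpha}$. Let $(U_z)$ be i.i.d. uniform on $[0,1]$, independent of $f$; let $\mathbb P$ be the joint law and let $0\le\delta<\frac12-c_0$. Let $\mathbb L_d=\{(x,n)\in\mathbb Z^2: x+n \text{ even}\}$, and let $\mathbb L$ be the union of the segments from each $z\in\mathbb L_d$ to $z+(1,1)$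 and to $z+(-1,1)$. For $u=(u_1,u_2)\in\mathbb R^2$, the walk $X^u$ starts at $X^u_0=u_1$, and its trajectory $t\mapsto(X^u_t,u_2+t)$ moves straight upwards until it meets $\mathbb L$, then follows $\mathbb L$ upwards; at a site $z\in\mathbb L_d$ it takes the edge to $z+(1,1)$ if $U_z\ge\frac12-\delta\,\mathrm{sign} f(z)$, and the edge to $z+(-1,1)$ otherwise. The walk reflected at $\{x=a\}$, started from $u_1\le a$, follows the same rules, except that when it is about to cross the line from left to right it moves straight upwards on the line until it meets a segment of $\mathbb L$ directed to the north-west (if $a\in\mathbb Z$: until the next site of $\mathbb L_d$ on the line from which the step is to the left). For $u\in\mathbb R^2$ and $w,h>0$ let $B^u(w,h)=u+[0,w]\times[0,h]$. Let $H^u(w,h)$ be the event that, for some $v$ in the left face of the box, the trajectory of $X^v$ hits the right face before exiting the box. Let $V^u(w,h)$ be the event that, for some $v$ in the bottom face, the trajectory from $v$ reflected at the line carrying the right face hits the top face before exiting the box. With $\mathcal L_1=\{u\in\mathbb R^2:\|u\|_1\le1\}$, define for $h\ge2$ $$w(h)=\sup\Big\{w\ge1:\ \frac1{\mathrm{Vol}(\mathcal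 L_1)}\int_{\mathcal L_1}\mathbb P(H^u(w,h))\,du\ \ge\ \frac1{\mathrm{Vol}(\mathcal L_1)}\int_{\mathcal L_1}\mathbb P(V^u(w,h))\,du\Big\}.$$ **Proposition (Horizontal RSW).** Fix $\xi\in(0,1)$, $\alpha>1+\xi^{-1}$, $c_0\in(0,\frac12)$ and $c_1>0$. There is a constant $h_0>0$, depending only on $c_0,c_1,\alpha,\xi$, such that for every field $f$ and every $\delta$ as above, and every real $h\ge h_0$ with $w(h)\ge h^{\xi}$, $$\inf_{u\in\mathbb R^2}\mathbb P\Big(H^u\big(\tfrac{259}{256}\,w(h),\,3h\big)\Big)\ \ge\ \frac{c_0^{54}}{2^{10}}.$$ -/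

import Mathlib

open MeasureTheory ProbabilityTheory

noncomputable section

namespace RWDRE

/-! ### The random environment -/

/-- An environment: a real number at each point `(x, n)` of `ℤ²` (space `x`, time `n`). -/
abbrev Env := ℤ × ℤ → ℝ

/-- The law of the environment is invariant under all translations of `ℤ²`. -/
def TranslationInvariant (P : Measure Env) : Prop :=
  ∀ z : ℤ × ℤ, P.map (fun f x => f (x + z)) = P

/-- Symmetry of the environment under reflection about the vertical axis. A reflection exchanges
left and right, hence it turns a push of the walker to the right (positive value of the field)
into a push to the left (negative value): the field `f` has the law of `(x, n) ↦ -f (-x, n)`. -/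
def ReflectionSymmetric (P : Measure Env) : Prop :=
  P.map (fun f x => -f (-x.1, x.2)) = P

/-- The Harris-FKG inequality for increasing events. -/
def FKG (P : Measure Env) : Prop :=
  ∀ A B : Set Env, MeasurableSet A → MeasurableSet B → IsUpperSet A → IsUpperSet B →
    P A * P B ≤ P (A ∩ B)

/-- The `L¹` distance on `ℤ²`. -/
def l1dist (x y : ℤ × ℤ) : ℤ := |x.1 - y.1| + |x.2 - y.2|

/-- The rectangle `[a, a + w] × [b, b + h]` of `ℤ²`. -/
def rect (a b : ℤ) (w h : ℕ) : Set (ℤ × ℤ) :=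
  {x | a ≤ x.1 ∧ x.1 ≤ a + w ∧ b ≤ x.2 ∧ x.2 ≤ b + h}

/-- The decoupling condition with decay rate `ε`: for every rectangle `C` and every `r ≥ 2` there
is a coupling `Q` of the environment (first coordinate, of law `P`) with a second field, equal to
the first one up to probability `ε w h r`, whose restrictions to `A ⊆ C` and to `B` are
independent as soon as the distance between `A` and `B` is larger than `r`. -/
def Decoupling (P : Measure Env) (ε : ℕ → ℕ → ℕ → ℝ) : Prop :=
  ∀ (r : ℕ), 2 ≤ r → ∀ (a b : ℤ) (w h : ℕ), 1 ≤ w → 1 ≤ h →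
    ∃ Q : Measure (Env × Env), IsProbabilityMeasure Q ∧ Q.map Prod.fst = P ∧
      Q.real {p | p.2 ≠ p.1} ≤ ε w h r ∧
      ∀ A B : Set (ℤ × ℤ), A ⊆ rect a b w h →
        (∀ x ∈ A, ∀ y ∈ B, (r : ℤ) < l1dist x y) →
        IndepFun (fun p : Env × Env => A.domRestrict p.2) (fun p : Env × Env => B.domRestrict p.2) Q

/-! ### The annealed probability space -/

/-- The sample space of the graphical construction: an environment together with a number in
`[0, 1]` at each site. (Only the numbers at the sites of the even lattice are ever used by the
walks started on that lattice.) -/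
abbrev Sample := Env × (ℤ × ℤ → unitInterval)

/-- The annealed law: the environment has law `P` and, independently of it, the numbers attached
to the sites are i.i.d. uniform on `[0, 1]`. -/
def annealed (P : Measure Env) : Measure Sample :=
  P.prod (Measure.infinitePi fun _ : ℤ × ℤ => (volume : Measure unitInterval))

/-- The step, `+1` or `-1`, that the walk takes from the site `z`: it is `+1` if and only if
`U_z ≥ 1/2 - δ * sign (f z)`. -/
def jump (δ : ℝ) (ω : Sample) (z : ℤ × ℤ) : ℤ :=
  if 1 / 2 - δ * Real.sign (ω.1 z) ≤ (ω.2 z : ℝ) then 1 else -1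

/-! ### The coupled walks started from all points of the plane

They are defined for an arbitrary field `σ` of steps `±1`. -/

/-- The even lattice `(2ℤ)² ∪ ((1, 1) + (2ℤ)²)`, seen in the plane. -/
def latticePoints : Set (ℝ × ℝ) :=
  {u | ∃ x n : ℤ, Even (x + n) ∧ u = ((x : ℝ), (n : ℝ))}

/-- The even lattice with its (half-open) north-east and north-west edges. -/
def latticeEdges : Set (ℝ × ℝ) :=
  {v | ∃ u ∈ latticePoints, ∃ t : ℝ, 0 ≤ t ∧ t < 1 ∧
    (v = (u.1 + t, u.2 + t) ∨ v = (u.1 - t, u.2 + t))}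

/-- The walk started from the site `(x, n)` at integer times. -/
def discreteWalk (σ : ℤ × ℤ → ℤ) (x n : ℤ) : ℕ → ℤ
  | 0 => x
  | m + 1 => discreteWalk σ x n m + σ (discreteWalk σ x n m, n + m)

/-- Linear interpolation of the walk started from the site `(x, n)`. -/
def latticeWalk (σ : ℤ × ℤ → ℤ) (x n : ℤ) (t : ℝ) : ℝ :=
  discreteWalk σ x n ⌊t⌋₊ +
    (t - ⌊t⌋₊) * ((discreteWalk σ x n (⌊t⌋₊ + 1) : ℝ) - discreteWalk σ x n ⌊t⌋₊)

/-- The horizontal direction (`1` or `-1`) of the edge through a point of an open edge. -/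
def edgeDir (u : ℝ × ℝ) : ℝ := (-1) ^ (⌊u.1⌋ + ⌊u.2⌋)

/-- The time needed to reach the even lattice along the edge through `u`. It is `0` on the even
lattice. -/
def edgeTime (u : ℝ × ℝ) : ℝ :=
  sInf {s | 0 ≤ s ∧ (u.1 + s * edgeDir u, u.2 + s) ∈ latticePoints}

/-- The walk started from a point `u` of `latticeEdges`: it follows its edge up to the even
lattice and the walk on the lattice from then on. -/
def edgeWalk (σ : ℤ × ℤ → ℤ) (u : ℝ × ℝ) (t : ℝ) : ℝ :=
  if t ≤ edgeTime u then u.1 + edgeDir u * t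
  else latticeWalk σ ⌊u.1 + edgeDir u * edgeTime u⌋ ⌊u.2 + edgeTime u⌋ (t - edgeTime u)

/-- The time needed to reach `latticeEdges` from `u` by moving straight upwards. -/
def hitTime (u : ℝ × ℝ) : ℝ :=
  sInf {s | 0 ≤ s ∧ (u.1, u.2 + s) ∈ latticeEdges}

/-- The walk started from an arbitrary point `u` of the plane: it moves straight upwards until it
meets an edge, which it follows from then on. Its position in the plane at time `t` is
`(walk σ u t, u.2 + t)`. -/
def walk (σ : ℤ × ℤ → ℤ) (u : ℝ × ℝ) (t : ℝ) : ℝ :=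
  if t < hitTime u then u.1 else edgeWalk σ (u.1, u.2 + hitTime u) (t - hitTime u)

/-- The field of steps `σ`, where all sites strictly to the right of the line `{x = a}` are made
to point to the left. -/
def barrier (a : ℝ) (σ : ℤ × ℤ → ℤ) (z : ℤ × ℤ) : ℤ :=
  if a < z.1 then -1 else σ z

/-- The walk started from a point `u` with `u.1 ≤ a` and reflected at the line `{x = a}`: whenever
it is about to cross the line from left to right along a north-east edge, it travels straight
upwards on the line until it meets the next north-west edge, and resumes its course from there. If
`a` is an integer, a step to the right from a site of the line is suppressed, and the walk moves
straight upwards to the next site of the line.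

With the sites to the right of the line pointing to the left, a walk that crosses the line along
a north-east edge comes back along precisely the next north-west edge that meets the line, so
that truncating its trajectory at `a` replaces each such excursion by a vertical segment on the
line, as just described. -/
def reflectedWalk (a : ℝ) (σ : ℤ × ℤ → ℤ) (u : ℝ × ℝ) (t : ℝ) : ℝ :=
  min a (walk (barrier a σ) u t)

/-! ### Crossing events -/

/-- `C` is crossed from `A` to `B` by one of the trajectories `t ↦ (X v t, v.2 + t)`: the
trajectory of some `v ∈ A` hits `B` before exiting `C`. -/
def Crossed (X : ℝ × ℝ → ℝ → ℝ) (A B C : Set (ℝ × ℝ)) : Prop :=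
  ∃ v ∈ A, ∃ t : ℝ, 0 ≤ t ∧ (X v t, v.2 + t) ∈ B ∧
    ∀ s : ℝ, 0 ≤ s → s ≤ t → (X v s, v.2 + s) ∈ C

/-- The box `u + [0, w] × [0, h]`. -/
def box (u : ℝ × ℝ) (w h : ℝ) : Set (ℝ × ℝ) :=
  {v | u.1 ≤ v.1 ∧ v.1 ≤ u.1 + w ∧ u.2 ≤ v.2 ∧ v.2 ≤ u.2 + h}

/-- The left face of the box. -/
def leftFace (u : ℝ × ℝ) (w h : ℝ) : Set (ℝ × ℝ) := {v ∈ box u w h | v.1 = u.1}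

/-- The right face of the box. -/
def rightFace (u : ℝ × ℝ) (w h : ℝ) : Set (ℝ × ℝ) := {v ∈ box u w h | v.1 = u.1 + w}

/-- The bottom face of the box. -/
def bottomFace (u : ℝ × ℝ) (w h : ℝ) : Set (ℝ × ℝ) := {v ∈ box u w h | v.2 = u.2}

/-- The top face of the box. -/
def topFace (u : ℝ × ℝ) (w h : ℝ) : Set (ℝ × ℝ) := {v ∈ box u w h | v.2 = u.2 + h}

/-- The event that the box is crossed from left to right. -/
def horizontalCrossing (δ : ℝ) (u : ℝ × ℝ) (w h : ℝ) : Set Sample :=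
  {ω | Crossed (walk (jump δ ω)) (leftFace u w h) (rightFace u w h) (box u w h)}

/-- The event that the box is crossed from bottom to top by a walk reflected at the line that
carries the right face. -/
def verticalCrossing (δ : ℝ) (u : ℝ × ℝ) (w h : ℝ) : Set Sample :=
  {ω | Crossed (reflectedWalk (u.1 + w) (jump δ ω)) (bottomFace u w h) (topFace u w h)
    (box u w h)}

/-! ### The fluctuation scale -/

/-- The unit ball of the `ℓ¹` norm in the plane. -/
def rhombus : Set (ℝ × ℝ) := {u | |u.1| + |u.2| ≤ 1}

/-- The fluctuation scale `w(h)`: the supremum of the widths `w ≥ 1` for which, on average over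
anchors in the rhombus, a box of width `w` and height `h` is at least as likely to be crossed
horizontally as vertically. -/
def fluctuationScale (P : Measure Env) (δ h : ℝ) : ℝ :=
  sSup {w : ℝ | 1 ≤ w ∧
    ⨍ u in rhombus, (annealed P).real (verticalCrossing δ u w h) ≤
      ⨍ u in rhombus, (annealed P).real (horizontalCrossing δ u w h)}

end RWDRE

end

/-!
The arrows followed by the walks on the even lattice form a random field `η : Arrows`. Its law
`arrowLaw` under the annealed measure is invariant under translations and under the reflection
`mirror`, is positively associated, and inherits the decoupling property of the environment
(`mixingLaw_arrowLaw`). The proof is a study of crossings by lattice walks for such a law. Let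
`crossProb ν w T` be the probability that a box of width `w` and height `T` is crossed, and let
`medianWidth ν T` be the largest `w` for which it is at least `1 / 2`.

* A maximal inequality of Lévy's type (`maximal_ineq`): if narrow boxes of height `L` are unlikely
  to be crossed, a walk that has reached a far level is likely to be still close to it at the next
  multiple of `L`, and then, by symmetry, at any later time with probability at least `1 / 2`. So a
  crossing of a box by the reflected walk costs, up to a constant, the same as a large displacement
  of the reflected walk at a deterministic time.
* Read backwards in time, this displacement is a path of the dual system that starts from one point
  and is not reflected (`dual_hit`). The reversed field satisfies the same assumptions, and a second
  use of the maximal inequality turns the event into a large displacement of a walk at a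
  deterministic time, up to an error which is the probability of a crossing of a much wider box
  (`cross_or_displacement`). Displacements over successive time intervals are positively associated
  (`pow_le_real_pos`), so that in all cases wider boxes are crossed with at least a universal
  probability.
* This requires that narrow boxes of height `T / n` are not crossed, that is, that the median width
  drops by a fixed factor between the heights `T` and `T / n`. With nearly independent attempts, a
  drop at one scale implies a drop at the next one, so that without a drop at the height `T` there
  is none at any smaller scale, and the median width would grow more slowly than `T ^ ξ`
  (`exists_crossProb_widen`). The decoupling errors involve rectangles of area of order `T * W` and
  gaps of order `W`, where `W ≥ T ^ ξ / 4` is the median width, and they tend to `0` since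
  `α > 1 + 1 / ξ`.

The walks started from arbitrary points of the plane are given by an explicit formula until they
reach a site (`walk_of_le`, `walk_of_ge`), so that the crossings of the boxes of the plane are, up
to bounded errors on the sizes, crossings by lattice walks. If a box is not crossed vertically, then
it is crossed horizontally after a reflection; hence the widths in the definition of the fluctuation
scale are at most the median width plus a constant (`le_medianWidth_of_average_le`), and
`exists_crossProb_widen` applies, because `259 / 256 < 12 / 10` and `22 / 10 < 3`. The resulting
bound is `1 / 256 ^ 2`, which is at least `c₀ ^ 54 / 2 ^ 10` since `c₀ < 1 / 2`.
-/

noncomputable section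

namespace RWDRE

/-! ### Walks driven by a field of arrows -/

/-- A field of arrows: `true` at a site makes a walk step to the right, `false` to the left. -/
abbrev Arrows := ℤ × ℤ → Bool

/-- The field of steps `±1` that corresponds to a field of arrows. -/
def steps (η : Arrows) (z : ℤ × ℤ) : ℤ := if η z then 1 else -1

/-- The position after `m` steps of the walk started from the site `(x, n)`. -/
def pos (η : Arrows) (x n : ℤ) (m : ℕ) : ℤ := discreteWalk (steps η) x n m

lemma pos_zero (η : Arrows) (x n : ℤ) : pos η x n 0 = x := rfl

lemma pos_succ (η : Arrows) (x n : ℤ) (m : ℕ) :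
    pos η x n (m + 1) = pos η x n m + steps η (pos η x n m, n + m) := rfl

lemma steps_of_true {η : Arrows} {z : ℤ × ℤ} (h : η z = true) : steps η z = 1 := by
  simp [steps, h]

lemma steps_eq (η : Arrows) (z : ℤ × ℤ) :
    (η z = true ∧ steps η z = 1) ∨ (η z = false ∧ steps η z = -1) := by
  cases h : η z <;> simp [steps, h]

lemma pos_add (η : Arrows) (x n : ℤ) (m k : ℕ) :
    pos η x n (m + k) = pos η (pos η x n m) (n + m) k := by
  induction k with
  | zero => rfl
  | succ k ih =>
    rw [← add_assoc, pos_succ, ih, pos_succ]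
    push_cast
    rw [add_assoc]

lemma pos_le (η : Arrows) (x n : ℤ) (m : ℕ) : pos η x n m ≤ x + m := by
  induction m with
  | zero => simp [pos_zero]
  | succ m ih =>
    rw [pos_succ]
    rcases steps_eq η (pos η x n m, n + m) with h | h <;> push_cast <;> omega

lemma le_pos (η : Arrows) (x n : ℤ) (m : ℕ) : x - m ≤ pos η x n m := by
  induction m with
  | zero => simp [pos_zero]
  | succ m ih =>
    rw [pos_succ]
    rcases steps_eq η (pos η x n m, n + m) with h | h <;> push_cast <;> omega

lemma pos_parity (η : Arrows) (x n : ℤ) (m : ℕ) : (pos η x n m - x - m) % 2 = 0 := by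
  induction m with
  | zero => simp [pos_zero]
  | succ m ih =>
    rw [pos_succ]
    rcases steps_eq η (pos η x n m, n + m) with h | h <;> push_cast <;> omega

/-- Walks on the same sublattice keep their order, and the walk is monotone in the arrows. -/
lemma pos_mono {η η' : Arrows} (hη : η ≤ η') {x x' : ℤ} (n : ℤ) (hx : x ≤ x')
    (hp : (x' - x) % 2 = 0) (m : ℕ) : pos η x n m ≤ pos η' x' n m := by
  induction m with
  | zero => simpa [pos_zero]
  | succ m ih =>
    rw [pos_succ, pos_succ]
    have h1 := pos_parity η x n m
    have h2 := pos_parity η' x' n m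
    rcases steps_eq η (pos η x n m, n + m) with h | h <;>
    rcases steps_eq η' (pos η' x' n m, n + m) with h' | h'
    · omega
    · rcases ih.lt_or_eq with hlt | heq
      · omega
      · have := hη (pos η x n m, n + m)
        rw [h.1, heq, h'.1] at this
        exact absurd this (by simp)
    · omega
    · omega

lemma pos_congr {η η' : Arrows} {x n : ℤ} {m : ℕ}
    (h : ∀ i < m, η (pos η x n i, n + i) = η' (pos η x n i, n + i)) :
    ∀ i ≤ m, pos η x n i = pos η' x n i := by
  intro i
  induction i with
  | zero => intro _; rfl
  | succ i ih =>
    intro hi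
    have e := ih (by omega)
    rw [pos_succ, pos_succ, ← e]
    simp only [steps, h i (by omega)]

/-- The space-time box that contains the sites seen by `m` steps of the walk from `(x, n)`. -/
def lightBox (x n : ℤ) (m : ℕ) : Finset (ℤ × ℤ) :=
  Finset.Icc (x - m) (x + m) ×ˢ Finset.Ico n (n + m)

lemma mem_lightBox {x n : ℤ} {m : ℕ} {z : ℤ × ℤ} :
    z ∈ lightBox x n m ↔ (x - m ≤ z.1 ∧ z.1 ≤ x + m) ∧ n ≤ z.2 ∧ z.2 < n + m := by
  simp [lightBox]

lemma pos_congr_lightBox {η η' : Arrows} {x n : ℤ} {m : ℕ}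
    (h : ∀ z ∈ lightBox x n m, η z = η' z) {i : ℕ} (hi : i ≤ m) : pos η x n i = pos η' x n i := by
  refine pos_congr (fun j hj => h _ ?_) i hi
  rw [mem_lightBox]
  have h1 := pos_le η x n j
  have h2 := le_pos η x n j
  refine ⟨⟨?_, ?_⟩, ?_, ?_⟩ <;> simp only <;> omega

/-! ### Barriers, translations and reflections -/

/-- Make all sites to the left of `lo` point to the right. -/
def floorAt (lo : ℤ) (η : Arrows) : Arrows := fun z => decide (z.1 < lo) || η z

/-- Make all sites to the right of `hi` point to the left. -/
def ceilAt (hi : ℤ) (η : Arrows) : Arrows := fun z => decide (z.1 ≤ hi) && η z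

/-- Confine the walks to the strip between `lo` and `hi` by two reflecting barriers. -/
def clamp (lo hi : ℤ) (η : Arrows) : Arrows := floorAt lo (ceilAt hi η)

lemma floorAt_mono {lo lo' : ℤ} (h : lo ≤ lo') {η η' : Arrows} (hη : η ≤ η') :
    floorAt lo η ≤ floorAt lo' η' := by
  intro z
  have := hη z
  simp only [floorAt, Bool.le_iff_imp, Bool.or_eq_true, decide_eq_true_eq] at *
  rintro (h1 | h1)
  · left; omega
  · exact Or.inr (this h1)

lemma ceilAt_mono {hi hi' : ℤ} (h : hi ≤ hi') {η η' : Arrows} (hη : η ≤ η') :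
    ceilAt hi η ≤ ceilAt hi' η' := by
  intro z
  have := hη z
  simp only [ceilAt, Bool.le_iff_imp, Bool.and_eq_true, decide_eq_true_eq] at *
  rintro ⟨h1, h2⟩
  exact ⟨by omega, this h2⟩

lemma le_floorAt (lo : ℤ) (η : Arrows) : η ≤ floorAt lo η := by
  intro z
  simp only [floorAt, Bool.le_iff_imp, Bool.or_eq_true]
  exact Or.inr

lemma ceilAt_le (hi : ℤ) (η : Arrows) : ceilAt hi η ≤ η := by
  intro z
  simp only [ceilAt, Bool.le_iff_imp, Bool.and_eq_true]
  exact And.right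

lemma clamp_mono {lo lo' hi hi' : ℤ} (h : lo ≤ lo') (h' : hi ≤ hi') {η η' : Arrows}
    (hη : η ≤ η') : clamp lo hi η ≤ clamp lo' hi' η' :=
  floorAt_mono h (ceilAt_mono h' hη)

lemma ceilAt_le_clamp (lo hi : ℤ) (η : Arrows) : ceilAt hi η ≤ clamp lo hi η := le_floorAt _ _

lemma clamp_le_floorAt (lo hi : ℤ) (η : Arrows) : clamp lo hi η ≤ floorAt lo η :=
  floorAt_mono le_rfl (ceilAt_le _ _)

lemma floorAt_of_lt {lo : ℤ} {η : Arrows} {z : ℤ × ℤ} (h : z.1 < lo) : floorAt lo η z = true := by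
  simp [floorAt, h]

lemma floorAt_of_le {lo : ℤ} {η : Arrows} {z : ℤ × ℤ} (h : lo ≤ z.1) : floorAt lo η z = η z := by
  simp [floorAt, h]

/-- The arrows seen from the site `c`. -/
def shift (c : ℤ × ℤ) (η : Arrows) : Arrows := fun z => η (z + c)

/-- Reflection about the vertical axis; it reverses the arrows. -/
def mirror (η : Arrows) : Arrows := fun z => !η (-z.1, z.2)

/-- Reflection through the origin. The arrows are kept: a walk in `rev η` describes, read
backwards in time, a path of the dual system of `η`. -/
def rev (η : Arrows) : Arrows := fun z => η (-z)

lemma rev_rev (η : Arrows) : rev (rev η) = η := by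
  funext z; simp [rev]

lemma clamp_shift (lo hi : ℤ) (c : ℤ × ℤ) (η : Arrows) :
    clamp lo hi (shift c η) = shift c (clamp (lo + c.1) (hi + c.1) η) := by
  funext z
  simp [clamp, floorAt, ceilAt, shift]

lemma pos_shift (c : ℤ × ℤ) (η : Arrows) (x n : ℤ) (m : ℕ) :
    pos (shift c η) x n m = pos η (x + c.1) (n + c.2) m - c.1 := by
  induction m with
  | zero => simp [pos_zero]
  | succ m ih =>
    have e : steps (shift c η) (pos η (x + c.1) (n + c.2) m - c.1, n + m)
        = steps η (pos η (x + c.1) (n + c.2) m, n + c.2 + m) := by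
      have : (pos η (x + c.1) (n + c.2) m - c.1, n + (m : ℤ)) + c
          = (pos η (x + c.1) (n + c.2) m, n + c.2 + m) := by ext <;> simp; ring
      simp only [steps, shift, this]
    rw [pos_succ, pos_succ, ih, e]
    ring

lemma pos_mirror (η : Arrows) (x n : ℤ) (m : ℕ) :
    pos (mirror η) x n m = - pos η (-x) n m := by
  induction m with
  | zero => simp [pos_zero]
  | succ m ih =>
    rw [pos_succ, pos_succ, ih]
    simp only [steps, mirror, neg_neg]
    cases η (pos η (-x) n m, n + m) <;> simp <;> ring

/-! ### Comparison with a walk reflected at a barrier -/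

lemma le_pos_floorAt {lo x : ℤ} (hx : lo - 1 ≤ x) (η : Arrows) (n : ℤ) (m : ℕ) :
    lo - 1 ≤ pos (floorAt lo η) x n m := by
  induction m with
  | zero => exact hx
  | succ m ih =>
    rw [pos_succ]
    rcases ih.lt_or_eq with h | h
    · rcases steps_eq (floorAt lo η) (pos (floorAt lo η) x n m, n + m) with h' | h' <;> omega
    · rw [steps_of_true (floorAt_of_lt (by simp only; omega))]; omega

/-- A walk reflected at `lo` dominates every walk that starts later, to the left of `lo`. -/
lemma pos_le_pos_floorAt {η η' : Arrows} {lo : ℤ} (hη : η ≤ floorAt lo η') {x n n' : ℤ}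
    (hx : x ≤ lo) {k : ℕ} (hn : n' + k = n) (hp : (x + n - (lo + n')) % 2 = 0) (m : ℕ) :
    pos η x n m ≤ pos (floorAt lo η') lo n' (k + m) := by
  rw [pos_add, hn]
  have h1 := le_pos_floorAt (lo := lo) (x := lo) (by omega) η' n' k
  have h2 := pos_parity (floorAt lo η') lo n' k
  exact pos_mono hη n (by omega) (by omega) m

/-- Reaching the level `w` only depends on the arrows to the left of `w`. -/
lemma hit_congr {η η' : Arrows} {w x n : ℤ} {T : ℕ}
    (h : ∀ z : ℤ × ℤ, z.1 < w → n ≤ z.2 → z.2 < n + T → η z = η' z)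
    (hit : ∃ t ≤ T, w ≤ pos η x n t) : ∃ t ≤ T, w ≤ pos η' x n t := by
  by_contra hcon
  push Not at hcon
  obtain ⟨t, ht, hw⟩ := hit
  have := pos_congr (η := η') (η' := η) (x := x) (n := n) (m := t)
    (fun i hi => (h _ (hcon i (by omega)) (by simp) (by simp only; omega)).symm) t le_rfl
  have := hcon t ht
  omega

lemma clamp_eq_floorAt {lo hi : ℤ} {η : Arrows} {z : ℤ × ℤ} (h : z.1 ≤ hi) :
    clamp lo hi η z = floorAt lo η z := by
  simp [clamp, floorAt, ceilAt, h]

/-- Before the level `w` is reached, a barrier at or beyond `w` is not felt. -/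
lemma hit_clamp_iff {lo hi w x n : ℤ} (h : w ≤ hi + 1) (η : Arrows) (T : ℕ) :
    (∃ t ≤ T, w ≤ pos (clamp lo hi η) x n t) ↔ ∃ t ≤ T, w ≤ pos (floorAt lo η) x n t :=
  ⟨hit_congr fun z hz _ _ => clamp_eq_floorAt (by omega),
    hit_congr fun z hz _ _ => (clamp_eq_floorAt (by omega)).symm⟩

/-- A walk that reaches `w` from the left is exactly at `w` at some time. -/
lemma exists_eq_of_hit {η : Arrows} {w x n : ℤ} (hx : x ≤ w) {T : ℕ}
    (hit : ∃ t ≤ T, w ≤ pos η x n t) : ∃ t ≤ T, pos η x n t = w := by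
  obtain ⟨t, ht, hw⟩ := hit
  induction t with
  | zero => exact ⟨0, by omega, by rw [pos_zero] at *; omega⟩
  | succ t ih =>
    by_cases h : w ≤ pos η x n t
    · exact ih (by omega) h
    · refine ⟨t + 1, ht, ?_⟩
      rw [pos_succ] at *
      rcases steps_eq η (pos η x n t, n + t) with h' | h' <;> omega

/-! ### Crossings -/

/-- The event that the box `[0, w] × [0, T]` is crossed from left to right, expressed by the walk
that starts from the origin and is reflected at the left side of the box. -/
def Cross (w : ℤ) (T : ℕ) : Set Arrows := {η | ∃ t ≤ T, w ≤ pos (clamp 0 w η) 0 0 t}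

lemma mem_cross {w : ℤ} {T : ℕ} {η : Arrows} :
    η ∈ Cross w T ↔ ∃ t ≤ T, w ≤ pos (floorAt 0 η) 0 0 t := by
  rw [Cross, Set.mem_ofPred_eq, hit_clamp_iff (by omega)]

lemma cross_mono_time {w : ℤ} {T T' : ℕ} (h : T ≤ T') : Cross w T ⊆ Cross w T' := by
  rintro η ⟨t, ht, hw⟩
  exact ⟨t, ht.trans h, hw⟩

lemma cross_anti_width {w w' : ℤ} (T : ℕ) (h : w ≤ w') : Cross w' T ⊆ Cross w T := by
  intro η hη
  rw [mem_cross] at *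
  obtain ⟨t, ht, hw⟩ := hη
  exact ⟨t, ht, h.trans hw⟩

lemma cross_of_path {η η' : Arrows} (hη : η ≤ floorAt 0 η') {w x n : ℤ} {T m : ℕ} (hx : x ≤ 0)
    (hn : 0 ≤ n) (hp : (x + n) % 2 = 0) (hT : n + m ≤ T) (hw : w ≤ pos η x n m) :
    η' ∈ Cross w T := by
  rw [mem_cross]
  obtain ⟨k, rfl⟩ := Int.eq_ofNat_of_zero_le hn
  refine ⟨k + m, by omega, hw.trans ?_⟩
  exact pos_le_pos_floorAt hη hx (by simp) (by omega) m

lemma not_mem_cross {w : ℤ} {T : ℕ} (h : (T : ℤ) < w) (η : Arrows) : η ∉ Cross w T := by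
  rintro ⟨t, ht, hw⟩
  have := pos_le (clamp 0 w η) 0 0 t
  omega

/-- A crossing by the reflected walk contains a crossing by a walk that does not feel the
barrier: it starts from the last visit to the left side. -/
lemma exists_path_of_floor (η : Arrows) (t : ℕ) (h : 0 ≤ pos (floorAt 0 η) 0 0 t) :
    ∃ s ≤ t, s % 2 = 0 ∧ pos η 0 s (t - s) = pos (floorAt 0 η) 0 0 t ∧
      ∀ i ≤ t - s, 0 ≤ pos η 0 s i := by
  induction t with
  | zero => exact ⟨0, le_rfl, rfl, rfl, fun i hi => by
      have : i = 0 := by omega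
      subst this; simp [pos_zero]⟩
  | succ t ih =>
    have hlow := le_pos_floorAt (lo := 0) (x := 0) (by omega) η 0 t
    have hpar := pos_parity (floorAt 0 η) 0 0 t
    rw [pos_succ] at h ⊢
    by_cases h0 : 0 ≤ pos (floorAt 0 η) 0 0 t
    · obtain ⟨s, hs, hs2, he, hpos⟩ := ih h0
      have hstep : pos η 0 s (t + 1 - s) = pos (floorAt 0 η) 0 0 t +
          steps (floorAt 0 η) (pos (floorAt 0 η) 0 0 t, 0 + t) := by
        rw [show t + 1 - s = (t - s) + 1 by omega, pos_succ, he]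
        simp only [steps, floorAt_of_le (z := (pos (floorAt 0 η) 0 0 t, 0 + (t : ℤ))) h0]
        rw [show (s : ℤ) + ((t - s : ℕ) : ℤ) = 0 + t by omega]
      refine ⟨s, by omega, hs2, hstep, fun i hi => ?_⟩
      rcases (show i ≤ t - s ∨ i = t + 1 - s by omega) with hi | rfl
      · exact hpos i hi
      · rw [hstep]; exact h
    · have e : pos (floorAt 0 η) 0 0 t = -1 := by omega
      refine ⟨t + 1, le_rfl, by omega, ?_, fun i hi => ?_⟩
      · rw [e, steps_of_true (floorAt_of_lt (by simp))]; simp [pos_zero]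
      · have : i = 0 := by omega
        subst this; simp [pos_zero]

/-! ### The dual system -/

/-- Paths of a field and of its dual do not cross. If the walk reflected at `0` is beyond `w`
at time `T`, then the dual path that starts just to the left of `w` at time `T` gets to the left
of `0`. -/
lemma dual_hit {η : Arrows} {w : ℤ} {T : ℕ} (hp : (w + T) % 2 = 0)
    (h : w ≤ pos (floorAt 0 η) 0 0 T) :
    ∃ s ≤ T, w ≤ pos (shift (-(w - 1), -((T : ℤ) - 1)) (rev η)) 0 0 s := by
  set ζ := shift (-(w - 1), -((T : ℤ) - 1)) (rev η) with hζ
  have hval : ∀ z : ℤ × ℤ, ζ z = η (w - 1 - z.1, T - 1 - z.2) := by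
    intro z
    simp only [hζ, shift, rev]
    congr 1
    ext <;> simp <;> ring
  by_contra hcon
  push Not at hcon
  have key : ∀ n ≤ T, pos (floorAt 0 η) 0 0 n + pos ζ 0 0 (T - n) < w - 1 := by
    intro n
    induction n with
    | zero =>
      intro _
      have h1 := hcon T le_rfl
      have h2 := pos_parity ζ 0 0 T
      simp only [pos_zero, Nat.sub_zero]
      omega
    | succ n ih =>
      intro hn
      have ih := ih (by omega)
      have hs := hcon (T - (n + 1)) (by omega)
      rw [show T - n = (T - (n + 1)) + 1 by omega, pos_succ] at ih
      rw [pos_succ]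
      have p1 := pos_parity (floorAt 0 η) 0 0 n
      have p2 := pos_parity ζ 0 0 (T - (n + 1))
      rcases steps_eq ζ (pos ζ 0 0 (T - (n + 1)), 0 + ((T - (n + 1) : ℕ) : ℤ)) with a | a <;>
      rcases steps_eq (floorAt 0 η) (pos (floorAt 0 η) 0 0 n, 0 + (n : ℤ)) with b | b
      · omega
      · omega
      · rw [hval] at a
        by_cases hc : pos (floorAt 0 η) 0 0 n = w - 1 - pos ζ 0 0 (T - (n + 1))
        · exfalso
          have hb := b.1
          rw [floorAt_of_le (by simp only; omega), hc] at hb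
          have ha := a.1
          simp only at ha
          rw [show (T : ℤ) - 1 - (0 + ((T - (n + 1) : ℕ) : ℤ)) = 0 + n by omega] at ha
          rw [ha] at hb
          exact absurd hb (by decide)
        · omega
      · omega
  have := key T le_rfl
  simp only [Nat.sub_self, pos_zero] at this
  omega

/-- Crossings of a box, seen upside down. -/
lemma dual_cross {η : Arrows} {w : ℤ} {T : ℕ} (hw : w % 2 = 0) (hw0 : 0 ≤ w) (hT : T % 2 = 0)
    (h : η ∈ Cross w T) : shift (-(w - 1), -((T : ℤ) - 1)) (rev η) ∈ Cross w T := by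
  rw [mem_cross] at h
  obtain ⟨t, ht, he⟩ := exists_eq_of_hit hw0 h
  have hpar := pos_parity (floorAt 0 η) 0 0 t
  obtain ⟨s, hs, hs'⟩ := dual_hit (T := t) (by omega) he.ge
  have e : shift (-(w - 1), -((t : ℤ) - 1)) (rev η)
      = shift (0, (T : ℤ) - t) (shift (-(w - 1), -((T : ℤ) - 1)) (rev η)) := by
    funext z
    simp only [shift]
    congr 1
    ext
    · simp
    · simp only [Prod.snd_add]; ring
  rw [e, pos_shift] at hs'
  refine cross_of_path (η := shift (-(w - 1), -((T : ℤ) - 1)) (rev η)) (x := 0)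
    (n := (T : ℤ) - t) (m := s) (le_floorAt _ _) le_rfl (by omega) (by omega) (by omega) ?_
  simpa using hs'

/-- A walk reflected far to the left either does not feel the barrier, or has joined the walk
that starts from the barrier. -/
lemma pos_floorAt_eq_or (lo : ℤ) (hlo : lo ≤ 0) (hp : lo % 2 = 0) (η : Arrows) (t : ℕ) :
    pos (floorAt lo η) 0 0 t = pos η 0 0 t ∨
      pos (floorAt lo η) 0 0 t = pos (floorAt lo η) lo 0 t := by
  induction t with
  | zero => left; rfl
  | succ t ih =>
    rcases ih with h | h
    · by_cases h' : lo ≤ pos (floorAt lo η) 0 0 t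
      · left
        rw [pos_succ, pos_succ, ← h]
        simp only [steps, floorAt_of_le (z := (pos (floorAt lo η) 0 0 t, 0 + (t : ℤ))) h']
      · right
        have h1 := le_pos_floorAt (lo := lo) (x := lo) (by omega) η 0 t
        have h2 := pos_mono (le_refl (floorAt lo η)) 0 hlo (by omega) t
        rw [pos_succ, pos_succ, show pos (floorAt lo η) 0 0 t = pos (floorAt lo η) lo 0 t by omega]
    · right
      rw [pos_succ, pos_succ, h]

/-! ### Events that depend on few arrows -/

/-- The event `E` is determined by the arrows at the sites of `S`. -/
def DetBy (S : Set (ℤ × ℤ)) (E : Set Arrows) : Prop :=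
  ∀ ⦃η η' : Arrows⦄, (∀ z ∈ S, η z = η' z) → η ∈ E → η' ∈ E

namespace DetBy

variable {S S' : Set (ℤ × ℤ)} {E F : Set Arrows}

lemma mono (h : DetBy S E) (hS : S ⊆ S') : DetBy S' E :=
  fun _ _ h' hE => h (fun z hz => h' z (hS hz)) hE

lemma inter (h : DetBy S E) (h' : DetBy S F) : DetBy S (E ∩ F) :=
  fun _ _ e hE => ⟨h e hE.1, h' e hE.2⟩

lemma compl (h : DetBy S E) : DetBy S Eᶜ :=
  fun _ _ e hE hE' => hE (h (fun z hz => (e z hz).symm) hE')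

lemma diff (h : DetBy S E) (h' : DetBy S F) : DetBy S (E \ F) := h.inter h'.compl

lemma measurableSet (hS : S.Finite) (h : DetBy S E) : MeasurableSet E := by
  have : Finite S := hS
  have e : E = S.domRestrict ⁻¹' (S.domRestrict '' E) := by
    refine Set.Subset.antisymm (Set.subset_preimage_image _ _) ?_
    rintro η ⟨η', hη', he⟩
    exact h (fun z hz => congrFun he ⟨z, hz⟩) hη'
  rw [e]
  refine MeasurableSet.preimage (Set.toFinite _).measurableSet ?_
  exact measurable_pi_lambda _ fun z => measurable_pi_apply _

end DetBy

lemma detBy_of_pos {f : Arrows → Arrows} {x n : ℤ} {m : ℕ} {S : Set (ℤ × ℤ)} {E : Set Arrows}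
    (hf : ∀ η η' : Arrows, (∀ z ∈ S, η z = η' z) → ∀ z ∈ lightBox x n m, f η z = f η' z)
    (hE : ∀ η η' : Arrows, (∀ i ≤ m, pos (f η) x n i = pos (f η') x n i) → η ∈ E → η' ∈ E) :
    DetBy S E :=
  fun η η' h hη => hE η η' (fun _ hi => pos_congr_lightBox (hf η η' h) hi) hη

lemma clamp_congr {lo hi : ℤ} {η η' : Arrows} {z : ℤ × ℤ}
    (h : lo ≤ z.1 → z.1 ≤ hi → η z = η' z) : clamp lo hi η z = clamp lo hi η' z := by
  by_cases h1 : z.1 < lo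
  · simp [clamp, floorAt, h1]
  · by_cases h2 : z.1 ≤ hi
    · simp [clamp, floorAt, ceilAt, h1, h2, h (by omega) h2]
    · simp [clamp, floorAt, ceilAt, h2]

/-- The sites of a vertical strip during the times `0, …, T - 1`. -/
def strip (lo hi : ℤ) (T : ℕ) : Set (ℤ × ℤ) := {z | (lo ≤ z.1 ∧ z.1 ≤ hi) ∧ 0 ≤ z.2 ∧ z.2 < T}

lemma finite_strip (lo hi : ℤ) (T : ℕ) : (strip lo hi T).Finite := by
  refine (Finset.finite_toSet (Finset.Icc lo hi ×ˢ Finset.Ico 0 (T : ℤ))).subset ?_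
  rintro z hz
  simpa [strip] using hz

lemma strip_mono {lo hi : ℤ} {T T' : ℕ} (h : T ≤ T') : strip lo hi T ⊆ strip lo hi T' :=
  fun _ hz => ⟨hz.1, hz.2.1, by have := hz.2.2; omega⟩

lemma detBy_clamp_strip {lo hi x : ℤ} {T : ℕ} {E : Set Arrows}
    (hE : ∀ η η' : Arrows, (∀ i ≤ T, pos (clamp lo hi η) x 0 i = pos (clamp lo hi η') x 0 i) →
      η ∈ E → η' ∈ E) : DetBy (strip lo hi T) E := by
  refine detBy_of_pos (f := clamp lo hi) (x := x) (n := 0) (m := T) (fun η η' h z hz => ?_) hE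
  rw [mem_lightBox] at hz
  exact clamp_congr fun h1 h2 => h z ⟨⟨h1, h2⟩, hz.2.1, by simpa using hz.2.2⟩

lemma detBy_cross (w : ℤ) (T : ℕ) : DetBy (strip 0 w T) (Cross w T) := by
  refine detBy_clamp_strip (x := 0) fun η η' h => ?_
  rintro ⟨t, ht, hw⟩
  exact ⟨t, ht, by rwa [← h t ht]⟩

lemma measurableSet_cross (w : ℤ) (T : ℕ) : MeasurableSet (Cross w T) :=
  (detBy_cross w T).measurableSet (finite_strip _ _ _)

lemma detBy_pos {f : Arrows → Arrows}
    (hf : ∀ (η η' : Arrows) (z : ℤ × ℤ), η z = η' z → f η z = f η' z) {x n : ℤ} {m : ℕ}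
    {E : Set Arrows}
    (hE : ∀ η η' : Arrows, (∀ i ≤ m, pos (f η) x n i = pos (f η') x n i) → η ∈ E → η' ∈ E) :
    DetBy (lightBox x n m) E :=
  detBy_of_pos (f := f) (fun η η' h z hz => hf η η' z (h z (by exact_mod_cast hz))) hE

lemma ceilAt_congr (hi : ℤ) (η η' : Arrows) (z : ℤ × ℤ) (h : η z = η' z) :
    ceilAt hi η z = ceilAt hi η' z := by simp [ceilAt, h]

lemma measurable_shift (c : ℤ × ℤ) : Measurable (shift c) :=
  measurable_pi_lambda _ fun _ => measurable_pi_apply _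

lemma measurable_rev : Measurable rev :=
  measurable_pi_lambda _ fun _ => measurable_pi_apply _

lemma measurable_mirror : Measurable mirror :=
  measurable_pi_lambda _ fun z =>
    (measurable_of_countable (fun b : Bool => !b)).comp (measurable_pi_apply (-z.1, z.2))

/-! ### Laws of fields of arrows -/

/-- The symmetries and the positive association of the law of a field of arrows. -/
structure GoodLaw (ν : Measure Arrows) : Prop where
  isProb : IsProbabilityMeasure ν
  map_shift : ∀ c, ν.map (shift c) = ν
  map_mirror : ν.map mirror = ν
  fkg : ∀ (S : Finset (ℤ × ℤ)) (E F : Set Arrows), DetBy S E → DetBy S F → IsUpperSet E →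
    IsUpperSet F → ν.real E * ν.real F ≤ ν.real (E ∩ F)

/-- Quantitative decoupling: if `A` is contained in a rectangle of width `wd` and height `ht`, and
if `B` is at distance larger than `r` of `A`, then the arrows in `A` and in `B` are independent up
to an error `τ`. The condition is stated for unions of rectangles of events, so that an event that
concerns `B` may be chosen according to the state of the arrows in `A`, at the price of a single
error term. -/
def MixesAt (ν : Measure Arrows) (wd ht r : ℕ) (τ : ℝ) : Prop :=
  ∀ (a b : ℤ) (A B : Set (ℤ × ℤ)), A ⊆ rect a b wd ht → (∀ x ∈ A, ∀ y ∈ B, (r : ℤ) < l1dist x y) →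
    ∀ (s : Finset ℤ) (E F : ℤ → Set Arrows),
      (∀ i ∈ s, MeasurableSet (E i) ∧ MeasurableSet (F i) ∧ DetBy A (E i) ∧ DetBy B (F i)) →
      (s : Set ℤ).PairwiseDisjoint E →
      |ν.real (⋃ i ∈ s, E i ∩ F i) - ∑ i ∈ s, ν.real (E i) * ν.real (F i)| ≤ τ

lemma MixesAt.pair {ν : Measure Arrows} {wd ht r : ℕ} {τ : ℝ} (h : MixesAt ν wd ht r τ) {a b : ℤ}
    {A B : Set (ℤ × ℤ)} (hA : A ⊆ rect a b wd ht) (hAB : ∀ x ∈ A, ∀ y ∈ B, (r : ℤ) < l1dist x y)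
    {E F : Set Arrows} (hE : MeasurableSet E) (hF : MeasurableSet F) (hEA : DetBy A E)
    (hFB : DetBy B F) : |ν.real (E ∩ F) - ν.real E * ν.real F| ≤ τ := by
  have := h a b A B hA hAB {0} (fun _ => E) (fun _ => F) (fun _ _ => ⟨hE, hF, hEA, hFB⟩)
    (by simp)
  simpa using this

lemma MixesAt.nonneg {ν : Measure Arrows} {wd ht r : ℕ} {τ : ℝ} (h : MixesAt ν wd ht r τ) :
    0 ≤ τ :=
  (abs_nonneg _).trans (h.pair (a := 0) (b := 0) (A := ∅) (B := ∅) (by simp) (by simp)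
    MeasurableSet.empty MeasurableSet.empty (fun _ _ _ h => h) (fun _ _ _ h => h))

lemma MixesAt.mono {ν : Measure Arrows} {wd ht wd' ht' r : ℕ} {τ : ℝ} (h : MixesAt ν wd' ht' r τ)
    (hw : wd ≤ wd') (hh : ht ≤ ht') : MixesAt ν wd ht r τ := by
  intro a b A B hA hAB
  refine h a b A B (hA.trans ?_) hAB
  rintro z ⟨h1, h2, h3, h4⟩
  exact ⟨h1, by omega, h3, by omega⟩

lemma MixesAt.weaken {ν : Measure Arrows} {wd ht r : ℕ} {τ τ' : ℝ} (h : MixesAt ν wd ht r τ)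
    (hτ : τ ≤ τ') : MixesAt ν wd ht r τ' :=
  fun a b A B hA hAB s E F hEF hd => (h a b A B hA hAB s E F hEF hd).trans hτ

lemma lt_l1dist_of_time {r : ℕ} {x y : ℤ × ℤ} {t : ℤ} (hx : x.2 < t) (hy : t + r ≤ y.2) :
    (r : ℤ) < l1dist x y := by
  have h1 := abs_nonneg (x.1 - y.1)
  have h2 := neg_abs_le (x.2 - y.2)
  simp only [l1dist]
  omega

lemma strip_subset_rect {k w T : ℕ} : strip (-(k : ℤ)) w T ⊆ rect (-(k : ℤ)) 0 (k + w) T := by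
  rintro z ⟨⟨h1, h2⟩, h3, h4⟩
  exact ⟨h1, by push_cast; omega, h3, by omega⟩

namespace GoodLaw

variable {ν : Measure Arrows}

lemma real_shift (hν : GoodLaw ν) (c : ℤ × ℤ) {E : Set Arrows} (hE : MeasurableSet E) :
    ν.real (shift c ⁻¹' E) = ν.real E := by
  conv_rhs => rw [← hν.map_shift c]
  rw [map_measureReal_apply (measurable_shift c) hE]

lemma real_mirror (hν : GoodLaw ν) {E : Set Arrows} (hE : MeasurableSet E) :
    ν.real (mirror ⁻¹' E) = ν.real E := by
  conv_rhs => rw [← hν.map_mirror]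
  rw [map_measureReal_apply measurable_mirror hE]

/-- By symmetry, a walk is to the right of its starting point with probability at least `1/2`. -/
lemma half_le (hν : GoodLaw ν) (x n : ℤ) (m : ℕ) : 1 / 2 ≤ ν.real {η | x ≤ pos η x n m} := by
  have := hν.isProb
  have hm : ∀ n, MeasurableSet {η : Arrows | 0 ≤ pos η 0 n m} := fun n =>
    (detBy_pos (f := id) (fun _ _ _ h => h) (x := 0) (n := n) (m := m)
      fun η η' h (hη : 0 ≤ pos η 0 n m) =>
        (hη.trans_eq (h m le_rfl) : 0 ≤ pos η' 0 n m)).measurableSet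
      (Finset.finite_toSet _)
  have h1 : {η : Arrows | x ≤ pos η x n m} = shift (x, 0) ⁻¹' {η | 0 ≤ pos η 0 n m} := by
    ext η
    simp [pos_shift]
  rw [h1, hν.real_shift _ (hm n)]
  have h2 : ν.real (mirror ⁻¹' {η : Arrows | 0 ≤ pos η 0 n m}) = _ := hν.real_mirror (hm n)
  have h3 : (Set.univ : Set Arrows) ⊆
      {η | 0 ≤ pos η 0 n m} ∪ mirror ⁻¹' {η | 0 ≤ pos η 0 n m} := by
    intro η _
    simp only [Set.mem_union, Set.mem_preimage, Set.mem_ofPred_eq, pos_mirror, neg_zero]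
    omega
  have h4 := (measureReal_mono h3 (μ := ν)).trans (measureReal_union_le _ _)
  rw [h2, probReal_univ] at h4
  linarith

end GoodLaw

/-- The probability that the box `[0, w] × [0, T]` is crossed. -/
def crossProb (ν : Measure Arrows) (w : ℤ) (T : ℕ) : ℝ := ν.real (Cross w T)

lemma crossProb_mono_time {ν : Measure Arrows} [IsProbabilityMeasure ν] {w : ℤ} {T T' : ℕ}
    (h : T ≤ T') : crossProb ν w T ≤ crossProb ν w T' := measureReal_mono (cross_mono_time h)

lemma crossProb_anti_width {ν : Measure Arrows} [IsProbabilityMeasure ν] {w w' : ℤ} {T : ℕ}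
    (h : w ≤ w') : crossProb ν w' T ≤ crossProb ν w T := measureReal_mono (cross_anti_width T h)

/-! ### A maximal inequality -/

section Levy

variable {ν : Measure Arrows} {k w b r L n : ℕ} {τ : ℝ}

/-- The walk started from the origin, in the strip between `-k` and `w`. -/
def stripWalk (k w : ℕ) (η : Arrows) (t : ℕ) : ℤ := pos (clamp (-(k : ℤ)) w η) 0 0 t

lemma stripWalk_add (k w : ℕ) (η : Arrows) (t s : ℕ) :
    stripWalk k w η (t + s) = pos (clamp (-(k : ℤ)) w η) (stripWalk k w η t) t s := by
  rw [stripWalk, pos_add, zero_add]; rfl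

lemma stripWalk_parity (k w : ℕ) (η : Arrows) (t : ℕ) : (stripWalk k w η t - t) % 2 = 0 := by
  have := pos_parity (clamp (-(k : ℤ)) w η) 0 0 t
  rw [stripWalk]; omega

lemma detBy_strip_of_stripWalk {T : ℕ} {E : Set Arrows}
    (hE : ∀ η η' : Arrows, (∀ i ≤ T, stripWalk k w η i = stripWalk k w η' i) → η ∈ E → η' ∈ E) :
    DetBy (strip (-(k : ℤ)) w T) E :=
  detBy_clamp_strip (x := 0) hE

/-- The event that, at one of the times `0, L, …, j * L`, the walk in the strip is at the level
`θ` or beyond. -/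
def gridHit (k w L : ℕ) (θ : ℤ) (j : ℕ) : Set Arrows := {η | ∃ i ≤ j, θ ≤ stripWalk k w η (i * L)}

lemma detBy_gridHit (k w L : ℕ) (θ : ℤ) (j : ℕ) :
    DetBy (strip (-(k : ℤ)) w (j * L)) (gridHit k w L θ j) := by
  refine detBy_strip_of_stripWalk fun η η' h => ?_
  rintro ⟨i, hi, hθ⟩
  exact ⟨i, hi, by rwa [← h _ (Nat.mul_le_mul_right L hi)]⟩

lemma measurableSet_gridHit (k w L : ℕ) (θ : ℤ) (j : ℕ) : MeasurableSet (gridHit k w L θ j) :=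
  (detBy_gridHit k w L θ j).measurableSet (finite_strip _ _ _)

/-- The event that the walk in the strip hits the level `w` between the times `j * L` and
`(j + 1) * L`. -/
def windowHit (k w L : ℕ) (j : ℕ) : Set Arrows :=
  {η | ∃ t, j * L ≤ t ∧ t ≤ (j + 1) * L ∧ (w : ℤ) ≤ stripWalk k w η t}

/-- The event that, in the ceiling field, no walk that starts from `x` between the times `t₀` and
`t₀ + M` is to the left of `x - b` at the time `t₀ + M`. -/
def noDrop (hi x t₀ : ℤ) (b M : ℕ) : Set Arrows :=
  {η | ∀ t ≤ M, t % 2 = 0 → x - b ≤ pos (ceilAt hi η) x (t₀ + t) (M - t)}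

lemma isUpperSet_noDrop (hi x t₀ : ℤ) (b M : ℕ) : IsUpperSet (noDrop hi x t₀ b M) :=
  fun _ _ h hη t ht ht2 =>
    (hη t ht ht2).trans (pos_mono (ceilAt_mono le_rfl h) _ le_rfl (by simp) _)

lemma detBy_noDrop (hi x t₀ : ℤ) (b M : ℕ) : DetBy (lightBox x t₀ M) (noDrop hi x t₀ b M) := by
  intro η η' h hη t ht ht2
  rw [← pos_congr_lightBox (η := ceilAt hi η) (m := M - t) (fun z hz => ?_) le_rfl]
  · exact hη t ht ht2
  · refine ceilAt_congr _ _ _ _ (h z ?_)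
    simp only [Finset.mem_coe, mem_lightBox] at *
    omega

/-- A drop is, up to symmetries, a crossing. -/
lemma le_real_noDrop (hν : GoodLaw ν) {hi x t₀ : ℤ} {b M L : ℕ} (hx : x ≤ hi) (hM : M ≤ L)
    (hb : crossProb ν b L ≤ 1 / 2) : 1 / 2 ≤ ν.real (noDrop hi x t₀ b M) := by
  have := hν.isProb
  have hsub : (noDrop hi x t₀ b M)ᶜ ⊆ shift (x, t₀) ⁻¹' (mirror ⁻¹' Cross b L) := by
    intro η hη
    simp only [noDrop, Set.mem_compl_iff, Set.mem_ofPred_eq, not_forall, not_le] at hη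
    obtain ⟨t, ht, ht2, hlt⟩ := hη
    refine cross_of_path (η := mirror (shift (x, t₀) (ceilAt hi η))) (x := 0) (n := t) (m := M - t)
      ?_ le_rfl (by omega) (by omega) (by omega) ?_
    · -- the ceiling at `hi` becomes, after reflection, a floor to the left of the origin
      intro z
      simp only [mirror, shift, ceilAt, floorAt, Bool.le_iff_imp]
      by_cases h0 : z.1 < 0
      · simp [h0]
      · have : -z.1 + x ≤ hi := by omega
        simp [h0, this]
    · rw [pos_mirror, pos_shift]
      simp only [neg_zero, zero_add]
      rw [add_comm (t : ℤ)]
      omega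
  have h1 := measureReal_mono hsub (μ := ν)
  have h2 : MeasurableSet (mirror ⁻¹' Cross b L) := measurable_mirror (measurableSet_cross _ _)
  rw [hν.real_shift _ h2, hν.real_mirror (measurableSet_cross _ _),
    measureReal_compl ((detBy_noDrop hi x t₀ b M).measurableSet (Finset.finite_toSet _)),
    probReal_univ] at h1
  have : ν.real (Cross b L) ≤ 1 / 2 := hb
  linarith

/-- The event that the level `w` is reached, between the times `t₀` and `t₀ + M`, by the walk in
the strip between `lo` and `w` that is at `x` at the time `t₀`. -/
def reach (lo w x t₀ : ℤ) (M : ℕ) : Set Arrows := {η | ∃ t ≤ M, w ≤ pos (clamp lo w η) x t₀ t}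

lemma isUpperSet_reach (lo w x t₀ : ℤ) (M : ℕ) : IsUpperSet (reach lo w x t₀ M) := by
  rintro η η' h ⟨t, ht, hw⟩
  exact ⟨t, ht, hw.trans (pos_mono (clamp_mono le_rfl le_rfl h) _ le_rfl (by simp) _)⟩

lemma detBy_reach (lo w x t₀ : ℤ) (M : ℕ) : DetBy (lightBox x t₀ M) (reach lo w x t₀ M) := by
  refine detBy_pos (f := clamp lo w) (fun η η' z h => clamp_congr fun _ _ => h) ?_
  rintro η η' h ⟨t, ht, hw⟩
  exact ⟨t, ht, by rwa [← h t ht]⟩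

lemma measurableSet_reach (lo w x t₀ : ℤ) (M : ℕ) : MeasurableSet (reach lo w x t₀ M) :=
  (detBy_reach lo w x t₀ M).measurableSet (Finset.finite_toSet _)

lemma real_reach_sub (hν : GoodLaw ν) (lo w x t₀ c : ℤ) (M : ℕ) :
    ν.real (reach (lo - c) (w - c) (x - c) t₀ M) = ν.real (reach lo w x t₀ M) := by
  rw [← hν.real_shift (-c, 0) (measurableSet_reach lo w x t₀ M)]
  congr 1
  ext η
  simp only [reach, Set.mem_preimage, Set.mem_ofPred_eq, clamp_shift, pos_shift, add_zero,
    sub_neg_eq_add, ← sub_eq_add_neg, sub_le_iff_le_add]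

/-- The basic step of the maximal inequality. The past is decoupled from the window after the time
`j * L` by a gap of length `r`, during which the walk moves by at most `r`. The resulting loss is
compensated by a translation of the arrows of the window, and inside the window positive
association makes it possible to require that the walk stays close to the level it has reached. -/
lemma half_windowHit_le (hν : GoodLaw ν) (hw : w % 2 = 0) (hr : r % 2 = 0)
    (hL : L % 2 = 0) (hr0 : 0 < r) (hrL : r < L) (hb : crossProb ν b L ≤ 1 / 2) {j : ℕ}
    (hj : j < n) (hmix : MixesAt ν (k + w) (n * L) r τ) :
    ν.real (windowHit k w L j \ gridHit k w L (w - 2 * r - b) j) / 2 - 3 / 2 * τ ≤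
      ν.real (gridHit k w L (w - 2 * r - b) (j + 1) \ gridHit k w L (w - 2 * r - b) j) := by
  have := hν.isProb
  set θ : ℤ := w - 2 * r - b with hθ
  have hjL2 : (j * L) % 2 = 0 := by rw [Nat.mul_mod, hL]; simp
  have hsucc : (j + 1) * L = j * L + L := by ring
  set t₀ : ℤ := (j * L : ℕ) + r with ht₀
  set M : ℕ := L - r with hM
  set s : Finset ℤ := Finset.Icc (-((j * L : ℕ) : ℤ)) (j * L : ℕ) with hs
  set E : ℤ → Set Arrows := fun y =>
    {η | η ∉ gridHit k w L θ j ∧ stripWalk k w η (j * L) = y} with hE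
  set V := noDrop w (w - 2 * r) t₀ b M with hV
  set Hp : ℤ → Set Arrows := fun y => reach (-(k : ℤ)) w (y + r) t₀ M with hHp
  set Hm : ℤ → Set Arrows := fun y =>
    reach (-(k : ℤ) - 2 * r) (w - 2 * r) (y + r - 2 * r) t₀ M with hHm
  set A := strip (-(k : ℤ)) w (j * L) with hA
  set B : Set (ℤ × ℤ) := {z | t₀ ≤ z.2} with hB
  have hlight : ∀ x : ℤ, (lightBox x t₀ M : Set (ℤ × ℤ)) ⊆ B := by
    intro x z hz
    simp only [Finset.mem_coe, mem_lightBox] at hz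
    exact hz.2.1
  have hAr : A ⊆ rect (-(k : ℤ)) 0 (k + w) (n * L) :=
    (strip_mono (Nat.mul_le_mul_right L hj.le)).trans strip_subset_rect
  have hAB : ∀ x ∈ A, ∀ y ∈ B, (r : ℤ) < l1dist x y := fun x hx y hy =>
    lt_l1dist_of_time hx.2.2 hy
  have hEA : ∀ y, DetBy A (E y) := fun y =>
    (detBy_gridHit k w L θ j).compl.inter
      (detBy_strip_of_stripWalk fun η η' h (e : stripWalk k w η (j * L) = y) =>
        (h _ le_rfl).symm.trans e)
  have hEm : ∀ y, MeasurableSet (E y) := fun y => (hEA y).measurableSet (finite_strip _ _ _)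
  have hVd := detBy_noDrop w (w - 2 * r) t₀ b M
  have hVm : MeasurableSet V := hVd.measurableSet (Finset.finite_toSet _)
  have hdisj : (s : Set ℤ).PairwiseDisjoint E := by
    intro y _ y' _ hne
    rw [Function.onFun, Set.disjoint_left]
    intro η h h'
    exact hne (h.2.symm.trans h'.2)
  have m1 := hmix _ _ A B hAr hAB s E (fun y => Hm y ∩ V)
    (fun y _ => ⟨hEm y, (measurableSet_reach _ _ _ _ _).inter hVm, hEA y,
      ((detBy_reach _ _ _ _ _).mono (hlight _)).inter (hVd.mono (hlight _))⟩) hdisj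
  have m2 := hmix _ _ A B hAr hAB s E Hp
    (fun y _ => ⟨hEm y, measurableSet_reach _ _ _ _ _, hEA y,
      (detBy_reach _ _ _ _ _).mono (hlight _)⟩) hdisj
  have hVhalf : 1 / 2 ≤ ν.real V := le_real_noDrop hν (by omega) (by omega) hb
  have hprod : ∀ y, ν.real (Hp y) / 2 ≤ ν.real (Hm y ∩ V) := by
    intro y
    have hfkg := hν.fkg (lightBox (y + r - 2 * r) t₀ M ∪ lightBox (w - 2 * r) t₀ M) (Hm y) V
      ((detBy_reach _ _ _ _ _).mono (by simp)) (hVd.mono (by simp))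
      (isUpperSet_reach _ _ _ _ _) (isUpperSet_noDrop _ _ _ _ _)
    have heq : ν.real (Hm y) = ν.real (Hp y) := real_reach_sub hν _ _ _ _ _ _
    rw [heq] at hfkg
    have : (0 : ℝ) ≤ ν.real (Hp y) := measureReal_nonneg
    nlinarith
  have hsum : (∑ y ∈ s, ν.real (E y) * ν.real (Hp y)) / 2
      ≤ ∑ y ∈ s, ν.real (E y) * ν.real (Hm y ∩ V) := by
    rw [Finset.sum_div]
    refine Finset.sum_le_sum fun y _ => ?_
    rw [mul_div_assoc]
    exact mul_le_mul_of_nonneg_left (hprod y) measureReal_nonneg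
  -- before the decoupling: the walk cannot reach `w` during the gap
  have hup : windowHit k w L j \ gridHit k w L θ j ⊆ ⋃ y ∈ s, E y ∩ Hp y := by
    rintro η ⟨⟨t, ht1, ht2, hwt⟩, hη⟩
    have hlt : stripWalk k w η (j * L) < θ := by
      by_contra hc
      exact hη ⟨j, le_rfl, not_lt.1 hc⟩
    have b1 := pos_le (clamp (-(k : ℤ)) w η) 0 0 (j * L)
    have b2 := le_pos (clamp (-(k : ℤ)) w η) 0 0 (j * L)
    simp only [Set.mem_iUnion]
    refine ⟨stripWalk k w η (j * L), ?_, ⟨hη, rfl⟩, ?_⟩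
    · rw [hs, Finset.mem_Icc]; rw [stripWalk]; omega
    have hgap : ∀ u ≤ r, stripWalk k w η (j * L + u) ≤ stripWalk k w η (j * L) + u := by
      intro u _
      rw [stripWalk_add]
      exact pos_le _ _ _ _
    have htr : j * L + r < t := by
      by_contra hc
      obtain ⟨u, rfl⟩ := Nat.exists_eq_add_of_le ht1
      have := hgap u (by omega)
      omega
    obtain ⟨u, rfl⟩ := Nat.exists_eq_add_of_le htr.le
    refine ⟨u, by omega, hwt.trans ?_⟩
    rw [stripWalk_add]
    have p := stripWalk_parity k w η (j * L + r)
    have p' := stripWalk_parity k w η (j * L)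
    have := pos_mono (le_refl (clamp (-(k : ℤ)) w η)) ((j * L + r : ℕ) : ℤ) (hgap r le_rfl)
      (by push_cast at *; omega) u
    rw [ht₀]
    push_cast at *
    exact this
  -- after the decoupling: the true walk dominates the translated one
  have hdown : ⋃ y ∈ s, E y ∩ (Hm y ∩ V) ⊆ gridHit k w L θ (j + 1) \ gridHit k w L θ j := by
    intro η hη
    simp only [Set.mem_iUnion] at hη
    obtain ⟨y, _, ⟨hη1, hy⟩, ⟨t, htM, htw⟩, hηV⟩ := hη
    refine ⟨⟨j + 1, le_rfl, ?_⟩, hη1⟩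
    have hgap : y - r ≤ stripWalk k w η (j * L + r) := by
      rw [stripWalk_add, hy]
      exact le_pos _ _ _ _
    have p := stripWalk_parity k w η (j * L + r)
    have p' := stripWalk_parity k w η (j * L)
    have hfield : clamp (-(k : ℤ) - 2 * r) (w - 2 * r) η ≤ clamp (-(k : ℤ)) w η :=
      clamp_mono (by omega) (by omega) le_rfl
    have hcmp : (w : ℤ) - 2 * r ≤ stripWalk k w η (j * L + r + t) := by
      refine htw.trans ?_
      rw [stripWalk_add]
      have := pos_mono hfield t₀ (x := y + r - 2 * r) (x' := stripWalk k w η (j * L + r))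
        (by omega) (by push_cast at *; omega) t
      rw [ht₀] at this
      push_cast at *
      exact this
    obtain ⟨t', ht'M, ht'2, ht'w⟩ : ∃ t' ≤ M, t' % 2 = 0 ∧
        (w : ℤ) - 2 * r ≤ stripWalk k w η (j * L + r + t') := by
      rcases Nat.mod_two_eq_zero_or_one t with h0 | h1
      · exact ⟨t, htM, h0, hcmp⟩
      · refine ⟨t + 1, by omega, by omega, ?_⟩
        have p1 := stripWalk_parity k w η (j * L + r + t)
        have := le_pos (clamp (-(k : ℤ)) w η) (stripWalk k w η (j * L + r + t))
          ((j * L + r + t : ℕ) : ℤ) 1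
        rw [← stripWalk_add] at this
        rw [← add_assoc]
        push_cast at *
        omega
    have hfin := hηV t' ht'M ht'2
    rw [show (j + 1) * L = j * L + r + t' + (M - t') by omega, stripWalk_add]
    refine hfin.trans ?_
    have p1 := stripWalk_parity k w η (j * L + r + t')
    have := pos_mono (ceilAt_le_clamp (-(k : ℤ)) w η) ((j * L + r + t' : ℕ) : ℤ) ht'w
      (by push_cast at *; omega) (M - t')
    rw [ht₀]
    push_cast at *
    exact this
  have h1 := measureReal_mono hup (μ := ν) (measure_ne_top _ _)
  have h2 := measureReal_mono hdown (μ := ν) (measure_ne_top _ _)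
  rw [abs_le] at m1 m2
  linarith [m1.1, m2.2]

lemma gridHit_mono (k w L : ℕ) (θ : ℤ) {i j : ℕ} (h : i ≤ j) :
    gridHit k w L θ i ⊆ gridHit k w L θ j :=
  fun _ ⟨a, ha, hθ⟩ => ⟨a, ha.trans h, hθ⟩

/-- If the walk in the strip hits `w`, then with comparable probability it is close to `w` at one
of the times `0, L, …, n * L`. -/
lemma real_hit_le_gridHit (hν : GoodLaw ν) (hw : w % 2 = 0) (hr : r % 2 = 0)
    (hL : L % 2 = 0) (hr0 : 0 < r) (hrL : r < L) (hb : crossProb ν b L ≤ 1 / 2)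
    (hmix : MixesAt ν (k + w) (n * L) r τ) :
    ν.real {η | ∃ t ≤ n * L, (w : ℤ) ≤ stripWalk k w η t} ≤
      3 * ν.real (gridHit k w L (w - 2 * r - b) n) + 3 * n * τ := by
  have := hν.isProb
  set θ : ℤ := w - 2 * r - b with hθ
  have hgrid : ∀ m ≤ n, ∑ j ∈ Finset.range m,
      (ν.real (windowHit k w L j \ gridHit k w L θ j) / 2 - 3 / 2 * τ)
        ≤ ν.real (gridHit k w L θ m) := by
    intro m
    induction m with
    | zero => intro _; simp
    | succ m ih =>
      intro hm
      rw [Finset.sum_range_succ]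
      have h1 := half_windowHit_le hν hw hr hL hr0 hrL hb (j := m) (by omega) hmix
      rw [measureReal_sdiff (gridHit_mono k w L θ (Nat.le_succ m))
        (measurableSet_gridHit _ _ _ _ _)] at h1
      linarith [ih (by omega)]
  have hcover : {η | ∃ t ≤ n * L, (w : ℤ) ≤ stripWalk k w η t} ⊆
      gridHit k w L θ n ∪ ⋃ j ∈ Finset.range n, windowHit k w L j \ gridHit k w L θ j := by
    rintro η ⟨t, ht, hwt⟩
    by_cases hη : η ∈ gridHit k w L θ n
    · exact Or.inl hη
    right
    have hL0 : 0 < L := by omega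
    have h1 := Nat.div_add_mod t L
    have h2 := Nat.mod_lt t hL0
    have htn : t < n * L := by
      refine lt_of_le_of_ne ht fun e => hη ⟨n, le_rfl, ?_⟩
      rw [← e]; omega
    have hj : t / L < n := by rwa [Nat.div_lt_iff_lt_mul hL0]
    simp only [Set.mem_iUnion]
    refine ⟨t / L, Finset.mem_range.2 hj, ⟨t, ?_, ?_, hwt⟩,
      fun h => hη (gridHit_mono k w L θ hj.le h)⟩
    · rw [mul_comm]; omega
    · rw [add_mul, mul_comm]; omega
  have h1 := (measureReal_mono hcover (μ := ν) (measure_ne_top _ _)).trans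
    (measureReal_union_le _ _)
  have h2 := measureReal_biUnion_finset_le (μ := ν) (Finset.range n)
    (fun j => windowHit k w L j \ gridHit k w L θ j)
  have h3 := hgrid n le_rfl
  rw [Finset.sum_sub_distrib, ← Finset.sum_div, Finset.sum_const, Finset.card_range,
    nsmul_eq_mul] at h3
  linarith

/-- A maximal inequality of Lévy's type: the probability that the walk in the strip hits `w` before
the time `n * L` is controlled by the probability that, at a later deterministic time, the walk
reflected at `-k` is not far from `w`. After the first time of the grid at which the walk is close
to `w`, its further displacement is nonnegative with probability at least `1/2`. -/
lemma maximal_ineq (hν : GoodLaw ν) (hw : w % 2 = 0) (hb2 : b % 2 = 0) (hr : r % 2 = 0)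
    (hL : L % 2 = 0) (hr0 : 0 < r) (hrL : r < L) (hb : crossProb ν b L ≤ 1 / 2)
    (hmix : MixesAt ν (k + w) (n * L) r τ) :
    ν.real {η | ∃ t ≤ n * L, (w : ℤ) ≤ stripWalk k w η t} ≤
      6 * ν.real {η | (w : ℤ) - 3 * r - b ≤ pos (floorAt (-k) η) 0 0 (n * L + r)}
        + 12 * (n + 1) * τ := by
  have := hν.isProb
  have hτ := hmix.nonneg
  set θ : ℤ := w - 2 * r - b with hθ
  set F : Set Arrows := {η | (w : ℤ) - 3 * r - b ≤ pos (floorAt (-k) η) 0 0 (n * L + r)} with hF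
  set A : ℕ → Set Arrows := fun j => gridHit k w L θ j \ ⋃ i < j, gridHit k w L θ i with hA
  set B : ℕ → Set Arrows := fun j =>
    {η | θ - r ≤ pos η (θ - r) (j * L + r : ℕ) (n * L - j * L)} with hB
  have hAd : ∀ j, DetBy (strip (-(k : ℤ)) w (j * L)) (A j) := by
    intro j
    refine (detBy_gridHit k w L θ j).diff ?_
    rintro η η' h hη
    simp only [Set.mem_iUnion] at hη ⊢
    obtain ⟨i, hi, hη⟩ := hη
    exact ⟨i, hi, (detBy_gridHit k w L θ i).mono (strip_mono (Nat.mul_le_mul_right L hi.le)) h hη⟩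
  have hAm : ∀ j, MeasurableSet (A j) := fun j => (hAd j).measurableSet (finite_strip _ _ _)
  have hBd : ∀ j, DetBy (lightBox (θ - r) (j * L + r : ℕ) (n * L - j * L)) (B j) := fun j =>
    detBy_pos (f := id) (fun _ _ _ h => h) fun η η' h hη => by
      simp only [hB, Set.mem_ofPred_eq] at hη ⊢
      exact hη.trans_eq (h _ le_rfl)
  have hBm : ∀ j, MeasurableSet (B j) := fun j => (hBd j).measurableSet (Finset.finite_toSet _)
  have hdisj : ∀ i j, i ≠ j → Disjoint (A i) (A j) := by
    have : ∀ i j, i < j → Disjoint (A i) (A j) := by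
      intro i j hij
      rw [Set.disjoint_left]
      intro η h h'
      exact h'.2 (by simp only [Set.mem_iUnion]; exact ⟨i, hij, h.1⟩)
    intro i j hij
    rcases hij.lt_or_gt with h | h
    · exact this i j h
    · exact (this j i h).symm
  have hprod : ∀ j ≤ n, ν.real (A j) / 2 - τ ≤ ν.real (A j ∩ B j) := by
    intro j hj
    have h1 := hmix.pair (a := -(k : ℤ)) (b := 0) (A := strip (-(k : ℤ)) w (j * L))
      (B := (lightBox (θ - r) (j * L + r : ℕ) (n * L - j * L) : Set (ℤ × ℤ)))
      ((strip_mono (Nat.mul_le_mul_right L hj)).trans strip_subset_rect)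
      (fun x hx y hy => lt_l1dist_of_time (t := (j * L : ℕ)) hx.2.2 (by
        simp only [Finset.mem_coe, mem_lightBox] at hy
        push_cast at *
        omega)) (hAm j) (hBm j) (hAd j) (hBd j)
    have h2 : 1 / 2 ≤ ν.real (B j) := hν.half_le _ _ _
    have h3 : (0 : ℝ) ≤ ν.real (A j) := measureReal_nonneg
    rw [abs_le] at h1
    nlinarith [h1.1]
  have hsub : ⋃ j ∈ Finset.range (n + 1), A j ∩ B j ⊆ F := by
    intro η hη
    simp only [Set.mem_iUnion] at hη
    obtain ⟨j, hj, ⟨hη1, hη2⟩, hηB⟩ := hη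
    have hjn : j ≤ n := by simpa [Nat.lt_succ_iff] using hj
    have hjL := Nat.mul_le_mul_right L hjn
    have hθj : θ ≤ stripWalk k w η (j * L) := by
      obtain ⟨i, hi, h⟩ := hη1
      rcases hi.lt_or_eq with hlt | rfl
      · exact absurd (by simp only [Set.mem_iUnion]; exact ⟨i, hlt, i, le_rfl, h⟩) hη2
      · exact h
    have h1 : stripWalk k w η (j * L) ≤ pos (floorAt (-k) η) 0 0 (j * L) :=
      pos_mono (clamp_le_floorAt _ _ _) 0 le_rfl (by simp) _
    have h2 := le_pos (floorAt (-k) η) (pos (floorAt (-k) η) 0 0 (j * L)) (0 + (j * L : ℕ)) r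
    rw [← pos_add] at h2
    have hjL2 : (j * L) % 2 = 0 := by rw [Nat.mul_mod, hL]; simp
    have p := pos_parity (floorAt (-k) η) 0 0 (j * L + r)
    have h3 := pos_mono (le_floorAt (-k) η) ((j * L + r : ℕ) : ℤ)
      (x := θ - r) (x' := pos (floorAt (-k) η) 0 0 (j * L + r)) (by omega)
      (by push_cast at *; omega) (n * L - j * L)
    have h4 := pos_add (floorAt (-k) η) 0 0 (j * L + r) (n * L - j * L)
    rw [show j * L + r + (n * L - j * L) = n * L + r by omega, zero_add] at h4
    simp only [hF, Set.mem_ofPred_eq]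
    rw [h4]
    refine le_trans ?_ h3
    have : θ - r ≤ _ := hηB
    omega
  have hgrid : gridHit k w L θ n ⊆ ⋃ j ∈ Finset.range (n + 1), A j := by
    intro η hη
    classical
    have hex : ∃ j, η ∈ gridHit k w L θ j := ⟨n, hη⟩
    simp only [Set.mem_iUnion]
    refine ⟨Nat.find hex, Finset.mem_range.2 (Nat.lt_succ_of_le (Nat.find_min' hex hη)),
      Nat.find_spec hex, ?_⟩
    simp only [Set.mem_iUnion, not_exists]
    exact fun i hi => Nat.find_min hex hi
  have e1 := (measureReal_mono hgrid (μ := ν) (measure_ne_top _ _)).trans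
    (measureReal_biUnion_finset_le _ _)
  have e2 : ∑ j ∈ Finset.range (n + 1), ν.real (A j ∩ B j) ≤ ν.real F := by
    rw [← measureReal_biUnion_finset (fun i _ j _ hij =>
      (hdisj i j hij).mono Set.inter_subset_left Set.inter_subset_left)
      (fun j _ => (hAm j).inter (hBm j))]
    exact measureReal_mono hsub (measure_ne_top _ _)
  have e3 : ∑ j ∈ Finset.range (n + 1), (ν.real (A j) / 2 - τ)
      ≤ ∑ j ∈ Finset.range (n + 1), ν.real (A j ∩ B j) :=
    Finset.sum_le_sum fun j hj => hprod j (by simpa [Nat.lt_succ_iff] using hj)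
  rw [Finset.sum_sub_distrib, ← Finset.sum_div, Finset.sum_const, Finset.card_range,
    nsmul_eq_mul] at e3
  push_cast at e3
  have e4 := real_hit_le_gridHit hν hw hr hL hr0 hrL hb hmix
  have hn : (0 : ℝ) ≤ n := n.cast_nonneg
  nlinarith

end Levy

/-! ### Time reversal -/

lemma DetBy.rev {S : Set (ℤ × ℤ)} {E : Set Arrows} (h : DetBy S E) :
    DetBy ((fun z => -z) ⁻¹' S) (rev ⁻¹' E) := by
  intro η η' e hE
  exact h (fun z hz => e (-z) (by simpa using hz)) hE

lemma GoodLaw.rev {ν : Measure Arrows} (hν : GoodLaw ν) : GoodLaw (ν.map rev) := by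
  have := hν.isProb
  refine ⟨Measure.isProbabilityMeasure_map measurable_rev.aemeasurable, fun c => ?_, ?_, ?_⟩
  · rw [Measure.map_map (measurable_shift c) measurable_rev]
    conv_rhs => rw [← hν.map_shift (-c), Measure.map_map measurable_rev (measurable_shift _)]
    congr 1
    funext η z
    simp [RWDRE.rev, shift, neg_add_rev, add_comm]
  · -- the reflection of the space axis, for the reversed field, is a reflection of the time axis
    rw [Measure.map_map measurable_mirror measurable_rev]
    conv_rhs => rw [← hν.map_mirror, Measure.map_map measurable_rev measurable_mirror]
    congr 1
  · intro S E F hE hF hEu hFu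
    have hEm := hE.measurableSet (Finset.finite_toSet S)
    have hFm := hF.measurableSet (Finset.finite_toSet S)
    rw [map_measureReal_apply measurable_rev hEm, map_measureReal_apply measurable_rev hFm,
      map_measureReal_apply measurable_rev (hEm.inter hFm), Set.preimage_inter]
    have hS : ((S.image fun z => -z : Finset (ℤ × ℤ)) : Set (ℤ × ℤ)) = (fun z => -z) ⁻¹' S := by
      simp
    have hup : ∀ {G : Set Arrows}, IsUpperSet G → IsUpperSet (RWDRE.rev ⁻¹' G) :=
      fun hG η η' h => hG fun z => h (-z)
    exact hν.fkg (S.image fun z => -z) _ _ (by rw [hS]; exact hE.rev) (by rw [hS]; exact hF.rev)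
      (hup hEu) (hup hFu)

lemma MixesAt.rev {ν : Measure Arrows} {wd ht r : ℕ} {τ : ℝ} (h : MixesAt ν wd ht r τ) :
    MixesAt (ν.map rev) wd ht r τ := by
  intro a b A B hA hAB s E F hEF hdisj
  have key := h (-(a + wd)) (-(b + ht)) ((fun z => -z) ⁻¹' A) ((fun z => -z) ⁻¹' B) ?_ ?_ s
    (fun i => RWDRE.rev ⁻¹' E i) (fun i => RWDRE.rev ⁻¹' F i)
    (fun i hi => ⟨measurable_rev (hEF i hi).1, measurable_rev (hEF i hi).2.1,
      (hEF i hi).2.2.1.rev, (hEF i hi).2.2.2.rev⟩)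
    (fun i hi j hj hij => (hdisj hi hj hij).preimage _)
  · have e1 : (ν.map RWDRE.rev).real (⋃ i ∈ s, E i ∩ F i)
        = ν.real (⋃ i ∈ s, RWDRE.rev ⁻¹' E i ∩ RWDRE.rev ⁻¹' F i) := by
      rw [map_measureReal_apply measurable_rev
        (Finset.measurableSet_biUnion _ fun i hi => (hEF i hi).1.inter (hEF i hi).2.1)]
      simp only [Set.preimage_iUnion, Set.preimage_inter]
    have e2 : ∑ i ∈ s, (ν.map RWDRE.rev).real (E i) * (ν.map RWDRE.rev).real (F i)
        = ∑ i ∈ s, ν.real (RWDRE.rev ⁻¹' E i) * ν.real (RWDRE.rev ⁻¹' F i) :=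
      Finset.sum_congr rfl fun i hi => by
        rw [map_measureReal_apply measurable_rev (hEF i hi).1,
          map_measureReal_apply measurable_rev (hEF i hi).2.1]
    rw [e1, e2]
    exact key
  · intro z hz
    obtain ⟨h1, h2, h3, h4⟩ := hA hz
    simp only [Prod.fst_neg, Prod.snd_neg] at h1 h2 h3 h4
    refine ⟨?_, ?_, ?_, ?_⟩ <;> omega
  · intro x hx y hy
    have := hAB (-x) hx (-y) hy
    simp only [l1dist, Prod.fst_neg, Prod.snd_neg] at *
    rwa [show -x.1 - -y.1 = -(x.1 - y.1) by ring, show -x.2 - -y.2 = -(x.2 - y.2) by ring,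
      abs_neg, abs_neg] at this

lemma map_rev_map_rev (ν : Measure Arrows) : (ν.map rev).map rev = ν := by
  rw [Measure.map_map measurable_rev measurable_rev]
  have : rev ∘ rev = id := funext rev_rev
  rw [this, Measure.map_id]

lemma crossProb_le_rev {ν : Measure Arrows} (hν : GoodLaw ν) {w T : ℕ} (hw : w % 2 = 0)
    (hT : T % 2 = 0) : crossProb ν w T ≤ crossProb (ν.map rev) w T := by
  have := hν.isProb
  have h : Cross w T ⊆ rev ⁻¹' (shift (-((w : ℤ) - 1), -((T : ℤ) - 1)) ⁻¹' Cross w T) :=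
    fun η hη => dual_cross (by omega) (by omega) hT hη
  have h1 := measureReal_mono h (μ := ν) (measure_ne_top _ _)
  rwa [← map_measureReal_apply measurable_rev (measurable_shift _ (measurableSet_cross _ _)),
    hν.rev.real_shift _ (measurableSet_cross _ _)] at h1

/-- Crossing probabilities are invariant under time reversal. -/
lemma crossProb_rev {ν : Measure Arrows} (hν : GoodLaw ν) {w T : ℕ} (hw : w % 2 = 0)
    (hT : T % 2 = 0) : crossProb (ν.map rev) w T = crossProb ν w T := by
  refine le_antisymm ?_ (crossProb_le_rev hν hw hT)
  have := crossProb_le_rev hν.rev hw hT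
  rwa [map_rev_map_rev] at this

/-! ### Displacement of a single walk -/

/-- Duality turns a large displacement of the reflected walk at a deterministic time into a large
displacement, at some time, of a walk without barrier in the reversed field. -/
lemma real_floor_le_rev {ν : Measure Arrows} (hν : GoodLaw ν) {y T : ℕ} (hy : y % 2 = 0)
    (hT : T % 2 = 0) : ν.real {η | (y : ℤ) ≤ pos (floorAt 0 η) 0 0 T} ≤
      (ν.map rev).real {η | ∃ t ≤ T, (y : ℤ) ≤ pos η 0 0 t} := by
  have := hν.isProb
  have hm : MeasurableSet {η : Arrows | ∃ t ≤ T, (y : ℤ) ≤ pos η 0 0 t} :=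
    DetBy.measurableSet (Finset.finite_toSet _) (detBy_pos (f := id) (x := 0) (n := 0) (m := T)
      (fun _ _ _ h => h) fun η η' h ⟨t, ht, hty⟩ => ⟨t, ht, hty.trans_eq (h t ht)⟩)
  have h : {η | (y : ℤ) ≤ pos (floorAt 0 η) 0 0 T} ⊆
      rev ⁻¹' (shift (-((y : ℤ) - 1), -((T : ℤ) - 1)) ⁻¹'
        {η | ∃ t ≤ T, (y : ℤ) ≤ pos η 0 0 t}) :=
    fun η hη => dual_hit (by omega) hη
  have h1 := measureReal_mono h (μ := ν) (measure_ne_top _ _)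
  rwa [← map_measureReal_apply measurable_rev (measurable_shift _ hm),
    hν.rev.real_shift _ hm] at h1

/-- A barrier at `-k` is felt by the walk only if a box of width `k` is crossed. -/
lemma real_floor_le_add {ν : Measure Arrows} (hν : GoodLaw ν) {k T : ℕ} (hk : k % 2 = 0) {y : ℤ}
    (hy : 0 ≤ y) : ν.real {η | y ≤ pos (floorAt (-k) η) 0 0 T} ≤
      ν.real {η | y ≤ pos η 0 0 T} + crossProb ν k T := by
  have := hν.isProb
  have h : {η | y ≤ pos (floorAt (-k) η) 0 0 T} ⊆
      {η | y ≤ pos η 0 0 T} ∪ shift (-(k : ℤ), 0) ⁻¹' Cross k T := by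
    intro η hη
    rcases pos_floorAt_eq_or (-(k : ℤ)) (by omega) (by omega) η T with e | e
    · left
      simpa only [Set.mem_ofPred_eq, e] using hη
    · right
      have hη : y ≤ pos (floorAt (-(k : ℤ)) η) 0 0 T := hη
      rw [e] at hη
      rw [Set.mem_preimage, mem_cross]
      refine ⟨T, le_rfl, ?_⟩
      have : floorAt 0 (shift (-(k : ℤ), 0) η) = shift (-(k : ℤ), 0) (floorAt (-(k : ℤ)) η) := by
        funext z
        have e : z.1 + -(k : ℤ) < -(k : ℤ) ↔ z.1 < 0 := by omega
        simp only [floorAt, shift, Prod.fst_add, e]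
      rw [this, pos_shift]
      simp only [zero_add]
      omega
  have h1 := (measureReal_mono h (μ := ν) (measure_ne_top _ _)).trans (measureReal_union_le _ _)
  rwa [hν.real_shift _ (measurableSet_cross _ _)] at h1

/-- Displacements over consecutive time intervals are positively associated. -/
lemma pow_le_real_pos {ν : Measure Arrows} (hν : GoodLaw ν) {y T : ℕ} (hy : (y + T) % 2 = 0)
    (m : ℕ) : ν.real {η | (y : ℤ) ≤ pos η 0 0 T} ^ m ≤
      ν.real {η | ((m * y : ℕ) : ℤ) ≤ pos η 0 0 (m * T)} := by
  have := hν.isProb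
  have hd : ∀ (y : ℤ) (x n : ℤ) (T : ℕ), DetBy (lightBox x n T) {η | y ≤ pos η x n T} :=
    fun y x n T => detBy_pos (f := id) (fun _ _ _ h => h) fun η η' h hη => by
      simp only [Set.mem_ofPred_eq] at hη ⊢
      exact hη.trans_eq (h _ le_rfl)
  have hu : ∀ (y : ℤ) (x n : ℤ) (T : ℕ), IsUpperSet {η : Arrows | y ≤ pos η x n T} :=
    fun y x n T η η' h (hη : y ≤ pos η x n T) => hη.trans (pos_mono h n le_rfl (by simp) T)
  induction m with
  | zero => simp [pos_zero]
  | succ m ih =>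
    set E : Set Arrows := {η | ((m * y : ℕ) : ℤ) ≤ pos η 0 0 (m * T)} with hE
    set F : Set Arrows :=
      {η | ((m * y : ℕ) : ℤ) + y ≤ pos η (m * y : ℕ) (m * T : ℕ) T} with hF
    have hFeq : ν.real F = ν.real {η | (y : ℤ) ≤ pos η 0 0 T} := by
      rw [← hν.real_shift ((m * y : ℕ), (m * T : ℕ)) (E := {η | (y : ℤ) ≤ pos η 0 0 T})
        ((hd _ _ _ _).measurableSet (Finset.finite_toSet _))]
      congr 1
      ext η
      simp only [hF, Set.mem_preimage, Set.mem_ofPred_eq, pos_shift, zero_add]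
      omega
    have hfkg := hν.fkg (lightBox 0 0 (m * T) ∪ lightBox (m * y : ℕ) (m * T : ℕ) T) E F
      ((hd _ _ _ _).mono (by simp)) ((hd _ _ _ _).mono (by simp)) (hu _ _ _ _) (hu _ _ _ _)
    have hsub : E ∩ F ⊆ {η | (((m + 1) * y : ℕ) : ℤ) ≤ pos η 0 0 ((m + 1) * T)} := by
      rintro η ⟨h1, h2⟩
      have h1 : ((m * y : ℕ) : ℤ) ≤ pos η 0 0 (m * T) := h1
      have h2 : ((m * y : ℕ) : ℤ) + y ≤ pos η (m * y : ℕ) (m * T : ℕ) T := h2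
      have p := pos_parity η 0 0 (m * T)
      have hpar : (m * y + m * T) % 2 = 0 := by rw [← mul_add, Nat.mul_mod, hy]; simp
      have h3 := pos_mono (le_refl η) ((m * T : ℕ) : ℤ) h1 (by omega) T
      simp only [Set.mem_ofPred_eq]
      rw [add_mul, one_mul, add_mul, one_mul, pos_add, zero_add]
      push_cast at *
      omega
    rw [pow_succ]
    calc _ ≤ ν.real E * ν.real F := by
            rw [hFeq]; exact mul_le_mul_of_nonneg_right ih measureReal_nonneg
      _ ≤ _ := hfkg.trans (measureReal_mono hsub (measure_ne_top _ _))

/-! ### The dichotomy at one scale -/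

/-- Suppose that a box of width `w` and height `n * L` is crossed with probability at least `1/2`,
but that narrow boxes of height `L` are not. Then either much wider boxes are crossed with a fixed
probability, or the displacement of a walk is comparable to `w` with a fixed probability, and
displacements can be added up. -/
lemma cross_or_displacement {ν : Measure Arrows} (hν : GoodLaw ν) {k w b r L n : ℕ} {τ : ℝ}
    (hk : k % 2 = 0) (hw : w % 2 = 0) (hb2 : b % 2 = 0) (hr : r % 2 = 0) (hL : L % 2 = 0)
    (hr0 : 0 < r) (hrL : r < L) (hwb : 6 * r + 2 * b ≤ w) (hR : 1 / 2 ≤ crossProb ν w (n * L))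
    (hb : crossProb ν b L ≤ 1 / 2) (hmix : MixesAt ν (k + w) ((n + 1) * L) r τ)
    (hτ : 3 * (n + 2) * τ ≤ 1 / 1000) :
    1 / 200 ≤ crossProb ν k ((n + 1) * L + r) ∨
      ∀ m : ℕ, (1 / 256 : ℝ) ^ m ≤
        crossProb ν (m * (w - 6 * r - 2 * b) : ℕ) (m * ((n + 1) * L + r)) := by
  have := hν.isProb
  have hν' := hν.rev
  have := hν'.isProb
  have hτ0 := hmix.nonneg
  have hnL : (n * L) % 2 = 0 := by rw [Nat.mul_mod, hL]; simp
  have hnL' : ((n + 1) * L) % 2 = 0 := by rw [Nat.mul_mod, hL]; simp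
  have hle : n * L ≤ (n + 1) * L := Nat.mul_le_mul_right _ (by omega)
  obtain ⟨y, hy⟩ : ∃ y : ℕ, y = w - 3 * r - b := ⟨_, rfl⟩
  have s1 := maximal_ineq (k := 0) (n := n) hν hw hb2 hr hL hr0 hrL hb
    (hmix.mono (by omega) hle)
  have e1 : {η | ∃ t ≤ n * L, (w : ℤ) ≤ stripWalk 0 w η t} = Cross w (n * L) := by
    simp [Cross, stripWalk]
  have e2 : {η | (w : ℤ) - 3 * r - b ≤ pos (floorAt (-((0 : ℕ) : ℤ)) η) 0 0 (n * L + r)}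
      = {η | (y : ℤ) ≤ pos (floorAt 0 η) 0 0 (n * L + r)} := by
    rw [show (w : ℤ) - 3 * r - b = y by omega]
    simp
  rw [e1, e2] at s1
  have s2 := real_floor_le_rev hν (y := y) (T := n * L + r) (by omega) (by omega)
  have s3 : (ν.map rev).real {η | ∃ t ≤ n * L + r, (y : ℤ) ≤ pos η 0 0 t} ≤
      (ν.map rev).real {η | ∃ t ≤ (n + 1) * L, (y : ℤ) ≤ stripWalk k y η t} := by
    refine measureReal_mono ?_ (measure_ne_top _ _)
    rintro η ⟨t, ht, hty⟩
    have : ∃ t ≤ (n + 1) * L, (y : ℤ) ≤ pos (floorAt (-(k : ℤ)) η) 0 0 t :=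
      ⟨t, ht.trans (by rw [add_mul]; omega),
        hty.trans (pos_mono (le_floorAt _ _) 0 le_rfl (by simp) t)⟩
    rwa [← hit_clamp_iff (hi := y) (by omega)] at this
  have s4 := maximal_ineq (k := k) (w := y) (n := n + 1) hν' (by omega) hb2 hr hL hr0 hrL
    (by rwa [crossProb_rev hν hb2 hL]) (hmix.rev.mono (by omega) le_rfl)
  have e3 : (y : ℤ) - 3 * r - b = ((w - 6 * r - 2 * b : ℕ) : ℤ) := by omega
  rw [e3] at s4
  have s5 := real_floor_le_add hν' (k := k) (T := (n + 1) * L + r) hk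
    (y := ((w - 6 * r - 2 * b : ℕ) : ℤ)) (by omega)
  rw [crossProb_rev hν hk (by omega)] at s5
  by_cases hc : 1 / 200 ≤ crossProb ν k ((n + 1) * L + r)
  · exact Or.inl hc
  right
  intro m
  have hX : 1 / 256 ≤ (ν.map rev).real
      {η | ((w - 6 * r - 2 * b : ℕ) : ℤ) ≤ pos η 0 0 ((n + 1) * L + r)} := by
    have hR' : 1 / 2 ≤ ν.real (Cross w (n * L)) := hR
    push_cast at s4
    nlinarith
  have s6 := pow_le_real_pos hν' (y := w - 6 * r - 2 * b) (T := (n + 1) * L + r) (by omega) m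
  have s7 : (ν.map rev).real {η | ((m * (w - 6 * r - 2 * b) : ℕ) : ℤ) ≤
      pos η 0 0 (m * ((n + 1) * L + r))} ≤
      crossProb (ν.map rev) (m * (w - 6 * r - 2 * b) : ℕ) (m * ((n + 1) * L + r)) := by
    refine measureReal_mono (fun η hη => ?_) (measure_ne_top _ _)
    exact cross_of_path (le_floorAt _ _) le_rfl le_rfl (by simp) (by simp) hη
  have hy2 : (w - 6 * r - 2 * b) % 2 = 0 := by omega
  have hT2 : ((n + 1) * L + r) % 2 = 0 := by omega
  rw [crossProb_rev hν (by rw [Nat.mul_mod, hy2]; simp) (by rw [Nat.mul_mod, hT2]; simp)] at s7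
  exact (pow_le_pow_left₀ (by norm_num) hX m).trans (s6.trans s7)

/-- Crossing attempts during well separated time intervals are nearly independent. -/
lemma one_sub_crossProb_le {ν : Measure Arrows} (hν : GoodLaw ν) {w T r : ℕ} {τ c : ℝ}
    (hT : T % 2 = 0) (hr : r % 2 = 0) (hc : c ≤ crossProb ν w T) (hc1 : c ≤ 1) {N : ℕ}
    (hmix : MixesAt ν w (N * (T + r)) r τ) :
    1 - crossProb ν w (N * (T + r)) ≤ (1 - c) ^ N + N * τ := by
  have := hν.isProb
  have hτ := hmix.nonneg
  have key : ∀ M ≤ N, 1 - crossProb ν w (M * (T + r)) ≤ (1 - c) ^ M + M * τ := by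
    intro M
    induction M with
    | zero =>
      intro _
      have : 0 ≤ crossProb ν w (0 * (T + r)) := measureReal_nonneg
      simpa using this
    | succ M ih =>
      intro hM
      have ih := ih (by omega)
      have hMle : M * (T + r) ≤ N * (T + r) := Nat.mul_le_mul_right _ (by omega)
      set E := (Cross w (M * (T + r)))ᶜ with hE
      set G := shift (0, (M * (T + r) + r : ℕ)) ⁻¹' Cross w T with hG
      have hGd : DetBy {z | ((M * (T + r) : ℕ) : ℤ) + r ≤ z.2} Gᶜ := by
        refine DetBy.compl fun η η' h hη => ?_
        refine detBy_cross w T (fun z hz => ?_) hη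
        have := hz.2.1
        exact h _ (by simp only [Set.mem_ofPred_eq, Prod.snd_add]; push_cast; omega)
      have hEm : MeasurableSet E := (measurableSet_cross _ _).compl
      have hGm : MeasurableSet G := measurable_shift _ (measurableSet_cross _ _)
      have hpair := hmix.pair (a := -((0 : ℕ) : ℤ)) (b := 0) (A := strip 0 w (M * (T + r)))
        (fun z hz => by
          have := strip_subset_rect (k := 0) (w := w) (by simpa using strip_mono hMle hz)
          simpa using this)
        (fun x hx y hy => lt_l1dist_of_time hx.2.2 hy) hEm hGm.compl (detBy_cross _ _).compl hGd
      have hEr : ν.real E = 1 - crossProb ν w (M * (T + r)) := by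
        rw [hE, measureReal_compl (measurableSet_cross _ _), probReal_univ]; rfl
      have hGr : ν.real Gᶜ = 1 - crossProb ν w T := by
        rw [measureReal_compl hGm, probReal_univ, hG, hν.real_shift _ (measurableSet_cross _ _)]
        rfl
      have hsub : (Cross w ((M + 1) * (T + r)))ᶜ ⊆ E ∩ Gᶜ := by
        intro η hη
        refine ⟨fun h => hη (cross_mono_time (Nat.mul_le_mul_right _ (by omega)) h),
          fun h => hη ?_⟩
        rw [hG, Set.mem_preimage, mem_cross] at h
        obtain ⟨t, ht, hwt⟩ := h
        have e : floorAt 0 (shift (0, ((M * (T + r) + r : ℕ) : ℤ)) η)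
            = shift (0, ((M * (T + r) + r : ℕ) : ℤ)) (floorAt 0 η) := by
          funext z
          simp [floorAt, shift]
        rw [e, pos_shift] at hwt
        have h2 : (M * (T + r) + r) % 2 = 0 := by
          rw [Nat.add_mod, Nat.mul_mod, Nat.add_mod T r, hT, hr]; simp
        exact cross_of_path (η := floorAt 0 η) (x := 0) (n := (M * (T + r) + r : ℕ)) (m := t)
          le_rfl le_rfl (by omega) (by omega) (by rw [add_mul]; push_cast; omega)
          (by simpa using hwt)
      have h1 := measureReal_mono hsub (μ := ν) (measure_ne_top _ _)
      rw [measureReal_compl (measurableSet_cross _ _), probReal_univ] at h1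
      have h1' : 1 - crossProb ν w ((M + 1) * (T + r)) ≤ ν.real (E ∩ Gᶜ) := h1
      rw [hEr, hGr, abs_le] at hpair
      have hA : 0 ≤ 1 - crossProb ν w (M * (T + r)) := by rw [← hEr]; exact measureReal_nonneg
      have hpow : (0 : ℝ) ≤ (1 - c) ^ M := pow_nonneg (by linarith) M
      have hB : 0 ≤ crossProb ν w T := measureReal_nonneg
      have hC : 0 ≤ 1 - crossProb ν w T := by rw [← hGr]; exact measureReal_nonneg
      have hMτ : 0 ≤ (M : ℝ) * τ := by positivity
      have : (1 - crossProb ν w (M * (T + r))) * (1 - crossProb ν w T)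
          ≤ (1 - c) ^ M * (1 - c) + M * τ := by
        calc _ ≤ ((1 - c) ^ M + M * τ) * (1 - crossProb ν w T) := by gcongr
          _ = (1 - c) ^ M * (1 - crossProb ν w T) + M * τ * (1 - crossProb ν w T) := by ring
          _ ≤ (1 - c) ^ M * (1 - c) + M * τ * 1 := by gcongr; linarith
          _ = _ := by ring
      rw [pow_succ]
      push_cast
      linarith [hpair.2]
  exact key N le_rfl

/-! ### The median width -/

open Classical in
/-- The largest width `w` for which the box of width `w` and height `T` is crossed with probability
at least `1/2`. -/
def medianWidth (ν : Measure Arrows) (T : ℕ) : ℕ :=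
  Nat.findGreatest (fun w => 1 / 2 ≤ crossProb ν w T) T

lemma le_medianWidth {ν : Measure Arrows} {w T : ℕ} (h : 1 / 2 ≤ crossProb ν w T) :
    w ≤ medianWidth ν T := by
  classical
  refine Nat.le_findGreatest ?_ h
  by_contra hc
  have : Cross w T = ∅ := Set.eq_empty_of_forall_notMem fun η => not_mem_cross (by omega) η
  rw [crossProb, this, measureReal_empty] at h
  norm_num at h

lemma crossProb_lt_half {ν : Measure Arrows} {w T : ℕ} (h : medianWidth ν T < w) :
    crossProb ν w T < 1 / 2 := by
  by_contra hc
  have := le_medianWidth (not_lt.1 hc)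
  omega

lemma medianWidth_le (ν : Measure Arrows) (T : ℕ) : medianWidth ν T ≤ T := by
  classical
  exact Nat.findGreatest_le T

lemma half_le_crossProb_medianWidth (ν : Measure Arrows) [IsProbabilityMeasure ν] (T : ℕ) :
    1 / 2 ≤ crossProb ν (medianWidth ν T) T := by
  classical
  have h0 : 1 / 2 ≤ crossProb ν (0 : ℕ) T := by
    have : Cross (0 : ℕ) T = Set.univ := by
      ext η
      simp only [Set.mem_univ, iff_true]
      exact ⟨0, by omega, by simp [pos_zero]⟩
    rw [crossProb, this, probReal_univ]
    norm_num
  exact Nat.findGreatest_spec (P := fun w : ℕ => 1 / 2 ≤ crossProb ν w T) (Nat.zero_le T) h0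

lemma medianWidth_mono (ν : Measure Arrows) [IsProbabilityMeasure ν] {T T' : ℕ} (h : T ≤ T') :
    medianWidth ν T ≤ medianWidth ν T' :=
  le_medianWidth ((half_le_crossProb_medianWidth ν T).trans (crossProb_mono_time h))

/-! ### All scales -/

/-- The bound on the decoupling error of a rectangle, up to a numerical factor. -/
def mixRate (c₁ α : ℝ) (wd ht r : ℕ) : ℝ :=
  4 * (c₁ * ((wd : ℝ) * ht + ((wd : ℝ) + ht) * r + (r : ℝ) ^ 2) * (r : ℝ) ^ (-α))

/-- The law of the arrows satisfies all the assumptions, with the given decoupling rate. -/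
structure MixingLaw (ν : Measure Arrows) (c₁ α : ℝ) : Prop extends GoodLaw ν where
  mix : ∀ wd ht r : ℕ, 1 ≤ wd → 1 ≤ ht → 2 ≤ r → MixesAt ν wd ht r (mixRate c₁ α wd ht r)

/-- For rectangles of width of order `W` and height of order `T`, and for gaps of order `W`, the
decoupling error is small as soon as `T` is large and `W` is at least of order `T ^ ξ`. This is
where the condition `α > 1 + 1 / ξ` is used. -/
lemma exists_mixRate_le {ξ α c₁ : ℝ} (hξ₀ : 0 < ξ) (hα : 1 + ξ⁻¹ < α) (hc₁ : 0 < c₁) {K τ : ℝ}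
    (hK : 1 ≤ K) (hτ : 0 < τ) : ∃ T₀ : ℕ, ∀ T W : ℕ, T₀ ≤ T → (T : ℝ) ^ ξ ≤ 4 * W → W ≤ T →
      ∀ wd ht r : ℕ, (wd : ℝ) ≤ K * W → (ht : ℝ) ≤ K * T → (W : ℝ) ≤ K * r → (r : ℝ) ≤ K * W →
        mixRate c₁ α wd ht r ≤ τ := by
  have hα1 : 0 < α - 1 := by have := inv_pos.2 hξ₀; linarith
  have hexp : 0 < ξ * (α - 1) - 1 := by
    have : ξ * ξ⁻¹ < ξ * (α - 1) := mul_lt_mul_of_pos_left (by linarith) hξ₀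
    rw [mul_inv_cancel₀ hξ₀.ne'] at this
    linarith
  set C : ℝ := 16 * c₁ * K ^ 2 * K ^ α * 4 ^ (α - 1) with hC
  have hC0 : 0 < C := by positivity
  have hlim : Filter.Tendsto (fun T : ℕ => C * (T : ℝ) ^ (-(ξ * (α - 1) - 1))) Filter.atTop
      (nhds (C * 0)) :=
    ((tendsto_rpow_neg_atTop hexp).comp tendsto_natCast_atTop_atTop).const_mul C
  rw [mul_zero] at hlim
  obtain ⟨T₀, hT₀⟩ := Filter.eventually_atTop.1 (hlim.eventually (gt_mem_nhds hτ))
  refine ⟨max T₀ 1, fun T W hT hW hWT wd ht r h1 h2 h3 h4 => ?_⟩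
  have hTpos : (0 : ℝ) < T := by exact_mod_cast (le_of_max_le_right hT)
  have hWpos : (0 : ℝ) < W := by
    have := Real.rpow_pos_of_pos hTpos ξ
    linarith
  have hWT' : (W : ℝ) ≤ T := by exact_mod_cast hWT
  have hK0 : 0 < K := by linarith
  have hrpos : (0 : ℝ) < r := by
    by_contra hc
    have : K * (r : ℝ) ≤ 0 := mul_nonpos_of_nonneg_of_nonpos hK0.le (not_lt.1 hc)
    linarith
  have hr1 : (r : ℝ) ^ (-α) ≤ K ^ α * (W : ℝ) ^ (-α) := by
    have : (W : ℝ) / K ≤ r := by rw [div_le_iff₀ hK0]; linarith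
    calc (r : ℝ) ^ (-α) ≤ ((W : ℝ) / K) ^ (-α) :=
          Real.rpow_le_rpow_of_nonpos (by positivity) this (by linarith)
      _ = K ^ α * (W : ℝ) ^ (-α) := by
          rw [Real.div_rpow hWpos.le hK0.le, Real.rpow_neg hK0.le, div_inv_eq_mul, mul_comm]
  have hbr : (wd : ℝ) * ht + ((wd : ℝ) + ht) * r + (r : ℝ) ^ 2 ≤ 4 * K ^ 2 * (W * T) := by
    have a1 : (wd : ℝ) * ht ≤ K ^ 2 * (W * T) := by
      calc (wd : ℝ) * ht ≤ (K * W) * (K * T) := by gcongr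
        _ = _ := by ring
    have a2 : (wd : ℝ) * r ≤ K ^ 2 * (W * T) := by
      calc (wd : ℝ) * r ≤ (K * W) * (K * W) := by gcongr
        _ ≤ (K * W) * (K * T) := by gcongr
        _ = _ := by ring
    have a3 : (ht : ℝ) * r ≤ K ^ 2 * (W * T) := by
      calc (ht : ℝ) * r ≤ (K * T) * (K * W) := by gcongr
        _ = _ := by ring
    have a4 : (r : ℝ) ^ 2 ≤ K ^ 2 * (W * T) := by
      calc (r : ℝ) ^ 2 ≤ (K * W) ^ 2 := by gcongr
        _ = (K * W) * (K * W) := by ring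
        _ ≤ (K * W) * (K * T) := by gcongr
        _ = _ := by ring
    linarith
  have hWrate : (W : ℝ) * (W : ℝ) ^ (-α) ≤ 4 ^ (α - 1) * (T : ℝ) ^ (-(ξ * (α - 1))) := by
    have e : (W : ℝ) * (W : ℝ) ^ (-α) = (W : ℝ) ^ (-(α - 1)) := by
      rw [show -(α - 1) = 1 + -α by ring, Real.rpow_add hWpos, Real.rpow_one]
    rw [e]
    calc (W : ℝ) ^ (-(α - 1)) ≤ ((T : ℝ) ^ ξ / 4) ^ (-(α - 1)) :=
          Real.rpow_le_rpow_of_nonpos (by positivity) (by linarith) (by linarith)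
      _ = _ := by
          rw [Real.div_rpow (by positivity) (by norm_num), ← Real.rpow_mul hTpos.le,
            Real.rpow_neg (by norm_num : (0 : ℝ) ≤ 4), div_inv_eq_mul, mul_neg, mul_comm]
  have hfin : mixRate c₁ α wd ht r ≤ C * (T : ℝ) ^ (-(ξ * (α - 1) - 1)) := by
    calc mixRate c₁ α wd ht r
        ≤ 4 * (c₁ * (4 * K ^ 2 * (W * T)) * (K ^ α * (W : ℝ) ^ (-α))) := by
          rw [mixRate]; gcongr
      _ = 16 * c₁ * K ^ 2 * K ^ α * (W * (W : ℝ) ^ (-α)) * T := by ring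
      _ ≤ 16 * c₁ * K ^ 2 * K ^ α * (4 ^ (α - 1) * (T : ℝ) ^ (-(ξ * (α - 1)))) * T := by gcongr
      _ = C * ((T : ℝ) ^ (-(ξ * (α - 1))) * T) := by rw [hC]; ring
      _ = C * (T : ℝ) ^ (-(ξ * (α - 1) - 1)) := by
          rw [show -(ξ * (α - 1) - 1) = -(ξ * (α - 1)) + 1 by ring, Real.rpow_add hTpos,
            Real.rpow_one]
  exact hfin.trans (hT₀ T (le_of_max_le_left hT)).le

/-- If the median width drops by a large factor when the height is divided by `n`, then much wider
boxes are crossed with a probability that does not depend on `n`. -/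
lemma exists_crossProb_ge {ξ α c₁ : ℝ} (hξ₀ : 0 < ξ) (hα : 1 + ξ⁻¹ < α) (hc₁ : 0 < c₁) {n : ℕ}
    (hn : 100 ≤ n) : ∃ T₀ : ℕ, ∀ (ν : Measure Arrows), MixingLaw ν c₁ α → ∀ T : ℕ, T₀ ≤ T →
      (T : ℝ) ^ ξ ≤ 4 * medianWidth ν T → 20 * medianWidth ν (T / n) < medianWidth ν T →
      ∀ m : ℕ, 1 ≤ m → m ≤ 42 → ∀ w t : ℕ, 10 * w ≤ 6 * m * medianWidth ν T →
        11 * m * T ≤ 10 * t → (1 / 256 : ℝ) ^ m ≤ crossProb ν w t := by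
  obtain ⟨T₁, hT₁⟩ := exists_mixRate_le (K := 1000 * n) (τ := 1 / (3000 * (n + 3))) hξ₀ hα hc₁
    (by have : (100 : ℝ) ≤ n := by exact_mod_cast hn
        linarith) (by positivity)
  have hlim := (tendsto_rpow_atTop hξ₀).comp tendsto_natCast_atTop_atTop
  obtain ⟨T₂, hT₂⟩ := Filter.eventually_atTop.1
    (hlim.eventually (Filter.eventually_ge_atTop (1000000 * n : ℝ)))
  refine ⟨max (max T₁ T₂) (n * (10 * n + 10)), fun ν hν T hT hW hdrop m hm1 hm2 w' t hw' ht => ?_⟩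
  have := hν.isProb
  have hTT₁ : T₁ ≤ T := (le_max_left _ _).trans ((le_max_left _ _).trans hT)
  have hTT₂ : T₂ ≤ T := (le_max_right _ _).trans ((le_max_left _ _).trans hT)
  have hTn : n * (10 * n + 10) ≤ T := (le_max_right _ _).trans hT
  have hn0 : 0 < n := by omega
  set W := medianWidth ν T with hWdef
  have hWT : W ≤ T := medianWidth_le ν T
  have hWbig : 250000 * n ≤ W := by
    have h1 : (1000000 * n : ℝ) ≤ (T : ℝ) ^ ξ := hT₂ T hTT₂
    have h2 : (250000 * n : ℝ) ≤ W := by linarith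
    exact_mod_cast h2
  -- `q` is the height of a window
  set q := T / n with hq
  have hq1 : n * q ≤ T := Nat.mul_div_le T n
  have hq2 : T < n * q + n := by
    have := Nat.lt_mul_div_succ T hn0
    rw [mul_add, mul_one] at this
    exact this
  have hq3 : 10 * n + 10 ≤ q := (Nat.le_div_iff_mul_le hn0).2 (by rw [mul_comm]; exact hTn)
  set L := 2 * (q / 2) with hL
  set w := 2 * (W / 2) with hw
  set b := 2 * (W / 40) + 2 with hb
  set ρ := W / (400 * n) with hρ
  have hρ1 : 400 * (n * ρ) ≤ W := by
    have := Nat.mul_div_le W (400 * n)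
    rw [← mul_assoc]; exact this
  have hρ2 : W < 400 * (n * ρ) + 400 * n := by
    have := Nat.lt_mul_div_succ W (show 0 < 400 * n by omega)
    rw [mul_add, mul_one, mul_assoc] at this
    exact this
  have hρ3 : 1 ≤ ρ := (Nat.one_le_div_iff (by omega)).2 (by omega)
  set r := 2 * ρ with hr
  have hρn : 100 * ρ ≤ n * ρ := Nat.mul_le_mul_right _ hn
  -- `n * ρ` is compared with `n * q` through `W ≤ T`
  have hρq : 400 * ρ ≤ q + 1 := by
    by_contra hc
    have h1 : n * (q + 2) ≤ n * (400 * ρ) := Nat.mul_le_mul_left _ (by omega)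
    have h2 : n * (400 * ρ) = 400 * (n * ρ) := by ring
    rw [mul_add] at h1
    omega
  have hLq : L ≤ q ∧ q ≤ L + 1 := by omega
  have hnL : T ≤ (n + 1) * L := by
    have h1 : n * (q - 1) ≤ n * L := Nat.mul_le_mul_left _ (by omega)
    have h2 : n * (q - 1) = n * q - n := by rw [Nat.mul_sub, mul_one]
    rw [add_mul, one_mul]
    omega
  have hq100 : 100 * q ≤ n * q := Nat.mul_le_mul_right _ hn
  have hT'' : 100 * ((n + 2) * L + r) ≤ 110 * T := by
    have h1 : (n + 2) * L ≤ (n + 2) * q := Nat.mul_le_mul_left _ hLq.1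
    have h2 : (n + 2) * q = n * q + 2 * q := by ring
    omega
  have hRw : 1 / 2 ≤ crossProb ν w ((n + 1) * L) :=
    (half_le_crossProb_medianWidth ν T).trans
      ((crossProb_anti_width (by omega)).trans (crossProb_mono_time hnL))
  have hRb : crossProb ν b L ≤ 1 / 2 :=
    (crossProb_mono_time hLq.1).trans (crossProb_lt_half (by omega)).le
  set k := 2 * (13 * W) with hk
  have hmix : MixesAt ν (k + w) ((n + 1 + 1) * L) r (1 / (3000 * (n + 3))) := by
    have h0 := hν.mix (k + w) ((n + 1 + 1) * L) r (by omega)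
      (Nat.mul_pos (by omega) (by omega)) (by omega)
    have hle : mixRate c₁ α (k + w) ((n + 1 + 1) * L) r ≤ 1 / (3000 * (n + 3)) := by
      have hn' : (100 : ℝ) ≤ n := by exact_mod_cast hn
      refine hT₁ T W hTT₁ hW hWT _ _ _ ?_ ?_ ?_ ?_
      · have : k + w ≤ 27 * W := by omega
        have h2 : ((k + w : ℕ) : ℝ) ≤ 27 * W := by exact_mod_cast this
        have h3 : (0 : ℝ) ≤ W := by positivity
        nlinarith
      · have : (n + 1 + 1) * L ≤ 2 * T := by
          rw [show n + 1 + 1 = n + 2 by ring]; omega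
        have h2 : (((n + 1 + 1) * L : ℕ) : ℝ) ≤ 2 * T := by exact_mod_cast this
        have h3 : (0 : ℝ) ≤ T := by positivity
        nlinarith
      · have h1 : n ≤ n * ρ := Nat.le_mul_of_pos_right n hρ3
        have : W ≤ 1000 * n * r := by
          have e : 1000 * n * r = 2000 * (n * ρ) := by rw [hr]; ring
          omega
        exact_mod_cast this
      · have : r ≤ W := by omega
        have h2 : (r : ℝ) ≤ W := by exact_mod_cast this
        have h3 : (0 : ℝ) ≤ W := by positivity
        nlinarith
    exact h0.weaken hle
  have hτ : 3 * (((n + 1 : ℕ) : ℝ) + 2) * (1 / (3000 * (n + 3))) ≤ 1 / 1000 := by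
    push_cast
    rw [show (n : ℝ) + 1 + 2 = n + 3 by ring, mul_one_div, div_le_iff₀ (by positivity)]
    linarith
  rcases cross_or_displacement hν.toGoodLaw (k := k) (w := w) (b := b) (r := r) (L := L)
    (n := n + 1) (by omega) (by omega) (by omega) (by omega) (by omega) (by omega) (by omega)
    (by omega) hRw hRb hmix hτ with h | h
  · have h1 : (1 / 256 : ℝ) ^ m ≤ 1 / 200 := by
      calc (1 / 256 : ℝ) ^ m ≤ (1 / 256 : ℝ) ^ 1 :=
            pow_le_pow_of_le_one (by norm_num) (by norm_num) hm1
        _ ≤ _ := by norm_num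
    have hmW : m * W ≤ 42 * W := Nat.mul_le_mul_right _ hm2
    have hmT : 1 * T ≤ m * T := Nat.mul_le_mul_right _ hm1
    rw [mul_assoc] at hw' ht
    exact h1.trans (h.trans ((crossProb_anti_width (by omega)).trans
      (crossProb_mono_time (by rw [show n + 1 + 1 = n + 2 by ring]; omega))))
  · refine (h m).trans ((crossProb_anti_width ?_).trans (crossProb_mono_time ?_))
    · have h1 : m * (6 * W) ≤ m * (10 * (w - 6 * r - 2 * b)) := Nat.mul_le_mul_left _ (by omega)
      have e1 : m * (6 * W) = 6 * m * W := by ring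
      have e2 : m * (10 * (w - 6 * r - 2 * b)) = 10 * (m * (w - 6 * r - 2 * b)) := by ring
      omega
    · have h1 : m * (100 * ((n + 2) * L + r)) ≤ m * (110 * T) := Nat.mul_le_mul_left _ hT''
      have e1 : m * (100 * ((n + 2) * L + r)) = 100 * (m * ((n + 1 + 1) * L + r)) := by ring
      have e2 : m * (110 * T) = 10 * (11 * m * T) := by ring
      omega

/-- Repeated, nearly independent attempts at the crossings of `exists_crossProb_ge` make wide boxes
likely to be crossed at a larger height: if the median width drops by a large factor from the height `T` to the height `T / n`, then it also drops by a large factor from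
the height `n * T` to the height `T`. -/
lemma exists_medianWidth_mul_le {ξ α c₁ : ℝ} (hξ₀ : 0 < ξ) (hα : 1 + ξ⁻¹ < α) (hc₁ : 0 < c₁)
    {N n : ℕ} (hN : (1 - (1 / 256 : ℝ) ^ 42) ^ N ≤ 1 / 4) (hn : 100 ≤ n) (hNn : 50 * N ≤ n) :
    ∃ T₀ : ℕ, ∀ (ν : Measure Arrows), MixingLaw ν c₁ α → ∀ T : ℕ, T₀ ≤ T →
      (T : ℝ) ^ ξ ≤ 4 * medianWidth ν T → 20 * medianWidth ν (T / n) < medianWidth ν T →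
      21 * medianWidth ν T ≤ medianWidth ν (n * T) := by
  obtain ⟨T₁, hT₁⟩ := exists_crossProb_ge hξ₀ hα hc₁ hn
  obtain ⟨T₂, hT₂⟩ := exists_mixRate_le (K := 100 + n) (τ := 1 / (4 * (N + 1))) hξ₀ hα hc₁
    (by have : (0 : ℝ) ≤ n := n.cast_nonneg
        linarith) (by positivity)
  refine ⟨max T₁ T₂, fun ν hν T hT hW hdrop => ?_⟩
  have := hν.isProb
  have hc := hT₁ ν hν T (le_of_max_le_left hT) hW hdrop 42 (by norm_num) le_rfl
    (21 * medianWidth ν T) (48 * T) (by omega) (by omega)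
  have hWT := medianWidth_le ν T
  set W := medianWidth ν T with hWdef
  have hW0 : 0 < W := by omega
  refine le_medianWidth ?_
  have hnT : N * (48 * T + 2 * W) ≤ n * T := by
    calc N * (48 * T + 2 * W) ≤ N * (50 * T) := Nat.mul_le_mul_left _ (by omega)
      _ = 50 * N * T := by ring
      _ ≤ n * T := Nat.mul_le_mul_right _ hNn
  refine le_trans ?_ (crossProb_mono_time hnT)
  rcases Nat.eq_zero_or_pos N with rfl | hN0
  · norm_num at hN
  have hmix : MixesAt ν (21 * W) (N * (48 * T + 2 * W)) (2 * W) (1 / (4 * (N + 1))) := by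
    have h0 := hν.mix (21 * W) (N * (48 * T + 2 * W)) (2 * W) (by omega)
      (Nat.mul_pos hN0 (by omega)) (by omega)
    have hle : mixRate c₁ α (21 * W) (N * (48 * T + 2 * W)) (2 * W) ≤ 1 / (4 * (N + 1)) := by
      have hn0 : (0 : ℝ) ≤ n := n.cast_nonneg
      have hW' : (0 : ℝ) ≤ W := W.cast_nonneg
      have hT' : (0 : ℝ) ≤ T := T.cast_nonneg
      refine hT₂ T W (le_of_max_le_right hT) hW hWT _ _ _ ?_ ?_ ?_ ?_
      · push_cast; nlinarith
      · have : ((N * (48 * T + 2 * W) : ℕ) : ℝ) ≤ n * T := by exact_mod_cast hnT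
        nlinarith
      · push_cast; nlinarith
      · push_cast; nlinarith
    exact h0.weaken hle
  have key := one_sub_crossProb_le hν.toGoodLaw (c := (1 / 256 : ℝ) ^ 42) (N := N) (by omega)
    (by omega) hc (pow_le_one₀ (by norm_num) (by norm_num)) hmix
  have hNτ : (N : ℝ) * (1 / (4 * (N + 1))) ≤ 1 / 4 := by
    rw [mul_one_div, div_le_iff₀ (by positivity)]
    linarith
  push_cast at key ⊢
  linarith

/-- Boxes that are wider than the median width by a factor `12 / 10`, and higher by a factor
`22 / 10`, are crossed with at least a universal probability. The proof goes through
`exists_crossProb_ge`, whose assumption is a drop of the median width by a factor `20` from the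
height `T` to the height `T / n`. Such a drop is inherited by the larger scales, by
`exists_medianWidth_mul_le`. Without a drop at the height `T` there would thus be none at the
heights `T / n, T / n ^ 2, …`, and the median width of `T` would be at most of order
`20 ^ (log T / log n)`, which, with `n` large enough, is not compatible with
`T ^ ξ ≤ 4 * medianWidth ν T`. -/
theorem exists_crossProb_widen {ξ α c₁ : ℝ} (hξ₀ : 0 < ξ) (hα : 1 + ξ⁻¹ < α) (hc₁ : 0 < c₁) :
    ∃ T₀ : ℕ, ∀ (ν : Measure Arrows), MixingLaw ν c₁ α → ∀ T : ℕ, T₀ ≤ T →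
      (T : ℝ) ^ ξ ≤ 4 * medianWidth ν T → ∀ w t : ℕ, 10 * w ≤ 12 * medianWidth ν T →
        22 * T ≤ 10 * t → (1 / 256 : ℝ) ^ 2 ≤ crossProb ν w t := by
  obtain ⟨N, hN⟩ : ∃ N : ℕ, (1 - (1 / 256 : ℝ) ^ 42) ^ N < 1 / 4 :=
    exists_pow_lt_of_lt_one (by norm_num) (sub_lt_self 1 (by positivity))
  have hlim := (tendsto_rpow_atTop (half_pos hξ₀)).comp tendsto_natCast_atTop_atTop
  obtain ⟨n₀, hn₀⟩ := Filter.eventually_atTop.1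
    (hlim.eventually (Filter.eventually_ge_atTop (20 : ℝ)))
  obtain ⟨n, hn⟩ : ∃ n : ℕ, n = max n₀ (max 100 (50 * N)) := ⟨_, rfl⟩
  have hn20 : (20 : ℝ) ≤ (n : ℝ) ^ (ξ / 2) := hn₀ n (by omega)
  have hn100 : 100 ≤ n := by omega
  have hn1 : (1 : ℝ) ≤ n := by
    have : 1 ≤ n := by omega
    exact_mod_cast this
  have hn20' : (20 : ℝ) ≤ (n : ℝ) ^ ξ :=
    hn20.trans (Real.rpow_le_rpow_of_exponent_le hn1 (by linarith))
  obtain ⟨T₁, hT₁⟩ := exists_crossProb_ge hξ₀ hα hc₁ hn100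
  obtain ⟨T₂, hT₂⟩ := exists_medianWidth_mul_le hξ₀ hα hc₁ hN.le hn100 (show 50 * N ≤ n by omega)
  set M := max (max T₁ T₂) 1 with hM
  obtain ⟨T₃, hT₃⟩ := Filter.eventually_atTop.1
    (hlim.eventually (Filter.eventually_gt_atTop (80 * M : ℝ)))
  refine ⟨max M T₃, fun ν hν T hT hW w t hw ht => ?_⟩
  have hTM : M ≤ T := le_of_max_le_left hT
  have := hν.isProb
  refine hT₁ ν hν T (by omega) hW ?_ 2 (by norm_num) (by norm_num) w t (by omega) (by omega)
  by_contra hdeg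
  have hchain : ∀ j : ℕ, M ≤ T / n ^ j → medianWidth ν T ≤ 20 ^ j * medianWidth ν (T / n ^ j) ∧
      medianWidth ν (T / n ^ j) ≤ 20 * medianWidth ν (T / n ^ (j + 1)) := by
    intro j
    induction j with
    | zero => intro _; simpa using hdeg
    | succ j ih =>
      intro hj
      have hstep : T / n ^ (j + 1) = T / n ^ j / n := by rw [pow_succ, Nat.div_div_eq_div_mul]
      obtain ⟨h1, h2⟩ := ih (hj.trans (by rw [hstep]; exact Nat.div_le_self _ _))
      have h3 : medianWidth ν T ≤ 20 ^ (j + 1) * medianWidth ν (T / n ^ (j + 1)) := by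
        calc medianWidth ν T ≤ 20 ^ j * medianWidth ν (T / n ^ j) := h1
          _ ≤ 20 ^ j * (20 * medianWidth ν (T / n ^ (j + 1))) := Nat.mul_le_mul_left _ h2
          _ = _ := by ring
      refine ⟨h3, ?_⟩
      by_contra hcon
      set t' := T / n ^ (j + 1) with ht'
      have ht'T : n ^ (j + 1) * t' ≤ T := Nat.mul_div_le T (n ^ (j + 1))
      have hW' : (t' : ℝ) ^ ξ ≤ 4 * medianWidth ν t' := by
        have a1 : (20 : ℝ) ^ (j + 1) * (t' : ℝ) ^ ξ ≤ (T : ℝ) ^ ξ := by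
          calc (20 : ℝ) ^ (j + 1) * (t' : ℝ) ^ ξ
              ≤ ((n : ℝ) ^ ξ) ^ (j + 1) * (t' : ℝ) ^ ξ := by gcongr
            _ = ((n : ℝ) ^ (j + 1) * t') ^ ξ := by
                rw [Real.mul_rpow (by positivity) (by positivity), ← Real.rpow_natCast,
                  ← Real.rpow_natCast, ← Real.rpow_mul (by positivity),
                  ← Real.rpow_mul (by positivity), mul_comm ξ]
            _ ≤ (T : ℝ) ^ ξ := by
                refine Real.rpow_le_rpow (by positivity) ?_ hξ₀.le
                exact_mod_cast ht'T
        have a2 : (medianWidth ν T : ℝ) ≤ 20 ^ (j + 1) * medianWidth ν t' := by exact_mod_cast h3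
        have a3 : (20 : ℝ) ^ (j + 1) * (t' : ℝ) ^ ξ ≤
            20 ^ (j + 1) * (4 * medianWidth ν t') := by linarith
        exact le_of_mul_le_mul_left a3 (by positivity)
      have hcon' : 20 * medianWidth ν (t' / n) < medianWidth ν t' := by
        rw [ht', Nat.div_div_eq_div_mul, ← pow_succ]
        exact not_le.1 hcon
      have hup := hT₂ ν hν t' (by omega) hW' hcon'
      have hmono : medianWidth ν (n * t') ≤ medianWidth ν (T / n ^ j) :=
        medianWidth_mono ν (by rw [hstep]; exact Nat.mul_div_le _ _)
      omega
  have hex : ∃ j, T / n ^ j < M :=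
    ⟨T, by rw [Nat.div_eq_of_lt (Nat.lt_pow_self (by omega))]; omega⟩
  classical
  obtain ⟨J, hJ⟩ : ∃ J, Nat.find hex = J + 1 := by
    refine Nat.exists_eq_succ_of_ne_zero fun h0 => ?_
    have := Nat.find_spec hex
    rw [h0, pow_zero, Nat.div_one] at this
    omega
  have hJM : M ≤ T / n ^ J := not_lt.1 (Nat.find_min hex (by omega))
  have hJ1 : T / n ^ (J + 1) < M := hJ ▸ Nat.find_spec hex
  obtain ⟨h1, h2⟩ := hchain J hJM
  have h3 : medianWidth ν T ≤ 20 ^ J * (20 * M) :=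
    h1.trans (Nat.mul_le_mul_left _ (h2.trans
      (Nat.mul_le_mul_left _ ((medianWidth_le ν _).trans hJ1.le))))
  have hnJ : n ^ J ≤ T := by
    have : 1 ≤ T / n ^ J := by omega
    exact (Nat.one_le_div_iff (by positivity)).1 this
  have hTpos : (0 : ℝ) < T := by
    have : 0 < T := by omega
    exact_mod_cast this
  have h20 : (20 : ℝ) ^ J ≤ (T : ℝ) ^ (ξ / 2) := by
    calc (20 : ℝ) ^ J ≤ ((n : ℝ) ^ (ξ / 2)) ^ J := by gcongr
      _ = ((n : ℝ) ^ J) ^ (ξ / 2) := by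
          rw [← Real.rpow_natCast, ← Real.rpow_natCast, ← Real.rpow_mul (by positivity),
            ← Real.rpow_mul (by positivity), mul_comm (ξ / 2)]
      _ ≤ (T : ℝ) ^ (ξ / 2) := by
          refine Real.rpow_le_rpow (by positivity) ?_ (by linarith)
          exact_mod_cast hnJ
  have h4 : (T : ℝ) ^ (ξ / 2) * (T : ℝ) ^ (ξ / 2) ≤ (T : ℝ) ^ (ξ / 2) * (80 * M) := by
    rw [← Real.rpow_add hTpos, add_halves]
    have h3' : (medianWidth ν T : ℝ) ≤ 20 ^ J * (20 * M) := by exact_mod_cast h3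
    have hM0 : (0 : ℝ) ≤ M := M.cast_nonneg
    calc (T : ℝ) ^ ξ ≤ 4 * (20 ^ J * (20 * M)) := by linarith
      _ = 20 ^ J * (80 * M) := by ring
      _ ≤ _ := by gcongr
  have h5 := le_of_mul_le_mul_left h4 (Real.rpow_pos_of_pos hTpos _)
  have h6 : (80 * M : ℝ) < (T : ℝ) ^ (ξ / 2) := hT₃ T (le_of_max_le_right hT)
  linarith

/-! ### Positive association -/

/-- Positive association of a measure on an ordered space: increasing events are positively
correlated. -/
def PosAssoc {α : Type*} [Preorder α] [MeasurableSpace α] (μ : Measure α) : Prop :=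
  ∀ A B : Set α, MeasurableSet A → MeasurableSet B → IsUpperSet A → IsUpperSet B →
    μ A * μ B ≤ μ (A ∩ B)

namespace PosAssoc

lemma map {α β : Type*} [Preorder α] [Preorder β] [MeasurableSpace α] [MeasurableSpace β]
    {μ : Measure α} (h : PosAssoc μ) {g : α → β} (hg : Monotone g) (hm : Measurable g) :
    PosAssoc (μ.map g) := by
  intro A B hA hB hA' hB'
  rw [Measure.map_apply hm hA, Measure.map_apply hm hB, Measure.map_apply hm (hA.inter hB)]
  exact h _ _ (hm hA) (hm hB) (hA'.preimage hg) (hB'.preimage hg)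

/-- On a chain, of two increasing events one contains the other. -/
lemma of_linearOrder {α : Type*} [LinearOrder α] [MeasurableSpace α] (μ : Measure α)
    [IsProbabilityMeasure μ] : PosAssoc μ := by
  intro A B _ _ hA hB
  rcases hA.total hB with h | h
  · rw [Set.inter_eq_left.2 h]
    exact mul_le_of_le_one_right' prob_le_one
  · rw [Set.inter_eq_right.2 h]
    exact mul_le_of_le_one_left' prob_le_one

/-- Positive association of a product: for a given first coordinate, the second one is replaced by
two independent copies; then, for given values of these copies, the first coordinate is. -/
lemma prod {α β : Type*} [Preorder α] [Preorder β] [MeasurableSpace α] [MeasurableSpace β]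
    {μ : Measure α} {ν : Measure β} [IsProbabilityMeasure μ] [IsProbabilityMeasure ν]
    (hμ : PosAssoc μ) (hν : PosAssoc ν) : PosAssoc (μ.prod ν) := by
  intro A B hA hB hA' hB'
  set D : Set (α × (β × β)) := {p | (p.1, p.2.1) ∈ A ∧ (p.1, p.2.2) ∈ B} with hD
  have hDm : MeasurableSet D :=
    (measurable_fst.prodMk (measurable_fst.comp measurable_snd) hA).inter
      (measurable_fst.prodMk (measurable_snd.comp measurable_snd) hB)
  have h1 : (μ.prod (ν.prod ν)) D ≤ (μ.prod ν) (A ∩ B) := by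
    rw [Measure.prod_apply hDm, Measure.prod_apply (hA.inter hB)]
    refine lintegral_mono fun x => ?_
    have : Prod.mk x ⁻¹' D = (Prod.mk x ⁻¹' A) ×ˢ (Prod.mk x ⁻¹' B) := by ext; simp [hD]
    rw [this, Measure.prod_prod]
    exact hν _ _ (measurable_prodMk_left hA) (measurable_prodMk_left hB)
      (hA'.preimage fun _ _ h => ⟨le_rfl, h⟩) (hB'.preimage fun _ _ h => ⟨le_rfl, h⟩)
  refine le_trans ?_ h1
  rw [Measure.prod_apply_symm hDm, Measure.prod_apply_symm hA, Measure.prod_apply_symm hB,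
    ← lintegral_prod_mul (measurable_measure_prodMk_right hA).aemeasurable
      (measurable_measure_prodMk_right hB).aemeasurable]
  refine lintegral_mono fun y => ?_
  exact hμ _ _ (measurable_prodMk_right hA) (measurable_prodMk_right hB)
    (hA'.preimage fun _ _ h => ⟨h, le_rfl⟩) (hB'.preimage fun _ _ h => ⟨h, le_rfl⟩)

lemma infinitePi_fin {β : Type*} [Preorder β] [MeasurableSpace β] {ν : Measure β}
    [IsProbabilityMeasure ν] (hν : PosAssoc ν) (n : ℕ) :
    PosAssoc (Measure.infinitePi fun _ : Fin n => ν) := by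
  rw [Measure.infinitePi_eq_pi]
  induction n with
  | zero =>
    intro A B _ _ _ _
    rcases Set.eq_empty_or_nonempty A with rfl | hA
    · simp
    · rw [Subsingleton.eq_univ_of_nonempty hA]
      simp
  | succ n ih =>
    rw [← ((measurePreserving_piFinSuccAbove (fun _ : Fin (n + 1) => ν) 0).symm).map_eq]
    refine (hν.prod ih).map ?_ (MeasurableEquiv.measurable _)
    rintro ⟨x, f⟩ ⟨x', f'⟩ h
    intro i
    refine Fin.cases ?_ (fun j => ?_) i
    · exact h.1
    · exact h.2 j

lemma infinitePi {ι β : Type*} [Finite ι] [Preorder β] [MeasurableSpace β] {ν : Measure β}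
    [IsProbabilityMeasure ν] (hν : PosAssoc ν) :
    PosAssoc (Measure.infinitePi fun _ : ι => ν) := by
  obtain ⟨n, ⟨e⟩⟩ := Finite.exists_equiv_fin ι
  rw [← Measure.map_infinitePi_infinitePi_of_inj (P := fun _ : Fin n => ν) e.injective]
  exact (infinitePi_fin hν n).map (fun _ _ h i => h (e i))
    (measurable_pi_lambda _ fun i => measurable_pi_apply _)

end PosAssoc

/-! ### The arrows of the annealed walk -/

/-- The law of the numbers attached to the sites. -/
def uniforms : Measure (ℤ × ℤ → unitInterval) :=
  Measure.infinitePi fun _ : ℤ × ℤ => (volume : Measure unitInterval)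

instance : IsProbabilityMeasure uniforms := by unfold uniforms; infer_instance

lemma annealed_eq (P : Measure Env) : annealed P = P.prod uniforms := rfl

/-- The arrow, as a function of the values of the field and of the number at the site. -/
def arrow (δ v : ℝ) (u : unitInterval) : Bool := decide (1 / 2 - δ * Real.sign v ≤ (u : ℝ))

/-- The arrows of the annealed walk. -/
def arrowsOf (δ : ℝ) (ω : Sample) : Arrows := fun z => arrow δ (ω.1 z) (ω.2 z)

lemma jump_eq_steps (δ : ℝ) (ω : Sample) : jump δ ω = steps (arrowsOf δ ω) := by
  funext z
  simp [jump, steps, arrowsOf, arrow]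

lemma sign_mono : Monotone Real.sign := by
  intro a b h
  rcases lt_trichotomy a 0 with ha | ha | ha <;> rcases lt_trichotomy b 0 with hb | hb | hb <;>
    simp [Real.sign_of_neg, Real.sign_of_pos, ha, hb] <;> linarith

lemma arrow_mono {δ : ℝ} (hδ : 0 ≤ δ) {v v' : ℝ} {u u' : unitInterval} (hv : v ≤ v')
    (hu : u ≤ u') : arrow δ v u ≤ arrow δ v' u' := by
  simp only [arrow, Bool.le_iff_imp, decide_eq_true_eq]
  intro h
  have h1 := mul_le_mul_of_nonneg_left (sign_mono hv) hδ
  have h2 : (u : ℝ) ≤ u' := hu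
  linarith

lemma measurable_arrow {α : Type*} [MeasurableSpace α] (δ : ℝ) {v : α → ℝ} {u : α → unitInterval}
    (hv : Measurable v) (hu : Measurable u) : Measurable fun p => arrow δ (v p) (u p) := by
  refine measurable_to_bool ?_
  have : (fun p => arrow δ (v p) (u p)) ⁻¹' {true}
      = {p | 1 / 2 - δ * Real.sign (v p) ≤ (u p : ℝ)} := by
    ext p; simp [arrow]
  rw [this]
  refine measurableSet_le ?_ (measurable_subtype_coe.comp hu)
  exact measurable_const.sub ((sign_mono.measurable.comp hv).const_mul δ)

lemma measurable_arrowsOf (δ : ℝ) : Measurable (arrowsOf δ) := by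
  refine measurable_pi_lambda _ fun z => ?_
  exact measurable_arrow δ ((measurable_pi_apply z).comp measurable_fst)
    ((measurable_pi_apply z).comp measurable_snd)

/-- The law of the arrows of the annealed walk. -/
def arrowLaw (P : Measure Env) (δ : ℝ) : Measure Arrows := (annealed P).map (arrowsOf δ)

instance (P : Measure Env) [IsProbabilityMeasure P] : IsProbabilityMeasure (annealed P) := by
  rw [annealed_eq]; infer_instance

section Symmetries

variable {P : Measure Env} [IsProbabilityMeasure P] {δ : ℝ}

lemma isProbabilityMeasure_arrowLaw : IsProbabilityMeasure (arrowLaw P δ) :=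
  Measure.isProbabilityMeasure_map (measurable_arrowsOf δ).aemeasurable

lemma map_shift_arrowLaw (hT : TranslationInvariant P) (c : ℤ × ℤ) :
    (arrowLaw P δ).map (shift c) = arrowLaw P δ := by
  have hm1 : Measurable fun (f : Env) (x : ℤ × ℤ) => f (x + c) := by fun_prop
  have hm2 : Measurable fun (U : ℤ × ℤ → unitInterval) (x : ℤ × ℤ) => U (x + c) := by fun_prop
  have hU : uniforms.map (fun U x => U (x + c)) = uniforms :=
    Measure.map_infinitePi_infinitePi_of_inj (P := fun _ => (volume : Measure unitInterval))
      (add_left_injective c)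
  have hΦ : (annealed P).map (Prod.map (fun f x => f (x + c)) fun U x => U (x + c))
      = annealed P := by
    rw [annealed_eq, ← Measure.map_prod_map _ _ hm1 hm2, hU, hT c]
  conv_rhs => rw [arrowLaw, ← hΦ]
  rw [arrowLaw, Measure.map_map (measurable_shift c) (measurable_arrowsOf δ),
    Measure.map_map (measurable_arrowsOf δ) (hm1.prodMap hm2)]
  rfl

/-- The numbers `U` are replaced by `1 - U`, which exchanges the two steps except when `U` is equal
to the threshold. -/
lemma map_mirror_arrowLaw (hR : ReflectionSymmetric P) :
    (arrowLaw P δ).map mirror = arrowLaw P δ := by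
  have hm1 : Measurable fun (f : Env) (x : ℤ × ℤ) => -f (-x.1, x.2) := by fun_prop
  have hm2 : Measurable fun (U : ℤ × ℤ → unitInterval) (x : ℤ × ℤ) =>
      unitInterval.symm (U (-x.1, x.2)) :=
    measurable_pi_lambda _ fun x => unitInterval.measurable_symm.comp (measurable_pi_apply _)
  have hinj : Function.Injective fun x : ℤ × ℤ => (-x.1, x.2) := by
    rintro ⟨a, b⟩ ⟨a', b'⟩ h
    simpa using h
  have hU : uniforms.map (fun U x => unitInterval.symm (U (-x.1, x.2))) = uniforms := by
    have h1 := Measure.map_infinitePi_infinitePi_of_inj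
      (P := fun _ => (volume : Measure unitInterval)) hinj
    have h2 := Measure.infinitePi_map_pi (fun _ : ℤ × ℤ => (volume : Measure unitInterval))
      (f := fun _ => unitInterval.symm) (fun _ => unitInterval.measurable_symm)
    simp only [unitInterval.measurePreserving_symm.map_eq] at h2
    conv_rhs => rw [uniforms, ← h2]
    conv_rhs => rw [← h1]
    have hm3 : Measurable fun (U : ℤ × ℤ → unitInterval) (x : ℤ × ℤ) => unitInterval.symm (U x) :=
      measurable_pi_lambda _ fun x => unitInterval.measurable_symm.comp (measurable_pi_apply _)
    have hm4 : Measurable fun (U : ℤ × ℤ → unitInterval) (x : ℤ × ℤ) => U (-x.1, x.2) := by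
      fun_prop
    rw [Measure.map_map hm3 hm4]
    rfl
  have hΦ : (annealed P).map (Prod.map (fun f x => -f (-x.1, x.2)) fun U x =>
      unitInterval.symm (U (-x.1, x.2))) = annealed P := by
    rw [annealed_eq, ← Measure.map_prod_map _ _ hm1 hm2, hU, hR]
  have hae : ∀ᵐ ω ∂annealed P, ∀ z, (ω.2 z : ℝ) ≠ 1 / 2 - δ * Real.sign (ω.1 z) := by
    rw [ae_all_iff]
    intro z
    have hms : MeasurableSet {ω : Sample | (ω.2 z : ℝ) ≠ 1 / 2 - δ * Real.sign (ω.1 z)} := by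
      refine (measurableSet_eq_fun ?_ ?_).compl
      · exact measurable_subtype_coe.comp ((measurable_pi_apply z).comp measurable_snd)
      · exact measurable_const.sub
          ((sign_mono.measurable.comp ((measurable_pi_apply z).comp measurable_fst)).const_mul δ)
    rw [annealed_eq, Measure.ae_prod_iff_ae_ae hms]
    refine Filter.Eventually.of_forall fun f => ?_
    have hs : ({u : unitInterval | (u : ℝ) = 1 / 2 - δ * Real.sign (f z)}).Subsingleton :=
      fun a ha b hb => Subtype.ext (ha.trans hb.symm)
    have h0 : ∀ᵐ u : unitInterval ∂volume, (u : ℝ) ≠ 1 / 2 - δ * Real.sign (f z) := by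
      rw [ae_iff]
      simpa using hs.measure_zero (volume : Measure unitInterval)
    have h1 := Measure.infinitePi_map_eval (fun _ : ℤ × ℤ => (volume : Measure unitInterval)) z
    rw [← h1] at h0
    exact ae_of_ae_map (measurable_pi_apply z).aemeasurable h0
  conv_rhs => rw [arrowLaw, ← hΦ]
  rw [arrowLaw, Measure.map_map measurable_mirror (measurable_arrowsOf δ),
    Measure.map_map (measurable_arrowsOf δ) (hm1.prodMap hm2)]
  refine Measure.map_congr (hae.mono fun ω hω => ?_)
  funext z
  have h := hω (-z.1, z.2)
  simp only [Function.comp_apply, mirror, arrowsOf, arrow, Prod.map_fst, Prod.map_snd,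
    Real.sign_neg, unitInterval.coe_symm_eq]
  rw [← decide_not, decide_eq_decide, not_le]
  constructor
  · intro h'; linarith
  · intro h'
    rcases lt_or_gt_of_ne h with h'' | h''
    · exact h''
    · linarith

lemma fkg_arrowLaw (hF : FKG P) (hδ : 0 ≤ δ) (S : Finset (ℤ × ℤ)) (E F : Set Arrows)
    (hE : DetBy S E) (hF' : DetBy S F) (hEu : IsUpperSet E) (hFu : IsUpperSet F) :
    (arrowLaw P δ).real E * (arrowLaw P δ).real F ≤ (arrowLaw P δ).real (E ∩ F) := by
  classical
  have hP : PosAssoc P := hF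
  set μS := Measure.infinitePi fun _ : S => (volume : Measure unitInterval) with hμS
  have hμ : PosAssoc μS := PosAssoc.infinitePi (PosAssoc.of_linearOrder _)
  -- the arrows outside of `S` are set to `false`
  set Ψ : Env × (S → unitInterval) → Arrows := fun p z =>
    if h : z ∈ S then arrow δ (p.1 z) (p.2 ⟨z, h⟩) else false with hΨ
  have hΨm : Measurable Ψ := by
    refine measurable_pi_lambda _ fun z => ?_
    by_cases h : z ∈ S
    · simp only [hΨ, h, dite_true]
      exact measurable_arrow δ ((measurable_pi_apply z).comp measurable_fst)
        ((measurable_pi_apply (⟨z, h⟩ : S)).comp measurable_snd)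
    · simp only [hΨ, h, dite_false]
      exact measurable_const
  have hΨmono : Monotone Ψ := by
    intro p p' h z
    by_cases hz : z ∈ S
    · simp only [hΨ, hz, dite_true]
      exact arrow_mono hδ (h.1 z) (h.2 _)
    · simp [hΨ, hz]
  have hassoc := (hP.prod hμ).map hΨmono hΨm
  have hrm : Measurable fun (U : ℤ × ℤ → unitInterval) (z : S) => U z := by fun_prop
  have hlaw : P.prod μS = (annealed P).map (Prod.map id fun U (z : S) => U z) := by
    rw [annealed_eq, ← Measure.map_prod_map _ _ measurable_id hrm, Measure.map_id, hμS]
    congr 1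
    exact (Measure.map_infinitePi_infinitePi_of_inj
      (P := fun _ : ℤ × ℤ => (volume : Measure unitInterval)) Subtype.val_injective).symm
  have key : ∀ G : Set Arrows, DetBy S G → arrowLaw P δ G = (P.prod μS).map Ψ G := by
    intro G hG
    have hGm := hG.measurableSet S.finite_toSet
    rw [hlaw, Measure.map_map hΨm (measurable_id.prodMap hrm), arrowLaw,
      Measure.map_apply (measurable_arrowsOf δ) hGm,
      Measure.map_apply (hΨm.comp (measurable_id.prodMap hrm)) hGm]
    congr 1
    ext ω
    have he : ∀ z ∈ (S : Set (ℤ × ℤ)), arrowsOf δ ω z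
        = (Ψ ∘ Prod.map id fun U (z : S) => U z) ω z := by
      intro z hz
      simp [hΨ, arrowsOf, Finset.mem_coe.1 hz]
    exact ⟨hG he, hG fun z hz => (he z hz).symm⟩
  have := hassoc E F (hE.measurableSet S.finite_toSet) (hF'.measurableSet S.finite_toSet) hEu hFu
  rw [← key _ hE, ← key _ hF', ← key _ (hE.inter hF')] at this
  have hp := isProbabilityMeasure_arrowLaw (P := P) (δ := δ)
  rw [measureReal_def, measureReal_def, measureReal_def, ← ENNReal.toReal_mul]
  exact ENNReal.toReal_mono (measure_ne_top _ _) this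

lemma goodLaw_arrowLaw (hT : TranslationInvariant P) (hR : ReflectionSymmetric P) (hF : FKG P)
    (hδ : 0 ≤ δ) : GoodLaw (arrowLaw P δ) where
  isProb := isProbabilityMeasure_arrowLaw
  map_shift := map_shift_arrowLaw hT
  map_mirror := map_mirror_arrowLaw hR
  fkg := fkg_arrowLaw hF hδ

end Symmetries

/-! ### Decoupling for the arrows -/

/-- Extension of a function on `A` by a constant. -/
def extendConst {β : Type*} (A : Set (ℤ × ℤ)) (d : β) (g : A → β) (z : ℤ × ℤ) : β :=
  open Classical in if h : z ∈ A then g ⟨z, h⟩ else d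

lemma extendConst_domRestrict {β : Type*} {A : Set (ℤ × ℤ)} (d : β) (g : ℤ × ℤ → β) {z : ℤ × ℤ}
    (hz : z ∈ A) : extendConst A d (A.domRestrict g) z = g z := by
  simp [extendConst, hz]

lemma measurable_extendConst {β : Type*} [MeasurableSpace β] (A : Set (ℤ × ℤ)) (d : β) :
    Measurable (extendConst A d) := by
  refine measurable_pi_lambda _ fun z => ?_
  by_cases h : z ∈ A
  · simp only [extendConst, h, dite_true]
    exact measurable_pi_apply _
  · simp only [extendConst, h, dite_false]
    exact measurable_const

lemma indepFun_uniforms {A B : Set (ℤ × ℤ)} (hAB : Disjoint A B) :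
    IndepFun (fun U : ℤ × ℤ → unitInterval => A.domRestrict U) (fun U => B.domRestrict U)
      uniforms := by
  have hi : iIndepFun (fun (z : ℤ × ℤ) (U : ℤ × ℤ → unitInterval) => U z) uniforms :=
    iIndepFun_infinitePi (P := fun _ : ℤ × ℤ => (volume : Measure unitInterval))
      (X := fun _ u => u) fun _ => measurable_id
  have hle : ∀ C : Set (ℤ × ℤ), MeasurableSpace.comap
      (fun U : ℤ × ℤ → unitInterval => C.domRestrict U) MeasurableSpace.pi ≤
      ⨆ z ∈ C, MeasurableSpace.comap (fun U : ℤ × ℤ → unitInterval => U z) inferInstance := by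
    intro C
    rw [MeasurableSpace.pi, MeasurableSpace.comap_iSup]
    refine iSup_le fun z => ?_
    rw [MeasurableSpace.comap_comp]
    exact le_iSup₂_of_le z.1 z.2 le_rfl
  rw [IndepFun_iff_Indep]
  exact indep_of_indep_of_le_left (indep_of_indep_of_le_right
    (indep_iSup_of_disjoint (fun z => (measurable_pi_apply z).comap_le) hi hAB) (hle B)) (hle A)

section Decouple

variable {δ : ℝ} {A B : Set (ℤ × ℤ)} {E F : Set Arrows}

/-- Independence of the field in `A` and in `B` passes to the arrows. -/
lemma arrowLaw_inter_of_indepFun {P : Measure Env} [IsProbabilityMeasure P] (hAB : Disjoint A B)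
    (hind : IndepFun (fun f : Env => A.domRestrict f) (fun f => B.domRestrict f) P)
    (hE : MeasurableSet E) (hF : MeasurableSet F) (hEA : DetBy A E) (hFB : DetBy B F) :
    arrowLaw P δ (E ∩ F) = arrowLaw P δ E * arrowLaw P δ F := by
  have hpre : ∀ {G : Set Arrows}, MeasurableSet G → MeasurableSet (arrowsOf δ ⁻¹' G) :=
    fun hG => measurable_arrowsOf δ hG
  have hap : ∀ {G : Set Arrows}, MeasurableSet G →
      arrowLaw P δ G = ∫⁻ f, uniforms (Prod.mk f ⁻¹' (arrowsOf δ ⁻¹' G)) ∂P := by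
    intro G hG
    rw [arrowLaw, Measure.map_apply (measurable_arrowsOf δ) hG, annealed_eq,
      Measure.prod_apply (hpre hG)]
  -- the sections of an event determined by `C` only involve the numbers in `C`
  have hsec : ∀ {C : Set (ℤ × ℤ)} {G : Set Arrows}, MeasurableSet G → DetBy C G → ∀ f : Env,
      ∃ G' : Set (C → unitInterval), MeasurableSet G' ∧
        Prod.mk f ⁻¹' (arrowsOf δ ⁻¹' G) = (fun U => C.domRestrict U) ⁻¹' G' := by
    intro C G hG hC f
    refine ⟨{V | arrowsOf δ (f, extendConst C 0 V) ∈ G}, ?_, ?_⟩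
    · exact ((measurable_arrowsOf δ).comp
        (measurable_const.prodMk (measurable_extendConst C 0))) hG
    · ext U
      have he : ∀ z ∈ C, arrowsOf δ (f, U) z
          = arrowsOf δ (f, extendConst C 0 (C.domRestrict U)) z := fun z hz => by
        simp only [arrowsOf, extendConst_domRestrict 0 U hz]
      exact ⟨fun h => hC he h, fun h => hC (fun z hz => (he z hz).symm) h⟩
  -- and their probabilities only involve the field in `C`
  have hfun : ∀ {C : Set (ℤ × ℤ)} {G : Set Arrows}, MeasurableSet G → DetBy C G →
      ∃ g : (C → ℝ) → ENNReal, Measurable g ∧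
        (fun f : Env => uniforms (Prod.mk f ⁻¹' (arrowsOf δ ⁻¹' G)))
          = g ∘ fun f => C.domRestrict f := by
    intro C G hG hC
    refine ⟨fun φ => uniforms (Prod.mk (extendConst C 0 φ) ⁻¹' (arrowsOf δ ⁻¹' G)),
      (measurable_measure_prodMk_left (hpre hG)).comp (measurable_extendConst C 0), ?_⟩
    funext f
    simp only [Function.comp_apply]
    congr 1
    ext U
    have he : ∀ z ∈ C, arrowsOf δ (f, U) z
        = arrowsOf δ (extendConst C 0 (C.domRestrict f), U) z := fun z hz => by
      simp only [arrowsOf, extendConst_domRestrict 0 f hz]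
    exact ⟨fun h => hC he h, fun h => hC (fun z hz => (he z hz).symm) h⟩
  obtain ⟨g, hg, hgE⟩ := hfun hE hEA
  obtain ⟨k, hk, hkF⟩ := hfun hF hFB
  have hrA : Measurable fun f : Env => A.domRestrict f := by fun_prop
  have hrB : Measurable fun f : Env => B.domRestrict f := by fun_prop
  rw [hap hE, hap hF, hap (hE.inter hF), hgE, hkF,
    ← lintegral_mul_eq_lintegral_mul_lintegral_of_indepFun (hg.comp hrA) (hk.comp hrB)
      (hind.comp hg hk), ← hgE, ← hkF]
  refine lintegral_congr fun f => ?_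
  obtain ⟨E', hE', hE'e⟩ := hsec hE hEA f
  obtain ⟨F', hF', hF'e⟩ := hsec hF hFB f
  rw [Pi.mul_apply, Set.preimage_inter, Set.preimage_inter, hE'e, hF'e]
  exact (indepFun_uniforms hAB).measure_inter_preimage_eq_mul _ _ hE' hF'

/-- The arrows inherit the coupling: it is applied with the same numbers at the sites for both
fields. Each of the four occurrences of an event costs at most the probability that the coupling
fails. -/
lemma mixesAt_arrowLaw {P : Measure Env} {ε : ℕ → ℕ → ℕ → ℝ} (hD : Decoupling P ε)
    {wd ht r : ℕ} (hwd : 1 ≤ wd) (hht : 1 ≤ ht) (hr : 2 ≤ r) :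
    MixesAt (arrowLaw P δ) wd ht r (4 * ε wd ht r) := by
  intro a b A B hA hAB s E F hEF hdisj
  obtain ⟨Q, hQ, hQP, hQε, hQi⟩ := hD r hr a b wd ht hwd hht
  set e := ε wd ht r
  have hABd : Disjoint A B := by
    rw [Set.disjoint_left]
    intro z h1 h2
    have := hAB z h1 z h2
    simp [l1dist] at this
    omega
  set P' := Q.map Prod.snd with hP'
  have hP'p : IsProbabilityMeasure P' := Measure.isProbabilityMeasure_map measurable_snd.aemeasurable
  have hPp : IsProbabilityMeasure P := hQP ▸ Measure.isProbabilityMeasure_map measurable_fst.aemeasurable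
  have hind : IndepFun (fun f : Env => A.domRestrict f) (fun f => B.domRestrict f) P' := by
    have hm : ∀ C : Set (ℤ × ℤ), Measurable fun f : Env => C.domRestrict f := fun C => by fun_prop
    rw [indepFun_iff_measure_inter_preimage_eq_mul]
    intro S S' hS hS'
    rw [hP', Measure.map_apply measurable_snd (hm A hS), Measure.map_apply measurable_snd (hm B hS'),
      Measure.map_apply measurable_snd ((hm A hS).inter (hm B hS'))]
    exact (hQi A B hA hAB).measure_inter_preimage_eq_mul S S' hS hS'
  set μ := Q.prod uniforms with hμ
  set N : Set ((Env × Env) × (ℤ × ℤ → unitInterval)) := {p | p.1.2 ≠ p.1.1} with hN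
  set σ : (Env × Env) × (ℤ × ℤ → unitInterval) → Arrows := fun p => arrowsOf δ (p.1.1, p.2) with hσ
  set σ' : (Env × Env) × (ℤ × ℤ → unitInterval) → Arrows := fun p => arrowsOf δ (p.1.2, p.2)
    with hσ'
  have hσm : Measurable σ := (measurable_arrowsOf δ).comp
    ((measurable_fst.comp measurable_fst).prodMk measurable_snd)
  have hσ'm : Measurable σ' := (measurable_arrowsOf δ).comp
    ((measurable_snd.comp measurable_fst).prodMk measurable_snd)
  have hν : arrowLaw P δ = μ.map σ := by
    have : P.prod uniforms = μ.map (Prod.map Prod.fst id) := by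
      rw [hμ, ← Measure.map_prod_map _ _ measurable_fst measurable_id, hQP, Measure.map_id]
    rw [arrowLaw, annealed_eq, this, Measure.map_map (measurable_arrowsOf δ)
      (measurable_fst.prodMap measurable_id)]
    rfl
  have hν' : arrowLaw P' δ = μ.map σ' := by
    have : P'.prod uniforms = μ.map (Prod.map Prod.snd id) := by
      rw [hμ, ← Measure.map_prod_map _ _ measurable_snd measurable_id, hP', Measure.map_id]
    rw [arrowLaw, annealed_eq, this, Measure.map_map (measurable_arrowsOf δ)
      (measurable_snd.prodMap measurable_id)]
    rfl
  have hNe : μ.real N ≤ e := by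
    have h1 : N = {p : Env × Env | p.2 ≠ p.1} ×ˢ Set.univ := by ext; simp [hN]
    rw [h1, measureReal_def, hμ, Measure.prod_prod, measure_univ, mul_one]
    exact hQε
  have hσσ : ∀ p ∉ N, σ p = σ' p := by
    intro p hp
    have : p.1.2 = p.1.1 := not_not.1 hp
    simp only [hσ, hσ', this]
  have hr1 : ∀ {G}, MeasurableSet G → (arrowLaw P δ).real G = μ.real (σ ⁻¹' G) := fun hG => by
    rw [hν, map_measureReal_apply hσm hG]
  have hr2 : ∀ {G}, MeasurableSet G → (arrowLaw P' δ).real G = μ.real (σ' ⁻¹' G) := fun hG => by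
    rw [hν', map_measureReal_apply hσ'm hG]
  set μN := μ.restrict N with hμN
  have hμNr : ∀ {S}, MeasurableSet S → μN.real S = μ.real (S ∩ N) := fun hS => by
    rw [hμN, measureReal_restrict_apply hS]
  have hd : ∀ {G}, MeasurableSet G → |(arrowLaw P δ).real G - (arrowLaw P' δ).real G|
      ≤ μN.real (σ ⁻¹' G) + μN.real (σ' ⁻¹' G) := by
    intro G hG
    rw [hr1 hG, hr2 hG, hμNr (hσm hG), hμNr (hσ'm hG)]
    have h1 : σ ⁻¹' G ⊆ σ' ⁻¹' G ∪ (σ ⁻¹' G ∩ N) := by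
      intro p hp
      by_cases hpN : p ∈ N
      · exact Or.inr ⟨hp, hpN⟩
      · left; rw [Set.mem_preimage, ← hσσ p hpN]; exact hp
    have h2 : σ' ⁻¹' G ⊆ σ ⁻¹' G ∪ (σ' ⁻¹' G ∩ N) := by
      intro p hp
      by_cases hpN : p ∈ N
      · exact Or.inr ⟨hp, hpN⟩
      · left; rw [Set.mem_preimage, hσσ p hpN]; exact hp
    have h3 := (measureReal_mono h1 (μ := μ)).trans (measureReal_union_le _ _)
    have h4 := (measureReal_mono h2 (μ := μ)).trans (measureReal_union_le _ _)
    have h5 : 0 ≤ μ.real (σ ⁻¹' G ∩ N) := measureReal_nonneg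
    have h6 : 0 ≤ μ.real (σ' ⁻¹' G ∩ N) := measureReal_nonneg
    rw [abs_le]
    constructor <;> linarith
  have hd' : ∀ {G}, MeasurableSet G → |(arrowLaw P δ).real G - (arrowLaw P' δ).real G| ≤ e := by
    intro G hG
    rw [hr1 hG, hr2 hG]
    have h1 : σ ⁻¹' G ⊆ σ' ⁻¹' G ∪ N := by
      intro p hp
      by_cases hpN : p ∈ N
      · exact Or.inr hpN
      · left; rw [Set.mem_preimage, ← hσσ p hpN]; exact hp
    have h2 : σ' ⁻¹' G ⊆ σ ⁻¹' G ∪ N := by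
      intro p hp
      by_cases hpN : p ∈ N
      · exact Or.inr hpN
      · left; rw [Set.mem_preimage, hσσ p hpN]; exact hp
    have h3 := (measureReal_mono h1 (μ := μ)).trans (measureReal_union_le _ _)
    have h4 := (measureReal_mono h2 (μ := μ)).trans (measureReal_union_le _ _)
    rw [abs_le]
    constructor <;> linarith
  have hpν := isProbabilityMeasure_arrowLaw (P := P) (δ := δ)
  have hpν' := isProbabilityMeasure_arrowLaw (P := P') (δ := δ)
  -- the union, in the decoupled field
  have hm : ∀ i ∈ s, MeasurableSet (E i ∩ F i) := fun i hi => (hEF i hi).1.inter (hEF i hi).2.1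
  have hU : MeasurableSet (⋃ i ∈ s, E i ∩ F i) := Finset.measurableSet_biUnion s hm
  have hU' : (arrowLaw P' δ).real (⋃ i ∈ s, E i ∩ F i)
      = ∑ i ∈ s, (arrowLaw P' δ).real (E i) * (arrowLaw P' δ).real (F i) := by
    rw [measureReal_biUnion_finset (fun i hi j hj hij =>
      (hdisj hi hj hij).mono Set.inter_subset_left Set.inter_subset_left) hm]
    refine Finset.sum_congr rfl fun i hi => ?_
    obtain ⟨h1, h2, h3, h4⟩ := hEF i hi
    rw [measureReal_def, arrowLaw_inter_of_indepFun hABd hind h1 h2 h3 h4, ENNReal.toReal_mul]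
    rfl
  have hsum1 : ∑ i ∈ s, |(arrowLaw P δ).real (E i) - (arrowLaw P' δ).real (E i)| ≤ 2 * e := by
    have hb : ∀ τ : (Env × Env) × (ℤ × ℤ → unitInterval) → Arrows, Measurable τ →
        ∑ i ∈ s, μN.real (τ ⁻¹' E i) ≤ e := by
      intro τ hτ
      rw [← measureReal_biUnion_finset (fun i hi j hj hij => (hdisj hi hj hij).preimage τ)
        fun i hi => hτ (hEF i hi).1]
      refine (measureReal_mono (Set.subset_univ _)).trans ?_
      rw [hμNr MeasurableSet.univ, Set.univ_inter]
      exact hNe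
    calc _ ≤ ∑ i ∈ s, (μN.real (σ ⁻¹' E i) + μN.real (σ' ⁻¹' E i)) :=
          Finset.sum_le_sum fun i hi => hd (hEF i hi).1
      _ ≤ 2 * e := by
          rw [Finset.sum_add_distrib]
          linarith [hb σ hσm, hb σ' hσ'm]
  have hsumE : ∑ i ∈ s, (arrowLaw P' δ).real (E i) ≤ 1 := by
    rw [← measureReal_biUnion_finset hdisj fun i hi => (hEF i hi).1]
    exact measureReal_le_one
  have he0 : 0 ≤ e := measureReal_nonneg.trans hNe
  have hsum2 : |∑ i ∈ s, (arrowLaw P' δ).real (E i) * (arrowLaw P' δ).real (F i)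
      - ∑ i ∈ s, (arrowLaw P δ).real (E i) * (arrowLaw P δ).real (F i)| ≤ 3 * e := by
    rw [← Finset.sum_sub_distrib]
    refine (Finset.abs_sum_le_sum_abs _ _).trans ?_
    have hterm : ∀ i ∈ s, |(arrowLaw P' δ).real (E i) * (arrowLaw P' δ).real (F i)
        - (arrowLaw P δ).real (E i) * (arrowLaw P δ).real (F i)| ≤
        |(arrowLaw P δ).real (E i) - (arrowLaw P' δ).real (E i)|
          + (arrowLaw P' δ).real (E i) * e := by
      intro i hi
      have h1 := hd' (hEF i hi).2.1
      have h2 : |(arrowLaw P δ).real (F i)| ≤ 1 := by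
        rw [abs_of_nonneg measureReal_nonneg]; exact measureReal_le_one
      have h3 : (0 : ℝ) ≤ (arrowLaw P' δ).real (E i) := measureReal_nonneg
      calc _ = |-(((arrowLaw P δ).real (E i) - (arrowLaw P' δ).real (E i))
              * (arrowLaw P δ).real (F i))
            + -((arrowLaw P' δ).real (E i)
              * ((arrowLaw P δ).real (F i) - (arrowLaw P' δ).real (F i)))| := by ring_nf
        _ ≤ _ := by
            refine (abs_add_le _ _).trans ?_
            rw [abs_neg, abs_neg, abs_mul, abs_mul, abs_of_nonneg h3]
            exact add_le_add (mul_le_of_le_one_right (abs_nonneg _) h2)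
              (mul_le_mul_of_nonneg_left h1 h3)
    refine (Finset.sum_le_sum hterm).trans ?_
    rw [Finset.sum_add_distrib, ← Finset.sum_mul]
    have := mul_le_mul_of_nonneg_right hsumE he0
    linarith
  have h1 := hd' hU
  rw [hU'] at h1
  refine (abs_sub_le _ _ _).trans ((add_le_add h1 hsum2).trans_eq ?_)
  ring

end Decouple

lemma mixingLaw_arrowLaw {P : Measure Env} [IsProbabilityMeasure P] {ε : ℕ → ℕ → ℕ → ℝ}
    {δ c₁ α : ℝ} (hT : TranslationInvariant P) (hR : ReflectionSymmetric P) (hF : FKG P)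
    (hD : Decoupling P ε)
    (hε : ∀ w h r : ℕ, 1 ≤ w → 1 ≤ h → 2 ≤ r →
      ε w h r ≤ c₁ * ((w : ℝ) * h + ((w : ℝ) + h) * r + (r : ℝ) ^ 2) * (r : ℝ) ^ (-α))
    (hδ : 0 ≤ δ) : MixingLaw (arrowLaw P δ) c₁ α where
  toGoodLaw := goodLaw_arrowLaw hT hR hF hδ
  mix := fun wd ht r hwd hht hr => (mixesAt_arrowLaw hD hwd hht hr).weaken
    (mul_le_mul_of_nonneg_left (hε wd ht r hwd hht hr) (by norm_num))

/-! ### The walks started from arbitrary points of the plane -/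

/-- The edges of the even lattice fill the lines of slope `±1` through its points. -/
lemma mem_latticeEdges {v : ℝ × ℝ} :
    v ∈ latticeEdges ↔ (∃ k : ℤ, v.1 + v.2 = 2 * k) ∨ ∃ k : ℤ, v.2 - v.1 = 2 * k := by
  constructor
  · rintro ⟨u, ⟨x, n, ⟨k, hk⟩, rfl⟩, t, _, _, rfl | rfl⟩
    · refine Or.inr ⟨n - k, ?_⟩
      have : (x : ℝ) + n = k + k := by exact_mod_cast hk
      push_cast
      linarith
    · refine Or.inl ⟨k, ?_⟩
      have : (x : ℝ) + n = k + k := by exact_mod_cast hk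
      simp only
      linarith
  · rintro (⟨k, hk⟩ | ⟨k, hk⟩)
    · refine ⟨((⌈v.1⌉ : ℤ), ((2 * k - ⌈v.1⌉ : ℤ) : ℝ)), ⟨⌈v.1⌉, 2 * k - ⌈v.1⌉, ⟨k, by ring⟩, rfl⟩,
        ⌈v.1⌉ - v.1, by linarith [Int.le_ceil v.1], by linarith [Int.ceil_lt_add_one v.1],
        Or.inr (Prod.ext ?_ ?_)⟩ <;> push_cast <;> linarith
    · refine ⟨((⌊v.1⌋ : ℤ), ((⌊v.1⌋ + 2 * k : ℤ) : ℝ)), ⟨⌊v.1⌋, ⌊v.1⌋ + 2 * k,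
        ⟨⌊v.1⌋ + k, by ring⟩, rfl⟩,
        v.1 - ⌊v.1⌋, by linarith [Int.floor_le v.1], by linarith [Int.lt_floor_add_one v.1],
        Or.inl (Prod.ext ?_ ?_)⟩ <;> push_cast <;> linarith

/-- The number of the first descending diagonal `x + y = 2 * i` at or above a point. -/
def diagI (u : ℝ × ℝ) : ℤ := ⌈(u.1 + u.2) / 2⌉

/-- The number of the first ascending diagonal `y - x = 2 * j` at or above a point. -/
def diagJ (u : ℝ × ℝ) : ℤ := ⌈(u.2 - u.1) / 2⌉

/-- The space coordinate of the first site visited by the walk from a point. -/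
def tipX (u : ℝ × ℝ) : ℤ := diagI u - diagJ u

/-- The time coordinate of the first site visited by the walk from a point. -/
def tipN (u : ℝ × ℝ) : ℤ := diagI u + diagJ u

lemma diagI_bounds (u : ℝ × ℝ) : u.1 + u.2 ≤ 2 * diagI u ∧ 2 * diagI u < u.1 + u.2 + 2 := by
  have h1 := Int.le_ceil ((u.1 + u.2) / 2)
  have h2 := Int.ceil_lt_add_one ((u.1 + u.2) / 2)
  rw [diagI]
  constructor <;> linarith

lemma diagJ_bounds (u : ℝ × ℝ) : u.2 - u.1 ≤ 2 * diagJ u ∧ 2 * diagJ u < u.2 - u.1 + 2 := by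
  have h1 := Int.le_ceil ((u.2 - u.1) / 2)
  have h2 := Int.ceil_lt_add_one ((u.2 - u.1) / 2)
  rw [diagJ]
  constructor <;> linarith

lemma even_tip (u : ℝ × ℝ) : Even (tipX u + tipN u) := ⟨diagI u, by rw [tipX, tipN]; ring⟩

lemma cast_tipX (u : ℝ × ℝ) : (tipX u : ℝ) = diagI u - diagJ u := by simp [tipX]

lemma cast_tipN (u : ℝ × ℝ) : (tipN u : ℝ) = diagI u + diagJ u := by simp [tipN]

lemma tipX_bounds (u : ℝ × ℝ) : u.1 - 1 < tipX u ∧ tipX u < u.1 + 1 := by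
  have h1 := diagI_bounds u
  have h2 := diagJ_bounds u
  rw [cast_tipX]
  constructor <;> linarith

lemma tipN_bounds (u : ℝ × ℝ) : u.2 ≤ tipN u ∧ tipN u < u.2 + 2 := by
  have h1 := diagI_bounds u
  have h2 := diagJ_bounds u
  rw [cast_tipN]
  constructor <;> linarith

lemma hitTime_eq (u : ℝ × ℝ) :
    hitTime u = min (2 * diagI u - (u.1 + u.2)) (2 * diagJ u - (u.2 - u.1)) := by
  have h1 := diagI_bounds u
  have h2 := diagJ_bounds u
  refine IsLeast.csInf_eq ⟨⟨le_min (by linarith) (by linarith), ?_⟩, ?_⟩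
  · rw [mem_latticeEdges]
    rcases min_choice (2 * (diagI u : ℝ) - (u.1 + u.2)) (2 * diagJ u - (u.2 - u.1)) with h | h
    · exact Or.inl ⟨diagI u, by simp only [h]; ring⟩
    · exact Or.inr ⟨diagJ u, by simp only [h]; ring⟩
  · rintro s ⟨hs0, hs⟩
    rw [mem_latticeEdges] at hs
    rcases hs with ⟨k, hk⟩ | ⟨k, hk⟩
    · have : diagI u ≤ k := Int.ceil_le.2 (by simp only at hk; linarith)
      have : (diagI u : ℝ) ≤ k := by exact_mod_cast this
      simp only at hk
      exact (min_le_left _ _).trans (by linarith)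
    · have : diagJ u ≤ k := Int.ceil_le.2 (by simp only at hk; linarith)
      have : (diagJ u : ℝ) ≤ k := by exact_mod_cast this
      simp only at hk
      exact (min_le_right _ _).trans (by linarith)

lemma floor_sub_of_pos {x : ℤ} {e : ℝ} (h0 : 0 < e) (h1 : e < 1) : ⌊(x : ℝ) - e⌋ = x - 1 := by
  rw [Int.floor_eq_iff]
  push_cast
  constructor <;> linarith

lemma floor_add_of_lt {x : ℤ} {e : ℝ} (h0 : 0 < e) (h1 : e < 1) : ⌊(x : ℝ) + e⌋ = x := by
  rw [Int.floor_eq_iff]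
  constructor <;> linarith

/-- The walk along the edge that leads, in direction `d`, to the site `(x, n)`. -/
lemma edgeWalk_eq (σ : ℤ × ℤ → ℤ) {x n : ℤ} (hxn : Even (x + n)) {e d : ℝ} (h0 : 0 ≤ e)
    (h1 : e < 1) (hd : d = 1 ∨ d = -1) {t : ℝ} (ht : 0 ≤ t) :
    edgeWalk σ (x - d * e, n - e) t =
      if t ≤ e then x - d * (e - t) else latticeWalk σ x n (t - e) := by
  have hdir : 0 < e → edgeDir (x - d * e, n - e) = d := by
    intro he
    simp only [edgeDir]
    rcases hd with rfl | rfl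
    · rw [one_mul, floor_sub_of_pos he h1, floor_sub_of_pos he h1]
      exact Even.neg_one_zpow (by obtain ⟨k, hk⟩ := hxn; exact ⟨k - 1, by omega⟩)
    · rw [neg_one_mul, sub_neg_eq_add, floor_add_of_lt he h1, floor_sub_of_pos he h1]
      exact Odd.neg_one_zpow (by obtain ⟨k, hk⟩ := hxn; exact ⟨k - 1, by omega⟩)
  have htime : edgeTime (x - d * e, n - e) = e := by
    refine IsLeast.csInf_eq ⟨⟨h0, ?_⟩, ?_⟩
    · refine ⟨x, n, hxn, ?_⟩
      rcases h0.eq_or_lt with he | he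
      · simp [← he]
      · rw [hdir he]
        ext <;> simp only <;> ring
    · rintro s ⟨hs0, x', n', _, hs⟩
      have h2 : (n : ℝ) - e + s = n' := congrArg Prod.snd hs
      by_contra hc
      have h3 : n' < n := by
        have : (n' : ℝ) < n := by linarith
        exact_mod_cast this
      have h4 : n - 1 < n' := by
        have : (n : ℝ) - 1 < n' := by linarith
        exact_mod_cast this
      omega
  simp only [edgeWalk, htime]
  have hmul : edgeDir (x - d * e, n - e) * e = d * e := by
    rcases h0.eq_or_lt with he | he
    · simp [← he]
    · rw [hdir he]
  rw [hmul]
  split_ifs with hte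
  · rcases h0.eq_or_lt with he | he
    · have : t = 0 := by linarith
      simp [← he, this]
    · rw [hdir he]; ring
  · simp

/-- The two phases of a walk before it reaches the lattice, in closed form: it moves along one of
the two diagonals above its starting point after a vertical segment. -/
lemma walk_of_le (σ : ℤ × ℤ → ℤ) {u : ℝ × ℝ} {t : ℝ} (ht : u.2 + t ≤ tipN u) :
    walk σ u t = max (u.2 + t - 2 * diagJ u) (min (2 * diagI u - (u.2 + t)) u.1) := by
  have hx := tipX_bounds u
  rw [cast_tipX] at hx
  rw [cast_tipN] at ht
  rw [walk, hitTime_eq]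
  rcases le_or_gt (2 * (diagI u : ℝ) - (u.1 + u.2)) (2 * diagJ u - (u.2 - u.1)) with h | h
  · rw [min_eq_left h]
    split_ifs with h1
    · rw [min_eq_right (by linarith), max_eq_right (by linarith)]
    · have he := edgeWalk_eq σ (even_tip u) (e := u.1 - (diagI u - diagJ u)) (d := -1)
        (t := t - (2 * diagI u - (u.1 + u.2))) (by linarith) (by linarith) (Or.inr rfl)
        (by linarith)
      rw [cast_tipX, cast_tipN, if_pos (by linarith)] at he
      rw [min_eq_left (by linarith), max_eq_right (by linarith)]
      refine Eq.trans ?_ (he.trans (by ring))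
      congr 2 <;> ring
  · rw [min_eq_right h.le]
    split_ifs with h1
    · rw [min_eq_right (by linarith), max_eq_right (by linarith)]
    · have he := edgeWalk_eq σ (even_tip u) (e := (diagI u - diagJ u) - u.1) (d := 1)
        (t := t - (2 * diagJ u - (u.2 - u.1))) (by linarith) (by linarith) (Or.inl rfl)
        (by linarith)
      rw [cast_tipX, cast_tipN, if_pos (by linarith)] at he
      rw [min_eq_right (by linarith), max_eq_left (by linarith)]
      refine Eq.trans ?_ (he.trans (by ring))
      congr 2 <;> ring

lemma latticeWalk_zero (σ : ℤ × ℤ → ℤ) (x n : ℤ) : latticeWalk σ x n 0 = x := by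
  simp [latticeWalk, discreteWalk]

lemma walk_of_ge (σ : ℤ × ℤ → ℤ) {u : ℝ × ℝ} {t : ℝ} (ht : tipN u ≤ u.2 + t) :
    walk σ u t = latticeWalk σ (tipX u) (tipN u) (u.2 + t - tipN u) := by
  rcases ht.eq_or_lt with ht' | ht'
  · have hx := tipX_bounds u
    rw [walk_of_le σ ht'.ge, ← ht', sub_self, latticeWalk_zero]
    rw [cast_tipX] at *
    rw [cast_tipN, max_eq_left (by rw [min_le_iff]; left; linarith)]
    ring
  have hx := tipX_bounds u
  rw [cast_tipX] at hx
  rw [cast_tipN] at ht'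
  rw [walk, hitTime_eq]
  rcases le_or_gt (2 * (diagI u : ℝ) - (u.1 + u.2)) (2 * diagJ u - (u.2 - u.1)) with h | h
  · rw [min_eq_left h, if_neg (by linarith)]
    have he := edgeWalk_eq σ (even_tip u) (e := u.1 - (diagI u - diagJ u)) (d := -1)
      (t := t - (2 * diagI u - (u.1 + u.2))) (by linarith) (by linarith) (Or.inr rfl)
      (by linarith)
    rw [cast_tipX, cast_tipN, if_neg (by linarith)] at he
    rw [cast_tipN]
    convert he using 2 <;> ring_nf
  · rw [min_eq_right h.le, if_neg (by linarith)]
    have he := edgeWalk_eq σ (even_tip u) (e := (diagI u - diagJ u) - u.1) (d := 1)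
      (t := t - (2 * diagJ u - (u.2 - u.1))) (by linarith) (by linarith) (Or.inl rfl)
      (by linarith)
    rw [cast_tipX, cast_tipN, if_neg (by linarith)] at he
    rw [cast_tipN]
    convert he using 2 <;> ring_nf

lemma walk_mem_Icc_of_le (σ : ℤ × ℤ → ℤ) {u : ℝ × ℝ} {t : ℝ} (ht : u.2 + t ≤ tipN u) :
    min u.1 (tipX u) ≤ walk σ u t ∧ walk σ u t ≤ max u.1 (tipX u) := by
  rw [walk_of_le σ ht]
  rw [cast_tipN] at ht
  rw [cast_tipX]
  refine ⟨le_max_of_le_right (le_min ((min_le_right _ _).trans (by linarith)) (min_le_left _ _)),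
    max_le (le_max_of_le_right (by linarith)) ((min_le_right _ _).trans (le_max_left _ _))⟩

/-! ### Interpolation -/

lemma latticeWalk_eq (η : Arrows) (x n : ℤ) {k : ℕ} {t : ℝ} (h0 : (k : ℝ) ≤ t) (h1 : t < k + 1) :
    latticeWalk (steps η) x n t = (1 - (t - k)) * pos η x n k + (t - k) * pos η x n (k + 1) := by
  have : ⌊t⌋₊ = k := (Nat.floor_eq_iff ((Nat.cast_nonneg k).trans h0)).2 ⟨h0, h1⟩
  rw [latticeWalk, this]
  simp only [pos]
  ring

lemma latticeWalk_natCast (η : Arrows) (x n : ℤ) (k : ℕ) :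
    latticeWalk (steps η) x n k = pos η x n k := by
  rw [latticeWalk_eq η x n le_rfl (by linarith)]
  ring

lemma latticeWalk_le_add (η : Arrows) (x n : ℤ) {t : ℝ} (ht : 0 ≤ t) :
    latticeWalk (steps η) x n t ≤ x + t := by
  rw [latticeWalk_eq η x n (Nat.floor_le ht) (Nat.lt_floor_add_one t)]
  set k := ⌊t⌋₊
  have h1 : (pos η x n k : ℝ) ≤ x + k := by exact_mod_cast pos_le η x n k
  have h2 : (pos η x n (k + 1) : ℝ) ≤ x + k + 1 := by
    have := pos_le η x n (k + 1)
    have h : pos η x n (k + 1) ≤ x + k + 1 := by push_cast at this; omega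
    exact_mod_cast h
  have h3 := Nat.floor_le ht
  have h4 := Nat.lt_floor_add_one t
  nlinarith

lemma sub_le_latticeWalk (η : Arrows) (x n : ℤ) {t : ℝ} (ht : 0 ≤ t) :
    x - t ≤ latticeWalk (steps η) x n t := by
  rw [latticeWalk_eq η x n (Nat.floor_le ht) (Nat.lt_floor_add_one t)]
  set k := ⌊t⌋₊
  have h1 : (x : ℝ) - k ≤ pos η x n k := by exact_mod_cast le_pos η x n k
  have h2 : (x : ℝ) - k - 1 ≤ pos η x n (k + 1) := by
    have := le_pos η x n (k + 1)
    have h : x - k - 1 ≤ pos η x n (k + 1) := by push_cast at this; omega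
    exact_mod_cast h
  have h3 := Nat.floor_le ht
  have h4 := Nat.lt_floor_add_one t
  nlinarith

lemma latticeWalk_mono (η : Arrows) {x x' n : ℤ} (h : x ≤ x') (hp : (x' - x) % 2 = 0) {t : ℝ}
    (ht : 0 ≤ t) : latticeWalk (steps η) x n t ≤ latticeWalk (steps η) x' n t := by
  have h3 := Nat.floor_le ht
  have h4 := Nat.lt_floor_add_one t
  rw [latticeWalk_eq η x n h3 h4, latticeWalk_eq η x' n h3 h4]
  set k := ⌊t⌋₊
  have h1 : (pos η x n k : ℝ) ≤ pos η x' n k := by exact_mod_cast pos_mono le_rfl n h hp k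
  have h2 : (pos η x n (k + 1) : ℝ) ≤ pos η x' n (k + 1) := by
    exact_mod_cast pos_mono le_rfl n h hp (k + 1)
  nlinarith

lemma latticeWalk_natCast_add (η : Arrows) (x n : ℤ) (k : ℕ) {t : ℝ} (ht : 0 ≤ t) :
    latticeWalk (steps η) x n (k + t) = latticeWalk (steps η) (pos η x n k) (n + k) t := by
  have h3 := Nat.floor_le ht
  have h4 := Nat.lt_floor_add_one t
  rw [latticeWalk_eq η _ _ h3 h4, latticeWalk_eq η x n (k := k + ⌊t⌋₊) (by push_cast; linarith)
    (by push_cast; linarith), pos_add, add_assoc k, pos_add]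
  push_cast
  ring

/-- Walks started at the same time keep their order. -/
lemma walk_mono (η : Arrows) {a b y : ℝ} (hab : a ≤ b) (t : ℝ) :
    walk (steps η) (a, y) t ≤ walk (steps η) (b, y) t := by
  have hI : diagI (a, y) ≤ diagI (b, y) := Int.ceil_mono (by simp only; linarith)
  have hJ : diagJ (b, y) ≤ diagJ (a, y) := Int.ceil_mono (by simp only; linarith)
  have hI' : (diagI (a, y) : ℝ) ≤ diagI (b, y) := by exact_mod_cast hI
  have hJ' : (diagJ (b, y) : ℝ) ≤ diagJ (a, y) := by exact_mod_cast hJ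
  rcases le_total (y + t) (tipN (a, y)) with h1 | h1 <;>
    rcases le_total (y + t) (tipN (b, y)) with h2 | h2
  · rw [walk_of_le _ h1, walk_of_le _ h2]
    simp only
    gcongr
  · rw [walk_of_le _ h1, walk_of_ge _ h2]
    have h3 := sub_le_latticeWalk η (tipX (b, y)) (tipN (b, y))
      (t := y + t - tipN (b, y)) (by linarith)
    refine le_trans ?_ h3
    simp only [cast_tipX, cast_tipN] at *
    exact max_le (by linarith) ((min_le_left _ _).trans (by linarith))
  · rw [walk_of_ge _ h1, walk_of_le _ h2]
    have h3 := latticeWalk_le_add η (tipX (a, y)) (tipN (a, y))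
      (t := y + t - tipN (a, y)) (by linarith)
    refine h3.trans (le_trans ?_ (le_max_left _ _))
    simp only [cast_tipX, cast_tipN] at *
    linarith
  · rw [walk_of_ge _ h1, walk_of_ge _ h2]
    simp only
    have hxa : tipX (a, y) = diagI (a, y) - diagJ (a, y) := rfl
    have hxb : tipX (b, y) = diagI (b, y) - diagJ (b, y) := rfl
    have hna : tipN (a, y) = diagI (a, y) + diagJ (a, y) := rfl
    have hnb : tipN (b, y) = diagI (b, y) + diagJ (b, y) := rfl
    rcases le_total (tipN (a, y)) (tipN (b, y)) with h | h
    · obtain ⟨k, hk⟩ := Int.eq_ofNat_of_zero_le (sub_nonneg.2 h)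
      have e : tipN (b, y) = tipN (a, y) + k := by omega
      have e' : (tipN (b, y) : ℝ) = tipN (a, y) + k := by exact_mod_cast e
      have := pos_le η (tipX (a, y)) (tipN (a, y)) k
      have hpar := pos_parity η (tipX (a, y)) (tipN (a, y)) k
      rw [show y + t - (tipN (a, y) : ℝ) = k + (y + t - tipN (b, y)) by rw [e']; ring,
        latticeWalk_natCast_add _ _ _ _ (by linarith), ← e]
      exact latticeWalk_mono η (by omega) (by omega) (by linarith)
    · obtain ⟨k, hk⟩ := Int.eq_ofNat_of_zero_le (sub_nonneg.2 h)
      have e : tipN (a, y) = tipN (b, y) + k := by omega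
      have e' : (tipN (a, y) : ℝ) = tipN (b, y) + k := by exact_mod_cast e
      have := le_pos η (tipX (b, y)) (tipN (b, y)) k
      have hpar := pos_parity η (tipX (b, y)) (tipN (b, y)) k
      rw [show y + t - (tipN (b, y) : ℝ) = k + (y + t - tipN (a, y)) by rw [e']; ring,
        latticeWalk_natCast_add _ _ _ _ (by linarith), ← e]
      exact latticeWalk_mono η (by omega) (by omega) (by linarith)

/-! ### Crossings of boxes of the plane and crossings by lattice walks -/

lemma latticeWalk_eq_of_le (η : Arrows) (x n : ℤ) {k : ℕ} {t : ℝ} (h0 : (k : ℝ) ≤ t)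
    (h1 : t ≤ k + 1) :
    latticeWalk (steps η) x n t = (1 - (t - k)) * pos η x n k + (t - k) * pos η x n (k + 1) := by
  rcases h1.lt_or_eq with h | h
  · exact latticeWalk_eq η x n h0 h
  · have : t = ((k + 1 : ℕ) : ℝ) := by push_cast; exact h
    rw [this, latticeWalk_natCast]
    push_cast
    ring

lemma exists_latticeWalk_le_pos (η : Arrows) (x n : ℤ) {t : ℝ} (ht : 0 ≤ t) :
    ∃ m : ℕ, (m : ℝ) ≤ t + 1 ∧ latticeWalk (steps η) x n t ≤ pos η x n m := by
  have h3 := Nat.floor_le ht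
  have h4 := Nat.lt_floor_add_one t
  by_contra! hc
  have h1 := hc ⌊t⌋₊ (by linarith)
  have h2 := hc (⌊t⌋₊ + 1) (by push_cast; linarith)
  have h5 := latticeWalk_eq η x n h3 h4
  nlinarith

lemma exists_pos_le_latticeWalk (η : Arrows) (x n : ℤ) {t : ℝ} (ht : 0 ≤ t) :
    ∃ m : ℕ, (m : ℝ) ≤ t + 1 ∧ pos η x n m ≤ latticeWalk (steps η) x n t := by
  have h3 := Nat.floor_le ht
  have h4 := Nat.lt_floor_add_one t
  by_contra! hc
  have h1 := hc ⌊t⌋₊ (by linarith)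
  have h2 := hc (⌊t⌋₊ + 1) (by push_cast; linarith)
  have h5 := latticeWalk_eq η x n h3 h4
  nlinarith

lemma exists_even_site (X : ℤ) (y : ℝ) : ∃ N : ℤ, (X + N) % 2 = 0 ∧ y - 2 < N ∧ N ≤ y := by
  have h1 := Int.floor_le y
  have h2 := Int.lt_floor_add_one y
  rcases Int.emod_two_eq_zero_or_one (X + ⌊y⌋) with h | h
  · exact ⟨⌊y⌋, h, by linarith, h1⟩
  · exact ⟨⌊y⌋ - 1, by omega, by push_cast; linarith, by push_cast; linarith⟩

/-- A horizontal crossing of a box is, up to a translation and to rounding, a crossing by a walk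
that starts from a corner. -/
lemma exists_horizontalCrossing_subset (δ : ℝ) (u : ℝ × ℝ) (w : ℝ) {h : ℝ} {T : ℕ}
    (hT : h + 3 ≤ T) : ∃ c, horizontalCrossing δ u w h ⊆
      {ω | shift c (arrowsOf δ ω) ∈ Cross (⌊w⌋ - 2) T} := by
  set X : ℤ := ⌈u.1⌉ + 1 with hX
  obtain ⟨N, hpar, hN1, hN2⟩ := exists_even_site X u.2
  have hX1 : u.1 + 1 ≤ X := by rw [hX]; push_cast; linarith [Int.le_ceil u.1]
  have hX2 : X < u.1 + 2 := by rw [hX]; push_cast; linarith [Int.ceil_lt_add_one u.1]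
  refine ⟨(X, N), ?_⟩
  rintro ω ⟨v, ⟨hvb, hv1⟩, t, ht, ⟨hvt, hvr⟩, _⟩
  rw [jump_eq_steps] at hvt hvr
  set η := arrowsOf δ ω
  have htip := tipX_bounds v
  have htipN := tipN_bounds v
  have hv2 : u.2 ≤ v.2 := hvb.2.2.1
  have hvt2 : v.2 + t ≤ u.2 + h := hvt.2.2.2
  simp only at hvr
  rcases le_total (v.2 + t) (tipN v) with hle | hge
  · have h1 := (walk_mem_Icc_of_le (steps η) hle).2
    rw [hvr] at h1
    have h2 : max v.1 (tipX v : ℝ) < u.1 + 1 := max_lt (by linarith) (by linarith)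
    have h3 : ⌊w⌋ < 1 := Int.floor_lt.2 (by push_cast; linarith)
    exact ⟨0, Nat.zero_le _, by rw [pos_zero]; omega⟩
  · rw [walk_of_ge _ hge] at hvr
    obtain ⟨m, hm1, hm2⟩ := exists_latticeWalk_le_pos η (tipX v) (tipN v)
      (t := v.2 + t - tipN v) (by linarith)
    rw [hvr] at hm2
    have hNv : N ≤ tipN v := by
      have : (N : ℝ) ≤ tipN v := by linarith
      exact_mod_cast this
    have hXv : tipX v ≤ X := by
      have : (tipX v : ℝ) ≤ X := by linarith
      exact_mod_cast this
    have hev := even_tip v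
    refine cross_of_path (le_floorAt 0 _) (x := tipX v - X) (n := tipN v - N) (m := m)
      (by omega) (by omega) (by obtain ⟨k, hk⟩ := hev; omega) ?_ ?_
    · have : (tipN v : ℝ) - N + m ≤ T := by linarith
      exact_mod_cast this
    · rw [pos_shift]
      simp only [sub_add_cancel]
      have h1 : (⌊w⌋ : ℝ) - 2 < pos η (tipX v) (tipN v) m - X := by
        linarith [Int.floor_le w]
      have : ⌊w⌋ - 2 < pos η (tipX v) (tipN v) m - X := by exact_mod_cast h1
      exact this.le

lemma barrier_steps (a : ℝ) (η : Arrows) : barrier a (steps η) = steps (ceilAt ⌊a⌋ η) := by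
  funext z
  have : a < z.1 ↔ ¬ z.1 ≤ ⌊a⌋ := by rw [not_le, Int.floor_lt]
  by_cases h : z.1 ≤ ⌊a⌋ <;> simp [barrier, this, steps, ceilAt, h]

/-- Among the reflected walks that start from the bottom face of the box, the one that starts from
the corner on the reflecting line is the most likely to cross the box vertically. -/
lemma mem_verticalCrossing_iff {δ w h : ℝ} (hw : 0 ≤ w) (hh : 0 ≤ h) {u : ℝ × ℝ} {ω : Sample} :
    ω ∈ verticalCrossing δ u w h ↔ ∀ s, 0 ≤ s → s ≤ h →
      u.1 ≤ walk (steps (ceilAt ⌊u.1 + w⌋ (arrowsOf δ ω))) (u.1 + w, u.2) s := by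
  have hb : barrier (u.1 + w) (jump δ ω) = steps (ceilAt ⌊u.1 + w⌋ (arrowsOf δ ω)) := by
    rw [jump_eq_steps, barrier_steps]
  constructor
  · rintro ⟨v, ⟨hvb, hv2⟩, t, ht, ⟨_, hvt⟩, hbox⟩ s hs0 hsh
    simp only [hv2] at hvt
    have h1 := (hbox s hs0 (by linarith)).1
    simp only [reflectedWalk, hb] at h1
    have h2 := walk_mono (ceilAt ⌊u.1 + w⌋ (arrowsOf δ ω)) (y := u.2) hvb.2.1 s
    have h3 : v = (v.1, u.2) := Prod.ext rfl hv2
    rw [h3] at h1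
    exact (h1.trans (min_le_right _ _)).trans h2
  · intro hω
    have hbox : ∀ s, 0 ≤ s → s ≤ h → (reflectedWalk (u.1 + w) (jump δ ω) (u.1 + w, u.2) s,
        u.2 + s) ∈ box u w h := by
      intro s hs0 hsh
      refine ⟨?_, min_le_left _ _, by simp only; linarith, by simp only; linarith⟩
      simp only [reflectedWalk, hb]
      exact le_min (by linarith) (hω s hs0 hsh)
    exact ⟨(u.1 + w, u.2), ⟨⟨by simp only; linarith, le_rfl, le_rfl, by simp only; linarith⟩, rfl⟩,
      h, hh, ⟨hbox h hh le_rfl, rfl⟩, hbox⟩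

/-- If a box is not crossed vertically then, up to a reflection, a translation and rounding, it is
crossed by a walk that starts from a corner. -/
lemma exists_compl_verticalCrossing_subset (δ : ℝ) (u : ℝ × ℝ) {w h : ℝ} (hw : 1 ≤ w)
    (hh : 0 ≤ h) {T : ℕ} (hT : h + 3 ≤ T) : ∃ c, (verticalCrossing δ u w h)ᶜ ⊆
      {ω | mirror (shift c (arrowsOf δ ω)) ∈ Cross (⌊w⌋ - 2) T} := by
  set a := u.1 + w with ha
  set X : ℤ := ⌊a⌋ - 1 with hX
  obtain ⟨N, hpar, hN1, hN2⟩ := exists_even_site X u.2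
  have hX1 : X ≤ a - 1 := by rw [hX]; push_cast; linarith [Int.floor_le a]
  have hX2 : a - 2 < X := by rw [hX]; push_cast; linarith [Int.lt_floor_add_one a]
  refine ⟨(X, N), fun ω hω => ?_⟩
  rw [Set.mem_compl_iff, mem_verticalCrossing_iff (by linarith) hh, ← ha] at hω
  push Not at hω
  obtain ⟨s, hs0, hsh, hlt⟩ := hω
  set η := arrowsOf δ ω
  have htip := tipX_bounds (a, u.2)
  have htipN := tipN_bounds (a, u.2)
  simp only at htip htipN
  rcases le_total (u.2 + s) (tipN (a, u.2)) with hle | hge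
  · have h1 := (walk_mem_Icc_of_le (steps (ceilAt ⌊a⌋ η)) (u := (a, u.2)) hle).1
    have h2 : u.1 ≤ min a (tipX (a, u.2) : ℝ) := le_min (by linarith) (by linarith)
    exact absurd (hlt.trans_le h2) (not_lt.2 h1)
  · rw [walk_of_ge _ hge] at hlt
    set x := tipX (a, u.2)
    set n := tipN (a, u.2)
    obtain ⟨m, hm1, hm2⟩ := exists_pos_le_latticeWalk (ceilAt ⌊a⌋ η) x n
      (t := u.2 + s - n) (by linarith)
    have hNv : N ≤ n := by
      have : (N : ℝ) ≤ n := by linarith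
      exact_mod_cast this
    have hXv : X ≤ x := by
      have : (X : ℝ) ≤ x := by linarith
      exact_mod_cast this
    have hev : Even (x + n) := even_tip _
    refine cross_of_path (η := mirror (shift (X, N) (ceilAt ⌊a⌋ η))) ?_ (x := -(x - X))
      (n := n - N) (m := m) (by omega) (by omega) (by obtain ⟨k, hk⟩ := hev; omega) ?_ ?_
    · -- the reflecting line becomes a barrier to the left of the origin
      intro z
      simp only [mirror, shift, ceilAt, floorAt, Bool.le_iff_imp]
      by_cases h0 : z.1 < 0
      · simp [h0]
      · have : -z.1 + X ≤ ⌊a⌋ := by omega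
        simp only [h0, Prod.fst_add, this, decide_true, Bool.true_and, decide_false, Bool.false_or]
        exact id
    · have : (n : ℝ) - N + m ≤ T := by linarith
      exact_mod_cast this
    · rw [pos_mirror, pos_shift]
      simp only [neg_neg, sub_add_cancel]
      have h1 : (⌊w⌋ : ℝ) - 2 < -(pos (ceilAt ⌊a⌋ η) x n m - X) := by
        linarith [Int.floor_le w]
      have : ⌊w⌋ - 2 < -(pos (ceilAt ⌊a⌋ η) x n m - X) := by exact_mod_cast h1
      exact this.le

/-- The first time at which an interpolated walk hits a level. -/
lemma exists_hit_of_pos {η : Arrows} {x n : ℤ} {m : ℕ} {a y : ℝ} (hx : x < y)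
    (hm : y ≤ pos η x n m) (ha : ∀ i ≤ m, a ≤ pos η x n i) :
    ∃ r : ℝ, 0 ≤ r ∧ r ≤ m ∧ latticeWalk (steps η) x n r = y ∧ ∀ r', 0 ≤ r' → r' ≤ r →
      a ≤ latticeWalk (steps η) x n r' ∧ latticeWalk (steps η) x n r' ≤ y := by
  have hex : ∃ m, y ≤ pos η x n m := ⟨m, hm⟩
  have hle : Nat.find hex ≤ m := Nat.find_min' hex hm
  obtain ⟨k, hk⟩ : ∃ k, Nat.find hex = k + 1 := by
    refine Nat.exists_eq_succ_of_ne_zero fun h0 => ?_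
    have := Nat.find_spec hex
    rw [h0, pos_zero] at this
    linarith
  have hk1 : y ≤ pos η x n (k + 1) := hk ▸ Nat.find_spec hex
  have hk2 : ∀ i ≤ k, pos η x n i < y := fun i hi => not_le.1 (Nat.find_min hex (by omega))
  have hkm : (k : ℝ) + 1 ≤ m := by
    have : k + 1 ≤ m := by omega
    exact_mod_cast this
  have hstep : (pos η x n (k + 1) : ℝ) = pos η x n k + 1 := by
    have h1 := hk2 k le_rfl
    rw [pos_succ] at hk1 ⊢
    rcases steps_eq η (pos η x n k, n + k) with h | h
    · rw [h.2]; push_cast; ring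
    · rw [h.2] at hk1; push_cast at hk1; linarith
  have hk0 : (0 : ℝ) ≤ k := Nat.cast_nonneg k
  have hkk := hk2 k le_rfl
  have hfin : latticeWalk (steps η) x n (k + (y - pos η x n k)) = y := by
    rw [latticeWalk_eq_of_le η x n (k := k) (by linarith) (by linarith), hstep]
    ring
  refine ⟨k + (y - pos η x n k), by linarith, by linarith, hfin, fun r' h2 h3 => ?_⟩
  have h4 := Nat.floor_le h2
  have h5 := Nat.lt_floor_add_one r'
  rcases h3.lt_or_eq with h6 | h6
  · have h7 : ⌊r'⌋₊ ≤ k := by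
      have : (⌊r'⌋₊ : ℝ) < k + 1 := by linarith
      have : ⌊r'⌋₊ < k + 1 := by exact_mod_cast this
      omega
    have h8 := ha ⌊r'⌋₊ (by omega)
    have h9 := ha (⌊r'⌋₊ + 1) (by omega)
    have h10 := hk2 ⌊r'⌋₊ h7
    rw [latticeWalk_eq η _ _ h4 h5]
    refine ⟨by nlinarith, ?_⟩
    rcases h7.lt_or_eq with h11 | h11
    · have h12 := hk2 (⌊r'⌋₊ + 1) (by omega)
      nlinarith
    · rw [h11] at h4 h5 ⊢
      rw [hstep]
      linarith
  · rw [h6, hfin]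
    exact ⟨(ha k (by omega)).trans hkk.le, le_rfl⟩

/-- Conversely, a crossing by a lattice walk contains a crossing of a box of the plane. It starts
from a point of the left face on a north-east edge, and ends when the right face is hit. -/
lemma exists_subset_horizontalCrossing (δ : ℝ) (u : ℝ × ℝ) {W h : ℝ} (hW : 1 ≤ W) {w : ℤ}
    (hw : W ≤ w) {T : ℕ} (hT : (T : ℝ) + 3 ≤ h) : ∃ c,
      {ω | shift c (arrowsOf δ ω) ∈ Cross w T} ⊆ horizontalCrossing δ u W h := by
  set X : ℤ := ⌈u.1⌉ with hX
  have hX1 : u.1 ≤ X := Int.le_ceil u.1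
  have hX2 : X < u.1 + 1 := Int.ceil_lt_add_one u.1
  obtain ⟨N, hpar, hN1, hN2⟩ := exists_even_site X (u.2 + 3)
  refine ⟨(X, N), fun ω hω => ?_⟩
  set η := arrowsOf δ ω with hη
  rw [Set.mem_ofPred_eq, mem_cross] at hω
  obtain ⟨τ, hτ, hcross⟩ := hω
  have hw0 : 0 ≤ w := by
    have : (0 : ℝ) ≤ w := by linarith
    exact_mod_cast this
  obtain ⟨s, hs, hs2, hend, hnonneg⟩ := exists_path_of_floor _ τ (hw0.trans hcross)
  have hpath : ∀ i, pos (shift (X, N) η) 0 s i = pos η X (s + N) i - X := fun i => by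
    rw [pos_shift, zero_add]
  have hreach : u.1 + W ≤ pos η X (s + N) (τ - s) := by
    have h1 : w ≤ pos η X (s + N) (τ - s) - X := by rw [← hpath, hend]; exact hcross
    have h2 : (w : ℝ) ≤ pos η X (s + N) (τ - s) - X := by exact_mod_cast h1
    linarith
  have hlow : ∀ i ≤ τ - s, u.1 ≤ pos η X (s + N) i := fun i hi => by
    have h1 := hnonneg i hi
    rw [hpath] at h1
    have h2 : (X : ℝ) ≤ pos η X (s + N) i := by exact_mod_cast (sub_nonneg.1 h1)
    linarith
  obtain ⟨r, hr0, hr1, hfin, hrange⟩ := exists_hit_of_pos (by linarith) hreach hlow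
  obtain ⟨q, hq⟩ : ∃ q : ℤ, X + (s + N) = 2 * q := ⟨(X + (s + N)) / 2, by omega⟩
  have hq' : (X : ℝ) + (s + N) = 2 * q := by exact_mod_cast hq
  obtain ⟨v, hv1, hv2⟩ : ∃ v : ℝ × ℝ, v.1 = u.1 ∧ v.2 = s + N - (X - u.1) :=
    ⟨(u.1, s + N - (X - u.1)), rfl, rfl⟩
  have hI : diagI v = q := by
    rw [diagI, Int.ceil_eq_iff, hv1, hv2]
    constructor <;> linarith
  have hJ : diagJ v = q - X := by
    rw [diagJ, Int.ceil_eq_iff, hv1, hv2]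
    push_cast
    constructor <;> linarith
  have htx : tipX v = X := by rw [tipX, hI, hJ]; ring
  have htn : tipN v = s + N := by rw [tipN, hI, hJ]; linarith
  have htn' : (tipN v : ℝ) = s + N := by rw [htn]; push_cast; ring
  have hsT : (s : ℝ) + r ≤ T := by
    have h1 : s + (τ - s) ≤ T := by omega
    have h2 : (s : ℝ) + (τ - s : ℕ) ≤ T := by exact_mod_cast h1
    linarith
  have hs0 : (0 : ℝ) ≤ s := Nat.cast_nonneg s
  have hbox : ∀ s', 0 ≤ s' → s' ≤ r + (X - u.1) →
      (walk (jump δ ω) v s', v.2 + s') ∈ box u W h := by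
    intro s' hs'0 hs'
    rw [jump_eq_steps]
    suffices hwalk : u.1 ≤ walk (steps η) v s' ∧ walk (steps η) v s' ≤ u.1 + W from
      ⟨hwalk.1, hwalk.2, by simp only; linarith, by simp only; linarith⟩
    rcases le_total (v.2 + s') (tipN v) with h1 | h1
    · obtain ⟨h2, h3⟩ := walk_mem_Icc_of_le (steps η) h1
      rw [htx, hv1] at h2 h3
      exact ⟨(le_min le_rfl hX1).trans h2, h3.trans (max_le (by linarith) (by linarith))⟩
    · rw [walk_of_ge _ h1, htn', htx, htn]
      exact hrange _ (by linarith) (by linarith)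
  refine ⟨v, ⟨⟨hv1.ge, by linarith, by linarith, by linarith⟩, hv1⟩, r + (X - u.1), by linarith,
    ⟨hbox _ (by linarith) le_rfl, ?_⟩, hbox⟩
  have h1 : v.2 + (r + (X - u.1)) = tipN v + r := by rw [htn', hv2]; ring
  simp only
  rw [jump_eq_steps, walk_of_ge _ (by rw [h1]; linarith), htx, h1, htn, add_sub_cancel_left]
  exact hfin

/-! ### Measurability of the vertical crossing probabilities -/

/-- A vertical crossing is checked at integer lattice times and at the final time. -/
lemma mem_verticalCrossing_iff_nat {δ w h : ℝ} (hw : 1 ≤ w) (hh : 2 ≤ h) {u : ℝ × ℝ}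
    {ω : Sample} : ω ∈ verticalCrossing δ u w h ↔ ∀ k : ℕ,
      u.1 ≤ latticeWalk (steps (ceilAt ⌊u.1 + w⌋ (arrowsOf δ ω))) (tipX (u.1 + w, u.2))
        (tipN (u.1 + w, u.2)) (min k (u.2 + h - tipN (u.1 + w, u.2))) := by
  rw [mem_verticalCrossing_iff (by linarith) (by linarith)]
  set η := ceilAt ⌊u.1 + w⌋ (arrowsOf δ ω)
  set v : ℝ × ℝ := (u.1 + w, u.2) with hv
  have htip := tipX_bounds v
  have htipN := tipN_bounds v
  set x := tipX v with hx
  set n := tipN v with hn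
  simp only [hv] at htip htipN
  set τ := u.2 + h - n with hτ
  have hτ0 : 0 ≤ τ := by linarith
  constructor
  · intro H k
    have h0 : 0 ≤ min (k : ℝ) τ := le_min (Nat.cast_nonneg k) hτ0
    have h1 : min (k : ℝ) τ ≤ τ := min_le_right _ _
    have := H (n - u.2 + min (k : ℝ) τ) (by linarith) (by linarith)
    rw [walk_of_ge _ (by simp only [hv]; linarith), ← hx, ← hn] at this
    convert this using 2
    simp only [hv]
    ring
  · intro H s hs0 hsh
    rcases le_total (v.2 + s) n with h1 | h1
    · exact (le_min (by simp only [hv]; linarith) (by linarith)).trans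
        (walk_mem_Icc_of_le (steps η) h1).1
    · rw [walk_of_ge _ h1]
      simp only [hv] at h1
      have hr0 : 0 ≤ u.2 + s - n := by linarith
      set r := u.2 + s - n with hr
      have hrτ : r ≤ τ := by linarith
      have h3 := Nat.floor_le hr0
      have h4 := Nat.lt_floor_add_one r
      set k := ⌊r⌋₊
      have hk := H k
      rw [min_eq_left (h3.trans hrτ), latticeWalk_natCast] at hk
      rw [latticeWalk_eq η x n h3 h4]
      rcases le_total ((k : ℝ) + 1) τ with h5 | h5
      · have hk1 := H (k + 1)
        push_cast at hk1
        rw [min_eq_left h5, show (k : ℝ) + 1 = ((k + 1 : ℕ) : ℝ) by push_cast; ring,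
          latticeWalk_natCast] at hk1
        nlinarith
      · have hk1 := H (k + 1)
        push_cast at hk1
        rw [min_eq_right h5, latticeWalk_eq_of_le η x n (h3.trans hrτ) h5] at hk1
        rcases le_total (pos η x n k : ℝ) (pos η x n (k + 1)) with h6 | h6 <;> nlinarith

lemma measurable_pos (x n : ℤ) (m : ℕ) : Measurable fun η : Arrows => pos η x n m := by
  refine measurable_to_countable' fun y => ?_
  refine DetBy.measurableSet (S := lightBox x n m) (Finset.finite_toSet _) fun η η' h hη => ?_
  have h1 : pos η x n m = y := hη
  exact (pos_congr_lightBox (fun z hz => h z hz) le_rfl).symm.trans h1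

lemma measurable_ceilAt (b : ℤ) : Measurable (ceilAt b) := by
  refine measurable_pi_lambda _ fun z => ?_
  by_cases h : z.1 ≤ b
  · simpa only [ceilAt, h, decide_true, Bool.true_and] using measurable_pi_apply z
  · simpa only [ceilAt, h, decide_false, Bool.false_and] using measurable_const

/-- The interpolated walk depends measurably on the arrows and on the time. -/
lemma measurable_latticeWalk (x n : ℤ) :
    Measurable fun p : Arrows × ℝ => latticeWalk (steps p.1) x n p.2 := by
  have h1 : Measurable fun p : Arrows × ℕ => (pos p.1 x n p.2 : ℝ) :=
    measurable_from_prod_countable_left fun k =>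
      (measurable_from_top (f := ((↑) : ℤ → ℝ))).comp (measurable_pos x n k)
  have hf : Measurable fun p : Arrows × ℝ => (p.1, ⌊p.2⌋₊) :=
    measurable_fst.prodMk (Nat.measurable_floor.comp measurable_snd)
  have hf1 : Measurable fun p : Arrows × ℝ => (p.1, ⌊p.2⌋₊ + 1) :=
    measurable_fst.prodMk ((measurable_from_top (f := fun k : ℕ => k + 1)).comp
      (Nat.measurable_floor.comp measurable_snd))
  have hc : Measurable fun p : Arrows × ℝ => ((⌊p.2⌋₊ : ℕ) : ℝ) :=
    (measurable_from_top (f := ((↑) : ℕ → ℝ))).comp (Nat.measurable_floor.comp measurable_snd)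
  exact (h1.comp hf).add ((measurable_snd.sub hc).mul ((h1.comp hf1).sub (h1.comp hf)))

lemma measurable_latticeWalk_ceilAt_prod : Measurable fun p : (ℤ × ℤ × ℤ) × (Arrows × ℝ) =>
    latticeWalk (steps (ceilAt p.1.1 p.2.1)) p.1.2.1 p.1.2.2 p.2.2 := by
  refine measurable_from_prod_countable_right fun c => ?_
  exact (measurable_latticeWalk c.2.1 c.2.2).comp
    (((measurable_ceilAt c.1).comp measurable_fst).prodMk measurable_snd)

lemma measurable_latticeWalk_ceilAt {β : Type*} [MeasurableSpace β] {b x n : β → ℤ}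
    {η : β → Arrows} {t : β → ℝ} (hb : Measurable b) (hx : Measurable x) (hn : Measurable n)
    (hη : Measurable η) (ht : Measurable t) :
    Measurable fun p => latticeWalk (steps (ceilAt (b p) (η p))) (x p) (n p) (t p) := by
  have hg : Measurable fun p => ((b p, x p, n p), η p, t p) :=
    (hb.prodMk (hx.prodMk hn)).prodMk (hη.prodMk ht)
  have := measurable_latticeWalk_ceilAt_prod.comp hg
  simpa only [Function.comp_def] using this

/-- The lower bound on the average of the vertical crossing probabilities in
`le_medianWidth_of_average_le` needs their measurability, since the average of a function that is
not integrable is `0`. -/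
lemma measurable_real_verticalCrossing {P : Measure Env} [IsProbabilityMeasure P] {δ w h : ℝ}
    (hw : 1 ≤ w) (hh : 2 ≤ h) :
    Measurable fun u : ℝ × ℝ => (annealed P).real (verticalCrossing δ u w h) := by
  have hI : Measurable diagI := Int.measurable_ceil.comp (by fun_prop)
  have hJ : Measurable diagJ := Int.measurable_ceil.comp (by fun_prop)
  have hX : Measurable tipX := hI.sub hJ
  have hN : Measurable tipN := hI.add hJ
  have hs : Measurable fun p : (ℝ × ℝ) × Sample => (p.1.1 + w, p.1.2) := by fun_prop
  have hset : MeasurableSet {p : (ℝ × ℝ) × Sample | p.2 ∈ verticalCrossing δ p.1 w h} := by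
    simp only [mem_verticalCrossing_iff_nat hw hh, Set.ofPred_forall]
    refine MeasurableSet.iInter fun k => measurableSet_le (by fun_prop) ?_
    have hcN : Measurable fun p : (ℝ × ℝ) × Sample => (tipN (p.1.1 + w, p.1.2) : ℝ) :=
      (measurable_from_top (f := ((↑) : ℤ → ℝ))).comp (hN.comp hs)
    have htime : Measurable fun p : (ℝ × ℝ) × Sample =>
        min (k : ℝ) (p.1.2 + h - tipN (p.1.1 + w, p.1.2)) :=
      measurable_const.min (((measurable_snd.comp measurable_fst).add_const h).sub hcN)
    have hfl : Measurable fun p : (ℝ × ℝ) × Sample => ⌊p.1.1 + w⌋ :=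
      Int.measurable_floor.comp (by fun_prop)
    exact measurable_latticeWalk_ceilAt hfl (hX.comp hs) (hN.comp hs)
      ((measurable_arrowsOf δ).comp measurable_snd) htime
  exact (measurable_measure_prodMk_left hset).ennreal_toReal

/-! ### Comparison of the fluctuation scale with the median width -/

lemma volume_rhombus_ne_zero : volume rhombus ≠ 0 := by
  have hopen : IsOpen {u : ℝ × ℝ | |u.1| + |u.2| < 1} := by
    apply isOpen_lt <;> fun_prop
  have hpos := hopen.measure_pos volume ⟨0, by simp⟩
  exact (hpos.trans_le (measure_mono fun u hu => le_of_lt (show |u.1| + |u.2| < 1 from hu))).ne'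

lemma volume_rhombus_ne_top : volume rhombus ≠ ⊤ := by
  have hb : Bornology.IsBounded rhombus := by
    refine (Metric.isBounded_closedBall (x := (0 : ℝ × ℝ)) (r := 1)).subset fun u hu => ?_
    have hu' : |u.1| + |u.2| ≤ 1 := hu
    rw [mem_closedBall_zero_iff, Prod.norm_def, Real.norm_eq_abs, Real.norm_eq_abs]
    exact max_le (by linarith [abs_nonneg u.2]) (by linarith [abs_nonneg u.1])
  exact hb.measure_lt_top.ne

/-- Measurability is not required: the average of a function that is not integrable is `0`. -/
lemma setAverage_le_of_le {f : ℝ × ℝ → ℝ} {c : ℝ} (h0 : ∀ u, 0 ≤ f u)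
    (hf : ∀ u, f u ≤ c) : ⨍ u in rhombus, f u ≤ c := by
  have := Fact.mk volume_rhombus_ne_top.lt_top
  have hne : NeZero (volume.restrict rhombus) :=
    ⟨by rw [Ne, Measure.restrict_eq_zero]; exact volume_rhombus_ne_zero⟩
  rw [average_eq']
  refine (integral_mono_of_nonneg (Filter.Eventually.of_forall h0) (integrable_const c)
    (Filter.Eventually.of_forall hf)).trans_eq ?_
  rw [← average_eq', average_const]

lemma le_setAverage_of_le {f : ℝ × ℝ → ℝ} {c : ℝ} (hfm : Measurable f) (h0 : ∀ u, 0 ≤ f u)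
    (h1 : ∀ u, f u ≤ 1) (hf : ∀ u, c ≤ f u) : c ≤ ⨍ u in rhombus, f u := by
  have := Fact.mk volume_rhombus_ne_top.lt_top
  have hne : NeZero (volume.restrict rhombus) :=
    ⟨by rw [Ne, Measure.restrict_eq_zero]; exact volume_rhombus_ne_zero⟩
  rw [average_eq']
  have hi : Integrable f (((volume.restrict rhombus) Set.univ)⁻¹ • volume.restrict rhombus) :=
    (integrable_const (1 : ℝ)).mono' hfm.aestronglyMeasurable
      (Filter.Eventually.of_forall fun u => by
        rw [Real.norm_eq_abs, abs_of_nonneg (h0 u)]; exact h1 u)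
  refine le_trans (Eq.ge ?_) (integral_mono (integrable_const c) hi hf)
  rw [← average_eq', average_const]

lemma real_arrowsOf {P : Measure Env} {δ : ℝ} {E : Set Arrows} (hE : MeasurableSet E) :
    (annealed P).real {ω | arrowsOf δ ω ∈ E} = (arrowLaw P δ).real E := by
  rw [arrowLaw, map_measureReal_apply (measurable_arrowsOf δ) hE]
  rfl

lemma real_shift_cross {P : Measure Env} {δ : ℝ} (hν : GoodLaw (arrowLaw P δ)) (c : ℤ × ℤ) (w : ℤ) (T : ℕ) :
    (annealed P).real {ω | shift c (arrowsOf δ ω) ∈ Cross w T} = crossProb (arrowLaw P δ) w T := by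
  rw [crossProb, ← hν.real_shift c (measurableSet_cross w T),
    ← real_arrowsOf (measurable_shift c (measurableSet_cross w T))]
  rfl

section Scale

variable {P : Measure Env} [IsProbabilityMeasure P] {δ : ℝ}

lemma real_horizontalCrossing_le (hν : GoodLaw (arrowLaw P δ)) (u : ℝ × ℝ) (w : ℝ) {h : ℝ} {T : ℕ}
    (hT : h + 3 ≤ T) : (annealed P).real (horizontalCrossing δ u w h) ≤
      crossProb (arrowLaw P δ) (⌊w⌋ - 2) T := by
  obtain ⟨c, hc⟩ := exists_horizontalCrossing_subset δ u w hT
  rw [← real_shift_cross hν c]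
  exact measureReal_mono hc

lemma le_real_verticalCrossing (hν : GoodLaw (arrowLaw P δ)) (u : ℝ × ℝ) {w h : ℝ} (hw : 1 ≤ w)
    (hh : 0 ≤ h) {T : ℕ} (hT : h + 3 ≤ T) : 1 - crossProb (arrowLaw P δ) (⌊w⌋ - 2) T ≤
      (annealed P).real (verticalCrossing δ u w h) := by
  obtain ⟨c, hc⟩ := exists_compl_verticalCrossing_subset δ u hw hh hT
  have hm := measurableSet_cross (⌊w⌋ - 2) T
  have h1 : (annealed P).real {ω | mirror (shift c (arrowsOf δ ω)) ∈ Cross (⌊w⌋ - 2) T}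
      = crossProb (arrowLaw P δ) (⌊w⌋ - 2) T := by
    rw [crossProb, ← hν.real_mirror hm, ← hν.real_shift c (measurable_mirror hm),
      ← real_arrowsOf (measurable_shift c (measurable_mirror hm))]
    rfl
  have h2 := measureReal_mono hc (μ := annealed P)
  have h3 := measureReal_union_le (μ := annealed P) (verticalCrossing δ u w h)
    (verticalCrossing δ u w h)ᶜ
  rw [Set.union_compl_self, probReal_univ] at h3
  linarith

lemma crossProb_le_real_horizontalCrossing (hν : GoodLaw (arrowLaw P δ)) (u : ℝ × ℝ) {W h : ℝ}
    (hW : 1 ≤ W) {w : ℤ} (hw : W ≤ w) {T : ℕ} (hT : (T : ℝ) + 3 ≤ h) :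
    crossProb (arrowLaw P δ) w T ≤ (annealed P).real (horizontalCrossing δ u W h) := by
  obtain ⟨c, hc⟩ := exists_subset_horizontalCrossing δ u hW hw hT
  rw [← real_shift_cross hν c]
  exact measureReal_mono hc

/-- The widths in the definition of the fluctuation scale are, up to rounding, at most the median
width. -/
lemma le_medianWidth_of_average_le (hν : GoodLaw (arrowLaw P δ)) {w h : ℝ} (hw : 1 ≤ w)
    (hh : 2 ≤ h) {T : ℕ} (hT : h + 3 ≤ T)
    (hav : ⨍ u in rhombus, (annealed P).real (verticalCrossing δ u w h) ≤
      ⨍ u in rhombus, (annealed P).real (horizontalCrossing δ u w h)) :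
    w - 3 ≤ medianWidth (arrowLaw P δ) T := by
  have hp := hν.isProb
  have h1 := le_setAverage_of_le (measurable_real_verticalCrossing (P := P) (δ := δ) hw hh)
    (fun _ => measureReal_nonneg) (fun _ => measureReal_le_one)
    fun u => le_real_verticalCrossing hν u hw (by linarith) hT
  have h2 := setAverage_le_of_le (c := crossProb (arrowLaw P δ) (⌊w⌋ - 2) T) (fun _ => measureReal_nonneg)
    fun u => real_horizontalCrossing_le hν u w hT
  have hR : 1 / 2 ≤ crossProb (arrowLaw P δ) (⌊w⌋ - 2) T := by linarith
  have hfl := Int.lt_floor_add_one w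
  rcases le_total (⌊w⌋ - 2) 0 with h3 | h3
  · have h4 : (⌊w⌋ : ℝ) - 2 ≤ 0 := by exact_mod_cast h3
    have h5 : (0 : ℝ) ≤ medianWidth (arrowLaw P δ) T := Nat.cast_nonneg _
    linarith
  · obtain ⟨m, hm⟩ := Int.eq_ofNat_of_zero_le h3
    rw [hm] at hR
    have h4 := le_medianWidth hR
    have h5 : (⌊w⌋ : ℝ) - 2 = m := by exact_mod_cast hm
    have h6 : (m : ℝ) ≤ medianWidth (arrowLaw P δ) T := by exact_mod_cast h4
    linarith

end Scale

/-! ### Crossings at a height of the order of the fluctuation scale -/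

/-- The supremum that defines a positive fluctuation scale is that of a nonempty bounded set. -/
lemma exists_average_le_of_lt_fluctuationScale {P : Measure Env} {δ h y : ℝ} (hy : 0 ≤ y)
    (hlt : y < fluctuationScale P δ h) : ∃ w, 1 ≤ w ∧ y < w ∧
      ⨍ u in rhombus, (annealed P).real (verticalCrossing δ u w h) ≤
        ⨍ u in rhombus, (annealed P).real (horizontalCrossing δ u w h) := by
  rw [fluctuationScale] at hlt
  obtain ⟨w, ⟨hw1, hw2⟩, hyw⟩ := exists_lt_of_lt_csSup (by
    by_contra hc
    rw [Set.not_nonempty_iff_eq_empty] at hc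
    rw [hc, Real.sSup_empty] at hlt
    linarith) hlt
  exact ⟨w, hw1, hyw, hw2⟩

lemma exists_horizontalCrossing_ge {ξ α c₁ : ℝ} (hξ₀ : 0 < ξ) (hξ₁ : ξ < 1) (hα : 1 + ξ⁻¹ < α)
    (hc₁ : 0 < c₁) : ∃ h₀ : ℝ, 0 < h₀ ∧ ∀ (P : Measure Env) (_ : IsProbabilityMeasure P) (δ : ℝ),
      MixingLaw (arrowLaw P δ) c₁ α → ∀ h : ℝ, h₀ ≤ h → h ^ ξ ≤ fluctuationScale P δ h →
        ∀ u : ℝ × ℝ, (1 / 256 : ℝ) ^ 2 ≤ (annealed P).real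
          (horizontalCrossing δ u (259 / 256 * fluctuationScale P δ h) (3 * h)) := by
  obtain ⟨T₀, hT₀⟩ := exists_crossProb_widen hξ₀ hα hc₁
  obtain ⟨h₁, hh₁⟩ := Filter.eventually_atTop.1
    ((tendsto_rpow_atTop hξ₀).eventually (Filter.eventually_ge_atTop 100))
  refine ⟨max (max h₁ T₀) 20, lt_max_of_lt_right (by norm_num), fun P hP δ hν h hh hscale u => ?_⟩
  have hh1 : h₁ ≤ h := ((le_max_left _ _).trans (le_max_left _ _)).trans hh
  have hhT : (T₀ : ℝ) ≤ h := ((le_max_right _ _).trans (le_max_left _ _)).trans hh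
  have hh20 : 20 ≤ h := (le_max_right _ _).trans hh
  have h100 : 100 ≤ h ^ ξ := hh₁ h hh1
  set W := fluctuationScale P δ h with hW
  have hW100 : 100 ≤ W := h100.trans hscale
  obtain ⟨w', hw'1, hw'2, hav⟩ := exists_average_le_of_lt_fluctuationScale (P := P) (δ := δ)
    (h := h) (y := 99 / 100 * W) (by linarith) (by rw [← hW]; linarith)
  -- the height of the lattice boxes that contain the boxes of height `h`
  set T := ⌈h⌉₊ + 3 with hT
  have hTh : h + 3 ≤ T := by rw [hT]; push_cast; linarith [Nat.le_ceil h]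
  have hTh' : (T : ℝ) ≤ h + 4 := by
    rw [hT]; push_cast; linarith [Nat.ceil_lt_add_one (show 0 ≤ h by linarith)]
  have hmed := le_medianWidth_of_average_le hν.toGoodLaw hw'1 (by linarith) hTh hav
  set M := medianWidth (arrowLaw P δ) T
  have hTξ : (T : ℝ) ^ ξ ≤ 4 * M := by
    have h1 : (T : ℝ) ^ ξ ≤ (2 * h) ^ ξ :=
      Real.rpow_le_rpow (Nat.cast_nonneg _) (by linarith) hξ₀.le
    have h2 : (2 : ℝ) ^ ξ ≤ 2 := by
      simpa using Real.rpow_le_rpow_of_exponent_le (show (1 : ℝ) ≤ 2 by norm_num) hξ₁.le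
    rw [Real.mul_rpow (by norm_num) (by linarith)] at h1
    have h3 : (2 : ℝ) ^ ξ * h ^ ξ ≤ 2 * h ^ ξ := mul_le_mul_of_nonneg_right h2 (by linarith)
    linarith
  set w := ⌈259 / 256 * W⌉₊ with hw
  have hw1 : 259 / 256 * W ≤ w := Nat.le_ceil _
  have hw2 : (w : ℝ) < 259 / 256 * W + 1 := Nat.ceil_lt_add_one (by linarith)
  set t := ⌊3 * h⌋₊ - 3 with ht
  have ht3 : 3 ≤ ⌊3 * h⌋₊ := Nat.le_floor (by push_cast; linarith)
  have ht' : (t : ℝ) = ⌊3 * h⌋₊ - 3 := by rw [ht, Nat.cast_sub ht3]; norm_num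
  have ht1 : (t : ℝ) + 3 ≤ 3 * h := by linarith [Nat.floor_le (show 0 ≤ 3 * h by linarith)]
  have ht2 : 3 * h - 4 < t := by linarith [Nat.lt_floor_add_one (3 * h)]
  refine (hT₀ _ hν T ?_ hTξ w t ?_ ?_).trans
    (crossProb_le_real_horizontalCrossing hν.toGoodLaw u (by linarith) (w := (w : ℤ)) ?_ ht1)
  · have : (T₀ : ℝ) ≤ T := by linarith
    exact_mod_cast this
  · have : (10 : ℝ) * w ≤ 12 * M := by linarith
    exact_mod_cast this
  · have : (22 : ℝ) * T ≤ 10 * t := by linarith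
    exact_mod_cast this
  · rw [Int.cast_natCast]; exact hw1

end RWDRE

end

theorem proposition4p6 (ξ α c₀ c₁ : ℝ) (hξ₀ : 0 < ξ) (hξ₁ : ξ < 1) (hα : 1 + ξ⁻¹ < α)
    (hc₀ : 0 < c₀) (hc₀' : c₀ < 1 / 2) (hc₁ : 0 < c₁) :
    ∃ h₀ : ℝ, 0 < h₀ ∧
      ∀ (P : MeasureTheory.Measure RWDRE.Env) (_ : MeasureTheory.IsProbabilityMeasure P)
        (ε : ℕ → ℕ → ℕ → ℝ) (δ : ℝ),
        RWDRE.TranslationInvariant P → RWDRE.ReflectionSymmetric P → RWDRE.FKG P →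
        RWDRE.Decoupling P ε →
        (∀ w h r : ℕ, 1 ≤ w → 1 ≤ h → 2 ≤ r →
          ε w h r ≤ c₁ * ((w : ℝ) * h + ((w : ℝ) + h) * r + (r : ℝ) ^ 2) * (r : ℝ) ^ (-α)) →
        0 ≤ δ → δ < 1 / 2 - c₀ →
        ∀ h : ℝ, h₀ ≤ h → h ^ ξ ≤ RWDRE.fluctuationScale P δ h →
          c₀ ^ 54 / 2 ^ 10 ≤ ⨅ u : ℝ × ℝ, (RWDRE.annealed P).real
            (RWDRE.horizontalCrossing δ u (259 / 256 * RWDRE.fluctuationScale P δ h)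
              (3 * h)) := by
  obtain ⟨h₀, hh₀, H⟩ := RWDRE.exists_horizontalCrossing_ge hξ₀ hξ₁ hα hc₁
  refine ⟨h₀, hh₀, fun P hP ε δ hT hR hF hD hε hδ _ h hh hscale => le_ciInf fun u => ?_⟩
  have hν := RWDRE.mixingLaw_arrowLaw (α := α) hT hR hF hD hε hδ
  refine le_trans ?_ (H P hP δ hν h hh hscale u)
  have hpow : c₀ ^ 54 ≤ (1 / 2) ^ 54 := pow_le_pow_left₀ hc₀.le hc₀'.le 54
  linarith
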